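/- Work in the category $\mathbf{CGH}$ of compactly generated Hausdorff spaces, in which all products and fibre products below are formed. A topological category $X$ is a category internal to $\mathbf{CGH}$, with space of objects $X_0$ and space of morphisms $X_1$; functors between topological categories are continuous on objects and on morphisms. The nerve $NX$ is the simplicial space whose $n$-simplices are the functors $[n]\to X$ (strings of $n$ composable morphisms), and $BX=|NX|$ denotes its geometric realization. For a space $S$, $\mathrm{disc}(S)$ is the topological category with space of objects $S$ and only identity morphisms; canonically $B\,\mathrm{disc}(S)\cong S$. A topological category $X$ is called well-pointed if $(X_1,X_0)$ is an NDR-pair over $X_0\times X_0$, where $X_0\subseteq X_1$ via identities and $X_1$ lies over $X_0\times X_0$ via (source, target): that is, there are continuous maps $u\colon X_1\to[0,1]$ and $h\colon X_1\times[0,1]\to X_1$ such that $h(a,t)$ has the same source and target as $a$ for all $a,t$; $X_0=u^{-1}(0)$; $h(a,0)=a$ for all $a$; $h(a,t)=a$ for all $a\in X_0$ and all $t$; and $h(a,1)\in X_0$ whenever $u(a)<1$. For a functor $f\colon X\to Y$ of topological categories, $Y_0\downarrow f$ is the topological category whose objects are the pairs $(g\colon a\to f(b),\,b)$ with $g\in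 Y_1$, $b\in X_0$, and whose morphisms $(g\colon a\to f(b),b)\to(g'\colon a\to f(b'),b')$ are the morphisms $h\colon b\to b'$ of $X$ with $f(h)\circ g=g'$; it is topologized as a limit in $\mathbf{CGH}$ (objects as $Y_1\times_{Y_0}X_0$, morphisms as the space of triples $(g,g',h)$ in $Y_1\times Y_1\times X_1$). Let $\rho\colon Y_0\downarrow f\to\mathrm{disc}(Y_0)$ be the functor $(g\colon a\to f(b),b)\mapsto a$. **Theorem A'.** Let $f\colon X\to Y$ be a functor between well-pointed topological categories. If $B\rho\colon B(Y_0\downarrow f)\to B\,\mathrm{disc}(Y_0)=Y_0$ is an acyclic Serre fibration (a Serre fibration that is also a weak homotopy equivalence), then $Bf\colon BX\to BY$ is a weak homotopy equivalence. -/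

import Mathlib

open CategoryTheory Topology
open scoped unitInterval CompactCoherentification

universe u

noncomputable section

/-- A continuous map from a k-space to `X` is continuous as a map to the k-ification of `X`. -/
theorem continuous_mk_comp_of_coherent {Z W : Type*} [TopologicalSpace Z] [TopologicalSpace W]
    [CompactlyCoherentSpace Z] {g : Z → W} (hg : Continuous g) :
    Continuous fun z => CompactCoherentification.mk W (g z) :=
  (CompactCoherentification.continuous_map_of_continuous hg).comp
    CompactCoherentification.continuous_mk

/-! ### Topological categories

Spaces are compactly generated Hausdorff spaces. A finite limit of such spaces is the usual
limit of topological spaces retopologized by `CompactCoherentification` (`𝐤`, the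
k-ification). -/

/-- A topological category: a category internal to compactly generated Hausdorff spaces.
Composition is written in diagrammatic order: `comp a b h` is "first `a`, then `b`"; it is
continuous on the space of composable pairs formed in compactly generated Hausdorff spaces. -/
structure TopologicalCategory : Type (u + 1) where
  /-- the space of objects -/
  Obj : Type u
  /-- the space of morphisms -/
  Mor : Type u
  [topObj : TopologicalSpace Obj]
  [topMor : TopologicalSpace Mor]
  [t2Obj : T2Space Obj]
  [t2Mor : T2Space Mor]
  [cgObj : CompactlyGeneratedSpace Obj]
  [cgMor : CompactlyGeneratedSpace Mor]
  /-- the source map -/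
  src : C(Mor, Obj)
  /-- the target map -/
  tgt : C(Mor, Obj)
  /-- the identity-assigning map -/
  ident : C(Obj, Mor)
  /-- composition of composable pairs -/
  comp (a b : Mor) (h : tgt a = src b) : Mor
  continuous_comp : Continuous fun p : 𝐤 {p : Mor × Mor // tgt p.1 = src p.2} =>
    comp ((CompactCoherentification.mk _).symm p).1.1 ((CompactCoherentification.mk _).symm p).1.2
      ((CompactCoherentification.mk _).symm p).2
  src_ident (x : Obj) : src (ident x) = x
  tgt_ident (x : Obj) : tgt (ident x) = x
  src_comp (a b : Mor) (h : tgt a = src b) : src (comp a b h) = src a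
  tgt_comp (a b : Mor) (h : tgt a = src b) : tgt (comp a b h) = tgt b
  ident_comp (a : Mor) : comp (ident (src a)) a (tgt_ident _) = a
  comp_ident (a : Mor) : comp a (ident (tgt a)) (src_ident _).symm = a
  assoc (a b c : Mor) (hab : tgt a = src b) (hbc : tgt b = src c) :
    comp (comp a b hab) c ((tgt_comp a b hab).trans hbc) =
      comp a (comp b c hbc) (hab.trans (src_comp b c hbc).symm)

attribute [instance] TopologicalCategory.topObj TopologicalCategory.topMor
  TopologicalCategory.t2Obj TopologicalCategory.t2Mor TopologicalCategory.cgObj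
  TopologicalCategory.cgMor

/-- A functor between topological categories: continuous on objects and on morphisms. -/
structure TopologicalFunctor (X Y : TopologicalCategory.{u}) where
  /-- the map on objects -/
  obj : C(X.Obj, Y.Obj)
  /-- the map on morphisms -/
  mor : C(X.Mor, Y.Mor)
  src_mor (a : X.Mor) : Y.src (mor a) = obj (X.src a)
  tgt_mor (a : X.Mor) : Y.tgt (mor a) = obj (X.tgt a)
  mor_ident (x : X.Obj) : mor (X.ident x) = Y.ident (obj x)
  mor_comp (a b : X.Mor) (h : X.tgt a = X.src b) :
    mor (X.comp a b h) =
      Y.comp (mor a) (mor b) ((tgt_mor a).trans ((congrArg obj h).trans (src_mor b).symm))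

/-! ### Well-pointed topological categories -/

/-- `(X, A)` is an NDR-pair over `B`, where `X` is a space over `B` via `p`. A map
`X → I × B` over `B` is the same as a map `u : X → I`, and its preimages of `{0} × B` and
`[0, 1) × B` are those of `{0}` and `[0, 1)` under `u`. -/
def IsNDRPairOver {X B : Type*} [TopologicalSpace X] (p : X → B) (A : Set X) : Prop :=
  ∃ (u : C(X, I)) (h : C(X × I, X)),
    (∀ x t, p (h (x, t)) = p x) ∧
    A = u ⁻¹' {0} ∧
    (∀ x, h (x, 0) = x) ∧
    (∀ a ∈ A, ∀ t, h (a, t) = a) ∧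
    ∀ x, u x < 1 → h (x, 1) ∈ A

namespace TopologicalCategory

/-- A topological category `X` is well-pointed if `(X₁, X₀)` is an NDR-pair over `X₀ × X₀`, where
`X₀` is regarded as a subspace of `X₁` by the identity-assigning map (which is a closed
embedding, with left inverse the source map), and `X₁` lies over `X₀ × X₀` by source and
target. -/
def IsWellPointed (X : TopologicalCategory.{u}) : Prop :=
  IsNDRPairOver (fun a : X.Mor => (X.src a, X.tgt a)) (Set.range X.ident)

end TopologicalCategory

/-! ### Simplicial spaces and geometric realization -/

/-- The space `∐ₙ Sₙ × Δⁿ`. (If `Sₙ` is compactly generated Hausdorff, so is the usual product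
`Sₙ × Δⁿ`, as `Δⁿ` is compact Hausdorff.) -/
abbrev PreRealization (S : SimplicialObject TopCat.{u}) : Type u :=
  Σ n : SimplexCategory, S.obj (Opposite.op n) × SimplexCategory.toTop₀.obj n

/-- The generating relation `(θ^* x, t) ∼ (x, θ_* t)` of the geometric realization. -/
inductive PreRealization.Rel (S : SimplicialObject TopCat.{u}) :
    PreRealization S → PreRealization S → Prop
  | glue {m n : SimplexCategory} (θ : m ⟶ n) (x : S.obj (Opposite.op n))
      (t : SimplexCategory.toTop₀.obj m) :
      PreRealization.Rel S ⟨m, S.map θ.op x, t⟩ ⟨n, x, SimplexCategory.toTop₀.map θ t⟩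

/-- The geometric realization of a simplicial space: the quotient of `∐ₙ Sₙ × Δⁿ` by the
equivalence relation generated by `(θ^* x, t) ∼ (x, θ_* t)`, with the quotient topology. -/
def GeometricRealization (S : SimplicialObject TopCat.{u}) : Type u :=
  Quot (PreRealization.Rel S)

instance (S : SimplicialObject TopCat.{u}) : TopologicalSpace (GeometricRealization S) :=
  inferInstanceAs (TopologicalSpace (Quot (PreRealization.Rel S)))

namespace GeometricRealization

/-- The point of the realization represented by an `n`-simplex and a point of `Δⁿ`. -/
def mk (S : SimplicialObject TopCat.{u}) (n : SimplexCategory) (x : S.obj (Opposite.op n))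
    (t : SimplexCategory.toTop₀.obj n) : GeometricRealization S :=
  Quot.mk _ ⟨n, x, t⟩

/-- The map of geometric realizations induced by a map of simplicial spaces:
`[x, t] ↦ [φ x, t]`. -/
def map {S T : SimplicialObject TopCat.{u}} (φ : S ⟶ T) :
    C(GeometricRealization S, GeometricRealization T) where
  toFun := Quot.lift (fun p => mk T p.1 (φ.app _ p.2.1) p.2.2) (by
    rintro _ _ ⟨θ, x, t⟩
    have h : φ.app _ (S.map θ.op x) = T.map θ.op (φ.app _ x) :=
      congrArg (fun g => g.hom x) (φ.naturality θ.op)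
    simp only [h]
    exact Quot.sound (PreRealization.Rel.glue θ _ t))
  continuous_toFun := by
    refine continuous_quot_lift _ (continuous_quot_mk.comp (continuous_sigma fun n => ?_))
    exact continuous_sigmaMk.comp
      (((φ.app _).hom.continuous.comp continuous_fst).prodMk continuous_snd)

end GeometricRealization

/-! ### The nerve and the classifying space -/

namespace TopologicalCategory

/-- Pairs `i ≤ j` in `[n] = {0 < ⋯ < n}`, i.e. the morphisms of the category `[n]`. -/
abbrev OrdMor (n : ℕ) : Type := {q : Fin (n + 1) × Fin (n + 1) // q.1 ≤ q.2}

/-- The conditions for `x` and `a` to be the object and morphism parts of a functor `[n] → X`. -/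
structure IsSimplex (X : TopologicalCategory.{u}) (n : ℕ)
    (p : (Fin (n + 1) → X.Obj) × (OrdMor n → X.Mor)) : Prop where
  src (q : OrdMor n) : X.src (p.2 q) = p.1 q.1.1
  tgt (q : OrdMor n) : X.tgt (p.2 q) = p.1 q.1.2
  ident (i : Fin (n + 1)) : p.2 ⟨(i, i), le_refl i⟩ = X.ident (p.1 i)
  comp (i j k : Fin (n + 1)) (hij : i ≤ j) (hjk : j ≤ k) :
    p.2 ⟨(i, k), hij.trans hjk⟩ =
      X.comp (p.2 ⟨(i, j), hij⟩) (p.2 ⟨(j, k), hjk⟩)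
        ((tgt ⟨(i, j), hij⟩).trans (src ⟨(j, k), hjk⟩).symm)

/-- The space of `n`-simplices of the nerve: the space of functors `[n] → X`, that is, of strings
of `n` composable morphisms together with all their composites. -/
abbrev NerveSpace (X : TopologicalCategory.{u}) (n : ℕ) : Type u :=
  𝐤 {p : (Fin (n + 1) → X.Obj) × (OrdMor n → X.Mor) // X.IsSimplex n p}

/-- A monotone map on morphisms. -/
def OrdMor.map {m n : ℕ} (θ : Fin (m + 1) →o Fin (n + 1)) (q : OrdMor m) : OrdMor n :=
  ⟨(θ q.1.1, θ q.1.2), θ.monotone q.2⟩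

/-- Precomposition of a functor `[n] → X` with a monotone map `[m] → [n]`. -/
def simplexRestrict (X : TopologicalCategory.{u}) {m n : ℕ} (θ : Fin (m + 1) →o Fin (n + 1))
    (p : {p : (Fin (n + 1) → X.Obj) × (OrdMor n → X.Mor) // X.IsSimplex n p}) :
    {p : (Fin (m + 1) → X.Obj) × (OrdMor m → X.Mor) // X.IsSimplex m p} :=
  ⟨(fun i => p.1.1 (θ i), fun q => p.1.2 (q.map θ)),
    ⟨fun q => p.2.src (q.map θ), fun q => p.2.tgt (q.map θ), fun i => p.2.ident (θ i),
      fun i j k hij hjk => p.2.comp (θ i) (θ j) (θ k) (θ.monotone hij) (θ.monotone hjk)⟩⟩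

theorem continuous_simplexRestrict (X : TopologicalCategory.{u}) {m n : ℕ}
    (θ : Fin (m + 1) →o Fin (n + 1)) : Continuous (X.simplexRestrict θ) := by
  unfold simplexRestrict
  fun_prop

/-- The nerve of a topological category, a simplicial space. -/
def nerve (X : TopologicalCategory.{u}) : SimplicialObject TopCat.{u} where
  obj n := TopCat.of (X.NerveSpace n.unop.len)
  map θ := TopCat.ofHom
    ⟨CompactCoherentification.map (X.simplexRestrict θ.unop.toOrderHom),
      CompactCoherentification.continuous_map_of_continuous (X.continuous_simplexRestrict _)⟩
  map_id _ := rfl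
  map_comp _ _ := rfl

/-- The classifying space `BX = |NX|`. -/
abbrev ClassifyingSpace (X : TopologicalCategory.{u}) : Type u := GeometricRealization X.nerve

end TopologicalCategory

namespace TopologicalFunctor

variable {X Y : TopologicalCategory.{u}}

/-- Postcomposition of a functor `[n] → X` with a functor `X → Y`. -/
def simplexMap (f : TopologicalFunctor X Y) (n : ℕ)
    (p : {p : (Fin (n + 1) → X.Obj) × (TopologicalCategory.OrdMor n → X.Mor) //
      X.IsSimplex n p}) :
    {p : (Fin (n + 1) → Y.Obj) × (TopologicalCategory.OrdMor n → Y.Mor) // Y.IsSimplex n p} :=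
  ⟨(fun i => f.obj (p.1.1 i), fun q => f.mor (p.1.2 q)),
    ⟨fun q => (f.src_mor _).trans (congrArg f.obj (p.2.src q)),
      fun q => (f.tgt_mor _).trans (congrArg f.obj (p.2.tgt q)),
      fun i => (congrArg f.mor (p.2.ident i)).trans (f.mor_ident _),
      fun i j k hij hjk => (congrArg f.mor (p.2.comp i j k hij hjk)).trans (f.mor_comp _ _ _)⟩⟩

theorem continuous_simplexMap (f : TopologicalFunctor X Y) (n : ℕ) :
    Continuous (f.simplexMap n) := by
  unfold simplexMap
  fun_prop

/-- The map of nerves induced by a functor. -/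
def nerveMap (f : TopologicalFunctor X Y) : X.nerve ⟶ Y.nerve where
  app n := TopCat.ofHom
    ⟨CompactCoherentification.map (f.simplexMap n.unop.len),
      CompactCoherentification.continuous_map_of_continuous (f.continuous_simplexMap _)⟩
  naturality _ _ _ := rfl

/-- The map `Bf : BX → BY` of classifying spaces induced by a functor `f : X → Y`. -/
def classifyingMap (f : TopologicalFunctor X Y) : C(X.ClassifyingSpace, Y.ClassifyingSpace) :=
  GeometricRealization.map f.nerveMap

end TopologicalFunctor

/-! ### Discrete categories -/

namespace TopologicalCategory

/-- The category `disc S` with space of objects `S` and only identity morphisms. -/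
def disc (S : Type u) [TopologicalSpace S] [T2Space S] [CompactlyGeneratedSpace S] :
    TopologicalCategory.{u} where
  Obj := S
  Mor := S
  src := ContinuousMap.id S
  tgt := ContinuousMap.id S
  ident := ContinuousMap.id S
  comp a _ _ := a
  continuous_comp :=
    (continuous_fst.comp continuous_subtype_val).comp CompactCoherentification.continuous_mk_symm
  src_ident _ := rfl
  tgt_ident _ := rfl
  src_comp _ _ _ := rfl
  tgt_comp _ _ h := h
  ident_comp _ := rfl
  comp_ident _ := rfl
  assoc _ _ _ _ _ := rfl

section Disc

variable (S : Type u) [TopologicalSpace S] [T2Space S] [CompactlyGeneratedSpace S]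

/-- The functor `[n] → disc S` that is constant at `s`. -/
def discSimplex (n : ℕ) (s : S) :
    {p : (Fin (n + 1) → (disc S).Obj) × (OrdMor n → (disc S).Mor) // (disc S).IsSimplex n p} :=
  ⟨(fun _ => s, fun _ => s), ⟨fun _ => rfl, fun _ => rfl, fun _ => rfl, fun _ _ _ _ _ => rfl⟩⟩

theorem continuous_discSimplex (n : ℕ) : Continuous (discSimplex S n) := by
  refine Continuous.subtype_mk ?_ _
  exact (continuous_pi fun _ => continuous_id).prodMk (continuous_pi fun _ => continuous_id)

theorem eq_discSimplex (n : ℕ)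
    (p : {p : (Fin (n + 1) → (disc S).Obj) × (OrdMor n → (disc S).Mor) //
      (disc S).IsSimplex n p}) : p = discSimplex S n (p.1.1 0) := by
  have hobj (i : Fin (n + 1)) : p.1.1 i = p.1.1 0 :=
    (p.2.tgt ⟨(0, i), Fin.zero_le i⟩).symm.trans (p.2.src ⟨(0, i), Fin.zero_le i⟩)
  refine Subtype.ext (Prod.ext (funext hobj) (funext fun q => ?_))
  exact (p.2.src q).trans (hobj q.1.1)

/-- The canonical map `B(disc S) → S`, sending the class of `(σ, t)` to the object on which
`σ : [n] → disc S` is constant. -/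
def discCollapse : C((disc S).ClassifyingSpace, S) where
  toFun := Quot.lift (fun p => ((CompactCoherentification.mk _).symm p.2.1).1.1 0) (by
    rintro _ _ ⟨θ, x, t⟩
    have h := eq_discSimplex S _ ((CompactCoherentification.mk _).symm x)
    exact congrArg (fun y => y.1.1 (θ.toOrderHom 0)) h)
  continuous_toFun := by
    refine continuous_quot_lift _ (continuous_sigma fun n => ?_)
    exact (continuous_apply (0 : Fin (n.len + 1))).comp (continuous_fst.comp
      (continuous_subtype_val.comp (CompactCoherentification.continuous_mk_symm.comp
        continuous_fst)))

/-- The canonical homeomorphism `B(disc S) ≃ S`. -/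
def discHomeo : (disc S).ClassifyingSpace ≃ₜ S where
  toFun := discCollapse S
  invFun s := GeometricRealization.mk (disc S).nerve (SimplexCategory.mk 0)
    (CompactCoherentification.mk _ (discSimplex S 0 s)) default
  left_inv := by
    rintro ⟨⟨n, x, t⟩⟩
    obtain ⟨y, rfl⟩ : ∃ y, CompactCoherentification.mk _ y = x :=
      ⟨(CompactCoherentification.mk _).symm x, rfl⟩
    have h := eq_discSimplex S _ y
    generalize y.1.1 0 = s at h
    subst h
    have key := Quot.sound (PreRealization.Rel.glue (S := (disc S).nerve)
      (SimplexCategory.const n (SimplexCategory.mk 0) 0)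
      (CompactCoherentification.mk _ (discSimplex S 0 s)) t)
    refine Eq.trans ?_ key.symm
    exact congrArg (GeometricRealization.mk (disc S).nerve (SimplexCategory.mk 0)
      (CompactCoherentification.mk _ (discSimplex S 0 s))) (Subsingleton.elim _ _)
  right_inv _ := rfl
  continuous_toFun := (discCollapse S).continuous
  continuous_invFun := by
    refine continuous_quot_mk.comp (continuous_sigmaMk.comp (Continuous.prodMk ?_ ?_))
    · exact CompactCoherentification.continuous_map_of_continuous
        (continuous_discSimplex S 0) |>.comp CompactCoherentification.continuous_mk
    · exact continuous_const

end Disc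

end TopologicalCategory

/-! ### The category `Y₀ ↓ f` -/

namespace TopologicalFunctor

variable {X Y : TopologicalCategory.{u}} (f : TopologicalFunctor X Y)

/-- The underlying set of objects of `Y₀ ↓ f`: pairs `(g : a → f b, b)`. -/
abbrev SliceObj : Type u := {p : Y.Mor × X.Obj // Y.tgt p.1 = f.obj p.2}

/-- The conditions on a triple `(g, g', h)`, with `g : a → f b`, `g' : a → f b'` and
`h : b → b'`, to be a morphism `(g, b) → (g', b')` of `Y₀ ↓ f`: the triangle formed by `g`,
`f h` and `g'` commutes. -/
structure IsSliceMor (p : Y.Mor × Y.Mor × X.Mor) : Prop where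
  tgt : Y.tgt p.1 = f.obj (X.src p.2.2)
  comm : Y.comp p.1 (f.mor p.2.2) (tgt.trans (f.src_mor _).symm) = p.2.1

/-- The underlying set of morphisms of `Y₀ ↓ f`. -/
abbrev SliceMor : Type u := {p : Y.Mor × Y.Mor × X.Mor // f.IsSliceMor p}

variable {f} in
theorem IsSliceMor.tgt' {p : Y.Mor × Y.Mor × X.Mor} (h : f.IsSliceMor p) :
    Y.tgt p.2.1 = f.obj (X.tgt p.2.2) := by
  rw [← h.comm, Y.tgt_comp, f.tgt_mor]

variable {f} in
theorem IsSliceMor.src' {p : Y.Mor × Y.Mor × X.Mor} (h : f.IsSliceMor p) :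
    Y.src p.2.1 = Y.src p.1 := by
  rw [← h.comm, Y.src_comp]

/-- The source `(g, b)` of a morphism of `Y₀ ↓ f`. -/
def sliceSrc (m : f.SliceMor) : f.SliceObj := ⟨(m.1.1, X.src m.1.2.2), m.2.tgt⟩

/-- The target `(g', b')` of a morphism of `Y₀ ↓ f`. -/
def sliceTgt (m : f.SliceMor) : f.SliceObj := ⟨(m.1.2.1, X.tgt m.1.2.2), m.2.tgt'⟩

/-- The identity of `(g, b)`. -/
def sliceIdent (o : f.SliceObj) : f.SliceMor :=
  ⟨(o.1.1, o.1.1, X.ident o.1.2), by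
    refine ⟨o.2.trans (congrArg f.obj (X.src_ident _).symm), ?_⟩
    have key : ∀ (c : Y.Mor) (hc : c = Y.ident (Y.tgt o.1.1)) (h : Y.tgt o.1.1 = Y.src c),
        Y.comp o.1.1 c h = o.1.1 := by
      rintro _ rfl _
      exact Y.comp_ident _
    exact key _ ((f.mor_ident _).trans (congrArg Y.ident o.2.symm)) _⟩

/-- Composition in `Y₀ ↓ f`: the composite of `(g, g', h)` and `(g', g'', k)` is
`(g, g'', h ≫ k)`. -/
def sliceComp (m m' : f.SliceMor) (h : f.sliceTgt m = f.sliceSrc m') : f.SliceMor :=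
  ⟨(m.1.1, m'.1.2.1, X.comp m.1.2.2 m'.1.2.2 (congrArg (fun o => o.1.2) h)), by
    have h₁ : m.1.2.1 = m'.1.1 := congrArg (fun o => o.1.1) h
    have h₂ : X.tgt m.1.2.2 = X.src m'.1.2.2 := congrArg (fun o => o.1.2) h
    refine ⟨m.2.tgt.trans (congrArg f.obj (X.src_comp _ _ _).symm), ?_⟩
    have key : ∀ (c : Y.Mor) (hc : c = Y.comp (f.mor m.1.2.2) (f.mor m'.1.2.2)
          ((f.tgt_mor _).trans ((congrArg f.obj h₂).trans (f.src_mor _).symm)))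
        (hh : Y.tgt m.1.1 = Y.src c), Y.comp m.1.1 c hh = m'.1.2.1 := by
      rintro _ rfl _
      rw [← Y.assoc _ _ _ (m.2.tgt.trans (f.src_mor _).symm), ← m'.2.comm]
      congr 1
      exact m.2.comm.trans h₁
    exact key _ (f.mor_comp _ _ h₂) _⟩

/-- The topological category `Y₀ ↓ f`. An object is a pair `(g : a → f b, b)`; a morphism
`(g : a → f b, b) → (g' : a → f b', b')` is a morphism `h : b → b'` of `X` with
`g' = f h ∘ g`. The spaces of objects and morphisms are the limits
`Y₁ ×_{Y₀} X₀` and `{(g, g', h)} ⊆ Y₁ × Y₁ × X₁` in compactly generated Hausdorff spaces. -/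
def slice : TopologicalCategory.{u} where
  Obj := 𝐤 f.SliceObj
  Mor := 𝐤 f.SliceMor
  src := ⟨CompactCoherentification.map f.sliceSrc,
    CompactCoherentification.continuous_map_of_continuous (by unfold sliceSrc; fun_prop)⟩
  tgt := ⟨CompactCoherentification.map f.sliceTgt,
    CompactCoherentification.continuous_map_of_continuous (by unfold sliceTgt; fun_prop)⟩
  ident := ⟨CompactCoherentification.map f.sliceIdent,
    CompactCoherentification.continuous_map_of_continuous (by unfold sliceIdent; fun_prop)⟩
  comp m m' h := CompactCoherentification.mk _
    (f.sliceComp ((CompactCoherentification.mk _).symm m) ((CompactCoherentification.mk _).symm m')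
      ((CompactCoherentification.mk _).injective h))
  continuous_comp := by
    have h₁ : Continuous fun p : 𝐤 {p : 𝐤 f.SliceMor × 𝐤 f.SliceMor //
        CompactCoherentification.map f.sliceTgt p.1 =
          CompactCoherentification.map f.sliceSrc p.2} =>
        ((CompactCoherentification.mk f.SliceMor).symm
          ((CompactCoherentification.mk _).symm p).1.1).1 :=
      continuous_subtype_val.comp (CompactCoherentification.continuous_mk_symm.comp
        (continuous_fst.comp (continuous_subtype_val.comp
          CompactCoherentification.continuous_mk_symm)))
    have h₂ : Continuous fun p : 𝐤 {p : 𝐤 f.SliceMor × 𝐤 f.SliceMor //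
        CompactCoherentification.map f.sliceTgt p.1 =
          CompactCoherentification.map f.sliceSrc p.2} =>
        ((CompactCoherentification.mk f.SliceMor).symm
          ((CompactCoherentification.mk _).symm p).1.2).1 :=
      continuous_subtype_val.comp (CompactCoherentification.continuous_mk_symm.comp
        (continuous_snd.comp (continuous_subtype_val.comp
          CompactCoherentification.continuous_mk_symm)))
    refine continuous_mk_comp_of_coherent (Continuous.subtype_mk ?_ _)
    refine h₁.fst.prodMk (h₂.snd.fst.prodMk ?_)
    exact X.continuous_comp.comp (continuous_mk_comp_of_coherent
      (Continuous.subtype_mk (h₁.snd.snd.prodMk h₂.snd.snd) fun p =>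
        congrArg (fun o => o.1.2) ((CompactCoherentification.mk f.SliceObj).injective
          ((CompactCoherentification.mk _).symm p).2)))
  src_ident o := congrArg (CompactCoherentification.mk f.SliceObj)
    (Subtype.ext (Prod.ext rfl (X.src_ident _)))
  tgt_ident o := congrArg (CompactCoherentification.mk f.SliceObj)
    (Subtype.ext (Prod.ext rfl (X.tgt_ident _)))
  src_comp m m' h := congrArg (CompactCoherentification.mk f.SliceObj)
    (Subtype.ext (Prod.ext rfl (X.src_comp _ _ _)))
  tgt_comp m m' h := congrArg (CompactCoherentification.mk f.SliceObj)
    (Subtype.ext (Prod.ext rfl (X.tgt_comp _ _ _)))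
  ident_comp m := congrArg (CompactCoherentification.mk f.SliceMor)
    (Subtype.ext (Prod.ext rfl (Prod.ext rfl (X.ident_comp _))))
  comp_ident m := congrArg (CompactCoherentification.mk f.SliceMor)
    (Subtype.ext (Prod.ext rfl (Prod.ext rfl (X.comp_ident _))))
  assoc _ _ _ _ _ := congrArg (CompactCoherentification.mk f.SliceMor)
    (Subtype.ext (Prod.ext rfl (Prod.ext rfl (X.assoc _ _ _ _ _))))

/-- The canonical functor `ρ : Y₀ ↓ f → disc Y₀`, sending `(g : a → f b, b)` to `a`. -/
def rho : TopologicalFunctor f.slice (TopologicalCategory.disc Y.Obj) where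
  obj := ⟨fun o => Y.src ((CompactCoherentification.mk f.SliceObj).symm o).1.1,
    Y.src.continuous.comp (continuous_fst.comp
      (continuous_subtype_val.comp CompactCoherentification.continuous_mk_symm))⟩
  mor := ⟨fun m => Y.src ((CompactCoherentification.mk f.SliceMor).symm m).1.1,
    Y.src.continuous.comp (continuous_fst.comp
      (continuous_subtype_val.comp CompactCoherentification.continuous_mk_symm))⟩
  src_mor _ := rfl
  tgt_mor m := ((CompactCoherentification.mk f.SliceMor).symm m).2.src'.symm
  mor_ident _ := rfl
  mor_comp _ _ _ := rfl

/-- The map `Bρ : B(Y₀ ↓ f) → B(disc Y₀) = Y₀`. -/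
def classifyingRho : C(f.slice.ClassifyingSpace, Y.Obj) :=
  (TopologicalCategory.discHomeo Y.Obj : C(_, Y.Obj)).comp f.rho.classifyingMap

end TopologicalFunctor

/-! ### Weak homotopy equivalences and Serre fibrations -/

section Homotopy

variable {E B : Type*} [TopologicalSpace E] [TopologicalSpace B]

/-- The map induced by `p` on sets of path components. -/
def zerothHomotopyMap (p : C(E, B)) : ZerothHomotopy E → ZerothHomotopy B :=
  Quotient.map p fun _ _ h => h.map p.continuous

/-- The map induced by `p` on homotopy groups. -/
def homotopyGroupMap (p : C(E, B)) (n : ℕ) (x : E) : π_ n E x → π_ n B (p x) :=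
  Quotient.map (fun γ => ⟨p.comp γ.1, fun y hy => congrArg p (γ.2 y hy)⟩)
    fun _ _ h => h.comp_continuousMap p

/-- A weak homotopy equivalence: a map inducing a bijection on path components and isomorphisms
on all homotopy groups at all base points. -/
def IsWeakHomotopyEquiv (p : C(E, B)) : Prop :=
  Function.Bijective (zerothHomotopyMap p) ∧
    ∀ (n : ℕ), 1 ≤ n → ∀ x : E, Function.Bijective (homotopyGroupMap p n x)

/-- A Serre fibration: a map with the homotopy lifting property for all cubes. -/
def IsSerreFibration (p : C(E, B)) : Prop :=
  ∀ (n : ℕ) (g : C(I^ (Fin n), E)) (H : C((I^ (Fin n)) × I, B)), (∀ y, H (y, 0) = p (g y)) →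
    ∃ K : C((I^ (Fin n)) × I, E), (∀ y, K (y, 0) = g y) ∧ ∀ z, p (K z) = H z

/-- An acyclic Serre fibration: a Serre fibration that is a weak homotopy equivalence. -/
def IsAcyclicSerreFibration (p : C(E, B)) : Prop :=
  IsSerreFibration p ∧ IsWeakHomotopyEquiv p

end Homotopy

end

/-!
The collage of `f` is the category whose objects are those of `X` and those of `Y`, which contains
`X` and `Y` as full subcategories, and in which the morphisms from an object `y` of `Y` to an object
`x` of `X` are the morphisms `y → f x` of `Y`, while there are none from `x` to `y`. Its classifying
space `M` plays the role of the mapping cylinder of `Bf`: it contains `BX` and `BY`, the functor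
that is the identity on `Y` and `f` on `X` induces a retraction of `M` to `BY`, and the inclusion of
`BX` in `M` is homotopic, over `BY`, to the composite of `Bf` with the inclusion of `BY`
(`exists_cylinder`). Therefore, `Bf` is a weak homotopy equivalence as soon as all maps from cubes
to `M` that send the boundary to `BX` can be deformed into `BX` relative to the boundary
(`CompressesCubes.isWeakHomotopyEquiv`).

The points of `M` that are represented by simplices with at most `r` vertices in `Y` form a closed
subspace `M_r` (`collageFil`). One has `M_0 = BX` (`isClosedEmbedding_inclX`, `range_inclX`), and
every map from a compact space to `M` has its image in some `M_r` (`exists_forall_mem_collageFil`).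
So it suffices to deform maps from cubes to `M_{r+1}` into `M_r`, relative to the preimage of `M_r`
(`exists_compression`).

The space `M_{r+1}` is obtained by attaching to `M_r` the space of all representatives with exactly
`r + 1` vertices in `Y` (`Stratum`, `isQuotientMap_stageMap`), along those in which one of these
vertices has weight zero or two consecutive ones are connected by an identity. The vertices in `X`
of such a representative, with the morphisms to them from the last vertex `y` in `Y`, form a simplex
of `Y₀ ↓ f`. Thus a point of `M_{r+1}` outside `M_r` consists of a string in `Y` that ends at some
`y`, of weights, and of a point of the cone on the fibre of `Bρ` over `y`; the coordinate in the
fibre is `Stratum.sliceCoord`. For a map from a cube to `M_{r+1}`, consider the part of the cube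
that does not come close to `M_r`. After a homotopy, the fibre coordinate matters only on a closed
subset of it. As an acyclic Serre fibration has the right lifting property with respect to the
inclusions of the boundaries of cubes (`IsAcyclicSerreFibration.liftsCubes`), the fibre coordinate
extends from this subset to a lift of the last vertex `y` on the whole part
(`LiftsCubes.exists_lift`). Moving along the cones towards this lift, one takes all weight away from
the vertices in `Y`, and the map is pushed into a neighbourhood of `M_r` (`exists_push`). The
homotopy that exhibits `(Y₁, Y₀)` as an NDR-pair over `Y₀ × Y₀` can be applied to the edges of the
strings, and shows that this neighbourhood can be deformed into `M_r` (`exists_retraction`).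

Whether two representatives define the same point of a geometric realization is decided by viewing
a point of the standard simplex as a partition of `[0, 1)` into intervals, so that a representative
gives a simplex for every increasing sequence of times (`GeometricRealization.mk_eq_mk_iff`).
-/

noncomputable section

/-! ### Filling boxes over a Serre fibration -/

section Boxes

/-- The open box in `K × I`: the bottom together with the walls over `dK`. -/
def openBox {K : Type*} (dK : Set K) : Set (K × I) := {q | q.2 = 0 ∨ q.1 ∈ dK}

/-- The reciprocal of the factor by which a point of the cube `I^N × I` has to be moved away from
the point `(1/2, …, 1/2, 2)` in order to hit the open box. -/
def boxScale {N : Type*} [Fintype N] (q : (N → I) × I) : ℝ :=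
  max ((2 - (q.2 : ℝ)) / 2) ‖fun i => 2 * (q.1 i : ℝ) - 1‖

/-- Radial projection of the cube `I^N × I` from `(1/2, …, 1/2, 2)`: at time `0` a point is
projected to the open box, and it comes back with unit speed in the scale factor. -/
def boxFlow {N : Type*} [Fintype N] (q : (N → I) × I) (t : ℝ) : (N → I) × I :=
  (fun i => Set.projIcc 0 1 zero_le_one
      (1 / 2 + max 1 (1 / boxScale q - t) * ((q.1 i : ℝ) - 1 / 2)),
    Set.projIcc 0 1 zero_le_one (2 - max 1 (1 / boxScale q - t) * (2 - (q.2 : ℝ))))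

/-- The time at which `boxFlow` returns to its starting point. -/
def boxTime {N : Type*} [Fintype N] (q : (N → I) × I) : I :=
  Set.projIcc 0 1 zero_le_one (1 / boxScale q - 1)

variable {N : Type*} [Fintype N]

theorem continuous_boxScale : Continuous (boxScale (N := N)) := by
  unfold boxScale; fun_prop

theorem half_le_boxScale (q : (N → I) × I) : 1 / 2 ≤ boxScale q := by
  refine le_max_of_le_left ?_
  have := q.2.2.2
  linarith

theorem boxScale_le_one (q : (N → I) × I) : boxScale q ≤ 1 := by
  refine max_le ?_ ?_
  · have := q.2.2.1
    linarith
  · refine (pi_norm_le_iff_of_nonneg zero_le_one).2 fun i => ?_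
    have h0 := (q.1 i).2.1
    have h1 := (q.1 i).2.2
    rw [Real.norm_eq_abs, abs_le]
    constructor <;> linarith

theorem boxScale_eq_one {q : (N → I) × I} (hq : q ∈ openBox (Cube.boundary N)) :
    boxScale q = 1 := by
  refine le_antisymm (boxScale_le_one q) ?_
  rcases hq with h | ⟨i, h⟩
  · refine le_max_of_le_left ?_
    simp [h]
  · refine le_max_of_le_right (le_trans ?_ (norm_le_pi_norm _ i))
    rcases h with h | h <;> (simp [h]; try norm_num)

theorem continuous_boxFlow :
    Continuous fun z : ((N → I) × I) × ℝ => boxFlow z.1 z.2 := by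
  have h : Continuous fun z : ((N → I) × I) × ℝ => 1 / boxScale z.1 := by
    refine continuous_const.div (continuous_boxScale.comp continuous_fst) fun z => ?_
    have := half_le_boxScale z.1
    linarith
  unfold boxFlow
  refine Continuous.prodMk (continuous_pi fun i => continuous_projIcc.comp ?_)
    (continuous_projIcc.comp ?_) <;> fun_prop

theorem one_le_inv_boxScale (q : (N → I) × I) : 1 ≤ 1 / boxScale q := by
  rw [le_div_iff₀ (by linarith [half_le_boxScale q])]
  linarith [boxScale_le_one q]

theorem boxTime_val (q : (N → I) × I) : (boxTime q : ℝ) = 1 / boxScale q - 1 := by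
  have h1 := one_le_inv_boxScale q
  have h2 : 1 / boxScale q ≤ 2 := by
    rw [div_le_iff₀ (by linarith [half_le_boxScale q])]
    linarith [half_le_boxScale q]
  exact congrArg Subtype.val (Set.projIcc_of_mem zero_le_one (x := 1 / boxScale q - 1)
    ⟨by linarith, by linarith⟩)

theorem continuous_boxTime : Continuous (boxTime (N := N)) := by
  refine continuous_projIcc.comp (Continuous.sub ?_ continuous_const)
  refine continuous_const.div continuous_boxScale fun z => ?_
  have := half_le_boxScale z
  linarith

theorem boxFlow_boxTime (q : (N → I) × I) : boxFlow q (boxTime q) = q := by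
  have h : max 1 (1 / boxScale q - (boxTime q : ℝ)) = 1 := by
    rw [boxTime_val]; norm_num
  unfold boxFlow
  rw [h]
  refine Prod.ext (funext fun i => ?_) ?_
  · have : (1 / 2 + 1 * ((q.1 i : ℝ) - 1 / 2)) = q.1 i := by ring
    simp only [this, Set.projIcc_val]
  · have : (2 - 1 * (2 - (q.2 : ℝ))) = q.2 := by ring
    simp only [this, Set.projIcc_val]

theorem boxTime_eq_zero {q : (N → I) × I} (hq : q ∈ openBox (Cube.boundary N)) :
    boxTime q = 0 := by
  refine Subtype.ext ?_
  rw [boxTime_val, boxScale_eq_one hq]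
  norm_num

theorem boxFlow_zero_eq_self {q : (N → I) × I} (hq : q ∈ openBox (Cube.boundary N)) :
    boxFlow q 0 = q := by
  have := boxFlow_boxTime q
  rwa [boxTime_eq_zero hq] at this

theorem boxFlow_zero_mem (q : (N → I) × I) : boxFlow q 0 ∈ openBox (Cube.boundary N) := by
  have hpos : 0 < boxScale q := by linarith [half_le_boxScale q]
  have hone := one_le_inv_boxScale q
  have hmax : max 1 (1 / boxScale q - 0) = 1 / boxScale q := by
    rw [sub_zero]; exact max_eq_right hone
  unfold boxFlow
  rw [hmax]
  rcases max_choice ((2 - (q.2 : ℝ)) / 2) ‖fun i => 2 * (q.1 i : ℝ) - 1‖ with h | h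
  · left
    have h' : boxScale q = (2 - (q.2 : ℝ)) / 2 := h
    refine Set.projIcc_of_le_left zero_le_one (le_of_eq ?_)
    have : 2 - (q.2 : ℝ) ≠ 0 := by linarith [q.2.2.2]
    rw [h']
    field_simp
    ring
  · right
    have h' : boxScale q = ‖fun i => 2 * (q.1 i : ℝ) - 1‖ := h
    have hne : Nonempty N := by
      by_contra hN
      rw [not_nonempty_iff] at hN
      have : ‖fun i => 2 * (q.1 i : ℝ) - 1‖ = 0 := by
        rw [Subsingleton.elim (fun i => 2 * (q.1 i : ℝ) - 1) 0, norm_zero]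
      linarith
    obtain ⟨i, hi'⟩ : ∃ i, |2 * (q.1 i : ℝ) - 1| = boxScale q := by
      by_contra! hlt
      refine lt_irrefl (boxScale q) (h'.trans_lt ((pi_norm_lt_iff hpos).2 fun i => ?_))
      exact lt_of_le_of_ne ((norm_le_pi_norm _ i).trans_eq h'.symm) (hlt i)
    refine ⟨i, ?_⟩
    rcases abs_choice (2 * (q.1 i : ℝ) - 1) with ha | ha
    · right
      refine Set.projIcc_of_right_le zero_le_one (le_of_eq ?_)
      rw [← hi', ha]
      rw [← hi', ha] at hpos
      field_simp
      ring
    · left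
      refine Set.projIcc_of_le_left zero_le_one (le_of_eq ?_)
      rw [← hi', ha]
      rw [← hi', ha] at hpos
      have : 2 * (q.1 i : ℝ) - 1 ≠ 0 := by linarith
      field_simp
      ring

attribute [irreducible] boxFlow boxTime

end Boxes

section Fibrations

variable {E B : Type*} [TopologicalSpace E] [TopologicalSpace B]

/-- Every partial lift over the open box in `K × I` extends to a lift over `K × I`. -/
def FillsBox (p : C(E, B)) {K : Type*} [TopologicalSpace K] (dK : Set K) : Prop :=
  ∀ (f : C(K × I, B)) (g : K × I → E), ContinuousOn g (openBox dK) →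
    (∀ q ∈ openBox dK, p (g q) = f q) →
    ∃ G : C(K × I, E), (∀ q ∈ openBox dK, G q = g q) ∧ ∀ q, p (G q) = f q

theorem FillsBox.of_homeomorph {p : C(E, B)} {K K' : Type*} [TopologicalSpace K]
    [TopologicalSpace K'] {dK : Set K} {dK' : Set K'} (e : K' ≃ₜ K)
    (he : ∀ x, e x ∈ dK ↔ x ∈ dK') (h : FillsBox p dK) : FillsBox p dK' := by
  intro f g hg hgf
  have hc : Continuous fun q : K × I => (e.symm q.1, q.2) := by fun_prop
  have hm : ∀ q ∈ openBox dK, ((e.symm q.1, q.2) : K' × I) ∈ openBox dK' := by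
    rintro q (hq | hq)
    · exact Or.inl hq
    · exact Or.inr ((he _).1 (by simpa using hq))
  obtain ⟨G, hG, hG'⟩ := h ⟨fun q => f (e.symm q.1, q.2), f.continuous.comp hc⟩
    (fun q => g (e.symm q.1, q.2)) (hg.comp hc.continuousOn hm) fun q hq => hgf _ (hm q hq)
  refine ⟨⟨fun q => G (e q.1, q.2), G.continuous.comp (by fun_prop)⟩, fun q hq => ?_, fun q => ?_⟩
  · have : ((e q.1, q.2) : K × I) ∈ openBox dK := hq.imp id (he _).2
    simpa using hG _ this
  · simpa using hG' (e q.1, q.2)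

/-- Splitting off the first coordinate of a cube. -/
def cubeSucc (n : ℕ) : (Fin (n + 1) → I) ≃ₜ (Fin n → I) × I where
  toFun y := (fun i => y i.succ, y 0)
  invFun q := Fin.cons q.2 q.1
  left_inv y := Fin.cons_self_tail y
  right_inv _ := rfl
  continuous_toFun := by fun_prop
  continuous_invFun := by
    refine continuous_pi fun i => Fin.cases ?_ (fun j => ?_) i
    · exact continuous_snd
    · exact (continuous_apply j).comp continuous_fst

/-- The boundary of the cube `I^n × I`. -/
def prodBoundary (n : ℕ) : Set ((Fin n → I) × I) :=
  {q | q.1 ∈ Cube.boundary (Fin n) ∨ q.2 = 0 ∨ q.2 = 1}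

theorem cubeSucc_mem_iff {n : ℕ} (y : Fin (n + 1) → I) :
    cubeSucc n y ∈ prodBoundary n ↔ y ∈ Cube.boundary (Fin (n + 1)) := by
  constructor
  · rintro (⟨i, h⟩ | h)
    · exact ⟨i.succ, h⟩
    · exact ⟨0, h⟩
  · rintro ⟨i, h⟩
    induction i using Fin.cases with
    | zero => exact Or.inr h
    | succ i => exact Or.inl ⟨i, h⟩

theorem isClosed_cubeBoundary (n : ℕ) : IsClosed (Cube.boundary (Fin n)) := by
  have : Cube.boundary (Fin n) = ⋃ i, {y : Fin n → I | y i = 0 ∨ y i = 1} := by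
    ext y; simp [Cube.boundary]
  rw [this]
  exact isClosed_iUnion_of_finite fun i =>
    (isClosed_eq (continuous_apply i) continuous_const).union
      (isClosed_eq (continuous_apply i) continuous_const)

theorem isClosed_openBox {K : Type*} [TopologicalSpace K] {dK : Set K} (h : IsClosed dK) :
    IsClosed (openBox dK) :=
  (isClosed_eq continuous_snd continuous_const).union (h.preimage continuous_fst)

/-- The pair (cube, open box) is a retract of the pair (`Q × I`, `Q × 0`) for the cube `Q`. -/
theorem IsSerreFibration.fillsBox {p : C(E, B)} (hp : IsSerreFibration p) (n : ℕ) :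
    FillsBox p (Cube.boundary (Fin n)) := by
  intro f g hg hgf
  have hc0 : Continuous fun y : Fin (n + 1) → I => ((cubeSucc n y, 0) : ((Fin n → I) × I) × ℝ) :=
    (cubeSucc n).continuous.prodMk continuous_const
  have hc1 : Continuous fun z : (Fin (n + 1) → I) × I =>
      ((cubeSucc n z.1, (z.2 : ℝ)) : ((Fin n → I) × I) × ℝ) :=
    ((cubeSucc n).continuous.comp continuous_fst).prodMk
      (continuous_subtype_val.comp continuous_snd)
  have h0 : Continuous fun y : Fin (n + 1) → I => g (boxFlow (cubeSucc n y) 0) :=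
    hg.comp_continuous (continuous_boxFlow.comp hc0) fun y => boxFlow_zero_mem (cubeSucc n y)
  have h1 : Continuous fun z : (Fin (n + 1) → I) × I => f (boxFlow (cubeSucc n z.1) z.2) :=
    f.continuous.comp (continuous_boxFlow.comp hc1)
  obtain ⟨K, hK0, hK⟩ := hp (n + 1) ⟨_, h0⟩ ⟨_, h1⟩ fun y => by
    simpa using (hgf _ (boxFlow_zero_mem (cubeSucc n y))).symm
  refine ⟨⟨fun q => K ((cubeSucc n).symm q, boxTime q), K.continuous.comp
    ((cubeSucc n).symm.continuous.prodMk continuous_boxTime)⟩, fun q hq => ?_, fun q => ?_⟩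
  · have := hK0 ((cubeSucc n).symm q)
    simp only [ContinuousMap.coe_mk, Homeomorph.apply_symm_apply, boxFlow_zero_eq_self hq] at this
    simpa [boxTime_eq_zero hq] using this
  · simpa [boxFlow_boxTime] using hK ((cubeSucc n).symm q, boxTime q)

theorem IsSerreFibration.fillsBox_prod {p : C(E, B)} (hp : IsSerreFibration p) (n : ℕ) :
    FillsBox p (prodBoundary n) :=
  (hp.fillsBox (n + 1)).of_homeomorph (cubeSucc n).symm fun q => by
    rw [← cubeSucc_mem_iff, Homeomorph.apply_symm_apply]

end Fibrations

/-! ### Acyclic Serre fibrations lift cubes relative to their boundary -/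

section Lifting

variable {E B : Type*} [TopologicalSpace E] [TopologicalSpace B]

/-- The right lifting property against the inclusions `∂I^n ⊆ I^n`; partial lifts are given by
functions whose values away from the boundary are irrelevant. -/
def LiftsCubes (p : C(E, B)) : Prop :=
  ∀ (n : ℕ) (f : C(Fin n → I, B)) (g : (Fin n → I) → E),
    ContinuousOn g (Cube.boundary (Fin n)) → (∀ y ∈ Cube.boundary (Fin n), p (g y) = f y) →
    ∃ G : C(Fin n → I, E), (∀ y ∈ Cube.boundary (Fin n), G y = g y) ∧ ∀ y, p (G y) = f y

/-- Injectivity on path components and homotopy groups: a loop in a fibre is null-homotopic in the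
total space. -/
theorem IsWeakHomotopyEquiv.exists_nullHomotopy {p : C(E, B)} (hp : IsWeakHomotopyEquiv p)
    (m : ℕ) (e : E) (γ : C(Fin m → I, E)) (hγ : ∀ y ∈ Cube.boundary (Fin m), γ y = e)
    (hpγ : ∀ y, p (γ y) = p e) :
    ∃ H : C((Fin m → I) × I, E), (∀ y, H (y, 0) = γ y) ∧ (∀ y, H (y, 1) = e) ∧
      ∀ y ∈ Cube.boundary (Fin m), ∀ t, H (y, t) = e := by
  rcases Nat.eq_zero_or_pos m with rfl | hm
  · let y₀ : Fin 0 → I := default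
    have h : Joined (γ y₀) e := by
      have : zerothHomotopyMap p (Quotient.mk _ (γ y₀)) = zerothHomotopyMap p (Quotient.mk _ e) :=
        congrArg (Quotient.mk _) (hpγ y₀)
      exact Quotient.exact (hp.1.1 this)
    obtain ⟨P⟩ := h
    refine ⟨⟨fun q => P q.2, P.continuous.comp continuous_snd⟩, fun y => ?_, fun y => ?_, ?_⟩
    · rw [Subsingleton.elim y y₀]; exact P.source
    · exact P.target
    · rintro y ⟨i, -⟩; exact i.elim0
  · let γ' : GenLoop (Fin m) E e := ⟨γ, hγ⟩
    have : homotopyGroupMap p m e (Quotient.mk _ γ') =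
        homotopyGroupMap p m e (Quotient.mk _ GenLoop.const) := by
      refine congrArg (Quotient.mk _) (Subtype.ext (ContinuousMap.ext fun y => hpγ y))
    obtain ⟨H⟩ : GenLoop.Homotopic γ' GenLoop.const := Quotient.exact ((hp.2 m hm e).1 this)
    refine ⟨⟨fun q => H (q.2, q.1), H.continuous.comp continuous_swap⟩, fun y => ?_, fun y => ?_,
      fun y hy t => ?_⟩
    · exact H.apply_zero y
    · exact H.apply_one y
    · exact (H.eq_fst t hy).trans (hγ y hy)

/-- Surjectivity on homotopy groups: a loop in the base is homotopic to the image of a loop. -/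
theorem IsWeakHomotopyEquiv.exists_loop {p : C(E, B)} (hp : IsWeakHomotopyEquiv p)
    (m : ℕ) (e : E) (h : C((Fin m → I) × I, B)) (hh : ∀ q ∈ prodBoundary m, h q = p e) :
    ∃ β : C((Fin m → I) × I, E), (∀ q ∈ prodBoundary m, β q = e) ∧
      ∃ K : C(((Fin m → I) × I) × I, B), (∀ q, K (q, 0) = h q) ∧ (∀ q, K (q, 1) = p (β q)) ∧
        ∀ q ∈ prodBoundary m, ∀ t, K (q, t) = p e := by
  let h' : GenLoop (Fin (m + 1)) B (p e) :=
    ⟨h.comp (cubeSucc m : C(_, _)), fun y hy => hh _ ((cubeSucc_mem_iff y).2 hy)⟩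
  obtain ⟨β', hβ'⟩ := (hp.2 (m + 1) (by omega) e).2 (Quotient.mk _ h')
  induction β' using Quotient.inductionOn with
  | _ β' =>
  obtain ⟨H⟩ : GenLoop.Homotopic _ h' := Quotient.exact hβ'
  have hb : ∀ q ∈ prodBoundary m, (cubeSucc m).symm q ∈ Cube.boundary (Fin (m + 1)) :=
    fun q hq => (cubeSucc_mem_iff _).1 (by rwa [Homeomorph.apply_symm_apply])
  refine ⟨β'.1.comp ((cubeSucc m).symm : C(_, _)), fun q hq => β'.2 _ (hb q hq),
    ⟨fun z => H (unitInterval.symm z.2, (cubeSucc m).symm z.1), by fun_prop⟩,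
    fun q => ?_, fun q => ?_, fun q hq t => ?_⟩
  · simp [h']
  · simp
  · refine (H.eq_fst _ (hb q hq)).trans ?_
    exact congrArg p (β'.2 _ (hb q hq))

/-- A loop in a fibre of an acyclic Serre fibration is null-homotopic within the fibre: a null
homotopy in the total space projects to a loop in the base, which is the image of a loop `β`, and
filling a box one wall of which is `β` corrects the null homotopy. -/
theorem IsAcyclicSerreFibration.exists_nullHomotopy {p : C(E, B)} (hp : IsAcyclicSerreFibration p)
    (m : ℕ) (e : E) (γ : C(Fin m → I, E)) (hγ : ∀ y ∈ Cube.boundary (Fin m), γ y = e)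
    (hpγ : ∀ y, p (γ y) = p e) :
    ∃ H : C((Fin m → I) × I, E), (∀ y, H (y, 0) = γ y) ∧ (∀ y, H (y, 1) = e) ∧
      (∀ y ∈ Cube.boundary (Fin m), ∀ t, H (y, t) = e) ∧ ∀ q, p (H q) = p e := by
  obtain ⟨H, H0, H1, Hb⟩ := hp.2.exists_nullHomotopy m e γ hγ hpγ
  obtain ⟨β, hβ, K, K0, K1, Kb⟩ := hp.2.exists_loop m e (p.comp H) (by
    rintro ⟨y, t⟩ (h | h | h)
    · exact congrArg p (Hb y h t)
    · obtain rfl : t = 0 := h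
      simp [H0, hpγ]
    · obtain rfl : t = 1 := h
      simp [H1])
  classical
  let g : ((Fin m → I) × I) × I → E := fun z =>
    if z.1.2 = 0 then H (z.1.1, unitInterval.symm z.2)
    else if z.1.2 = 1 then β (z.1.1, unitInterval.symm z.2) else e
  have g0 : ∀ z : ((Fin m → I) × I) × I, z.1.2 = 0 → g z = H (z.1.1, unitInterval.symm z.2) :=
    fun z hz => if_pos hz
  have g1 : ∀ z : ((Fin m → I) × I) × I, z.1.2 = 1 → g z = β (z.1.1, unitInterval.symm z.2) := by
    intro z hz
    simp [g, hz]
  have ge : ∀ z : ((Fin m → I) × I) × I, (z.2 = 0 ∨ z.1.1 ∈ Cube.boundary (Fin m)) → g z = e := by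
    intro z hz
    rcases eq_or_ne z.1.2 0 with h0 | h0
    · rw [g0 z h0]
      rcases hz with hz | hz
      · simp [hz, H1]
      · exact Hb _ hz _
    rcases eq_or_ne z.1.2 1 with h1 | h1
    · rw [g1 z h1]
      refine hβ _ ?_
      rcases hz with hz | hz
      · exact Or.inr (Or.inr (by simp [hz]))
      · exact Or.inl hz
    · simp [g, h0, h1]
  have hbox : openBox (prodBoundary m) = {z : ((Fin m → I) × I) × I | z.1.2 = 0} ∪
      ({z | z.1.2 = 1} ∪ {z | z.2 = 0 ∨ z.1.1 ∈ Cube.boundary (Fin m)}) := by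
    ext z
    simp only [openBox, prodBoundary, Set.mem_ofPred_eq, Set.mem_union]
    tauto
  have hcl0 : IsClosed {z : ((Fin m → I) × I) × I | z.1.2 = 0} :=
    isClosed_eq (by fun_prop) continuous_const
  have hcl1 : IsClosed {z : ((Fin m → I) × I) × I | z.1.2 = 1} :=
    isClosed_eq (by fun_prop) continuous_const
  have hcl2 : IsClosed {z : ((Fin m → I) × I) × I | z.2 = 0 ∨ z.1.1 ∈ Cube.boundary (Fin m)} :=
    (isClosed_eq (by fun_prop) continuous_const).union
      ((isClosed_cubeBoundary m).preimage (by fun_prop))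
  have hg : ContinuousOn g (openBox (prodBoundary m)) := by
    rw [hbox]
    refine ContinuousOn.union_of_isClosed ?_ (ContinuousOn.union_of_isClosed ?_ ?_ hcl1 hcl2) hcl0
      (hcl1.union hcl2)
    · refine ContinuousOn.congr (Continuous.continuousOn ?_) g0
      fun_prop
    · refine ContinuousOn.congr (Continuous.continuousOn ?_) g1
      fun_prop
    · exact ContinuousOn.congr continuousOn_const ge
  obtain ⟨G, hG, hGp⟩ := hp.1.fillsBox_prod m
    ⟨fun z => K ((z.1.1, unitInterval.symm z.2), z.1.2), by fun_prop⟩ g hg (by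
      intro z hz
      rw [hbox] at hz
      rcases hz with hz | hz | hz
      · change p (g z) = K ((z.1.1, unitInterval.symm z.2), z.1.2)
        rw [g0 z hz, show z.1.2 = 0 from hz, K0]; rfl
      · change p (g z) = K ((z.1.1, unitInterval.symm z.2), z.1.2)
        rw [g1 z hz, show z.1.2 = 1 from hz, K1]
      · rw [ge z hz]
        refine (Kb _ ?_ _).symm
        rcases hz with hz | hz
        · exact Or.inr (Or.inr (by simp [hz]))
        · exact Or.inl hz)
  have hmem : ∀ z, z ∈ openBox (prodBoundary m) ↔ (z.1.2 = 0 ∨ z.1.2 = 1 ∨ (z.2 = 0 ∨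
      z.1.1 ∈ Cube.boundary (Fin m))) := fun z => by rw [hbox]; rfl
  refine ⟨⟨fun q => G ((q.1, q.2), 1), by fun_prop⟩, fun y => ?_, fun y => ?_, fun y hy t => ?_,
    fun q => ?_⟩
  · rw [ContinuousMap.coe_mk, hG _ ((hmem _).2 (Or.inl rfl)), g0 _ rfl]
    simp [H0]
  · rw [ContinuousMap.coe_mk, hG _ ((hmem _).2 (Or.inr (Or.inl rfl))), g1 _ rfl]
    exact hβ _ (Or.inr (Or.inl (by simp)))
  · rw [ContinuousMap.coe_mk, hG _ ((hmem _).2 (Or.inr (Or.inr (Or.inr hy)))),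
      ge _ (Or.inr hy)]
  · exact (hGp (q, 1)).trans (Kb _ (Or.inr (Or.inl (by simp))) _)

/-- A contraction of the cube `I^n × I` to the centre of its bottom, which contracts the open box
within itself: everything is first pushed to the bottom. -/
def boxContract (n : ℕ) (q : (Fin n → I) × I) (t : I) : (Fin n → I) × I :=
  (fun i => Set.projIcc 0 1 zero_le_one
      (1 / 2 + (1 - max 0 (2 * (t : ℝ) - 1)) * ((q.1 i : ℝ) - 1 / 2)),
    Set.projIcc 0 1 zero_le_one (q.2 - 2 * (t : ℝ)))

theorem continuous_boxContract (n : ℕ) :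
    Continuous fun z : ((Fin n → I) × I) × I => boxContract n z.1 z.2 := by
  unfold boxContract
  refine Continuous.prodMk (continuous_pi fun i => continuous_projIcc.comp ?_)
    (continuous_projIcc.comp ?_) <;> fun_prop

theorem boxContract_zero (n : ℕ) (q : (Fin n → I) × I) : boxContract n q 0 = q := by
  refine Prod.ext (funext fun i => ?_) ?_ <;> simp [boxContract]

theorem boxContract_one (n : ℕ) (q q' : (Fin n → I) × I) :
    boxContract n q 1 = boxContract n q' 1 := by
  have h : ∀ q : (Fin n → I) × I, (boxContract n q 1).2 = 0 := fun q =>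
    Set.projIcc_of_le_left zero_le_one (by have := q.2.2.2; simp; linarith)
  refine Prod.ext (funext fun i => ?_) ((h q).trans (h q').symm)
  simp [boxContract]
  norm_num

theorem boxContract_mem (n : ℕ) {q : (Fin n → I) × I} (hq : q ∈ openBox (Cube.boundary (Fin n)))
    (t : I) : boxContract n q t ∈ openBox (Cube.boundary (Fin n)) := by
  have ht0 := t.2.1
  rcases hq with h | ⟨i, h⟩
  · exact Or.inl (Set.projIcc_of_le_left zero_le_one (by simp [h]; exact ht0))
  · rcases le_total (2 * (t : ℝ) - 1) 0 with ht | ht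
    · right
      refine ⟨i, ?_⟩
      rcases h with h | h
      · left; simp [boxContract, h, max_eq_left ht]
      · right; simp [boxContract, h, max_eq_left ht]
    · left
      have := q.2.2.2
      exact Set.projIcc_of_le_left zero_le_one (by linarith)

attribute [irreducible] boxContract

/-- The lifting property for the cube `I^m × I`. The contraction `boxContract` moves the lifting
problem to a single fibre, where it becomes the problem of contracting a loop. -/
theorem IsAcyclicSerreFibration.exists_lift_prod {p : C(E, B)} (hp : IsAcyclicSerreFibration p)
    (m : ℕ) (f : C((Fin m → I) × I, B)) (g : (Fin m → I) × I → E)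
    (hg : ContinuousOn g (prodBoundary m)) (hgf : ∀ q ∈ prodBoundary m, p (g q) = f q) :
    ∃ G : C((Fin m → I) × I, E), (∀ q ∈ prodBoundary m, G q = g q) ∧ ∀ q, p (G q) = f q := by
  classical
  have hsub : openBox (Cube.boundary (Fin m)) ⊆ prodBoundary m := by
    rintro q (h | h)
    · exact Or.inr (Or.inl h)
    · exact Or.inl h
  set c := boxContract m with hc
  have hcc : Continuous fun z : ((Fin m → I) × I) × I => c z.1 z.2 := continuous_boxContract m
  have hcb : ∀ {q}, q ∈ openBox (Cube.boundary (Fin m)) → ∀ t, c q t ∈ prodBoundary m :=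
    fun hq t => hsub (boxContract_mem m hq t)
  -- lift the contraction of the base over the top face, where it starts at `g`
  let gA : (Fin m → I) × I → E := fun z => if z.2 = 0 then g (z.1, 1) else g (c (z.1, 1) z.2)
  have gA0 : ∀ z : (Fin m → I) × I, z.2 = 0 → gA z = g (z.1, 1) := fun z hz => if_pos hz
  have gAb : ∀ z : (Fin m → I) × I, z.1 ∈ Cube.boundary (Fin m) → gA z = g (c (z.1, 1) z.2) := by
    intro z hz
    rcases eq_or_ne z.2 0 with h | h
    · rw [gA0 z h, h, hc, boxContract_zero]
    · exact if_neg h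
  have hgA : ContinuousOn gA (openBox (Cube.boundary (Fin m))) := by
    refine ContinuousOn.union_of_isClosed (s := {q : (Fin m → I) × I | q.2 = 0})
      (t := {q | q.1 ∈ Cube.boundary (Fin m)}) ?_ ?_ (isClosed_eq continuous_snd continuous_const)
      ((isClosed_cubeBoundary m).preimage continuous_fst)
    · refine ContinuousOn.congr ?_ gA0
      exact hg.comp (by fun_prop) fun z _ => Or.inr (Or.inr rfl)
    · refine ContinuousOn.congr ?_ gAb
      refine hg.comp (Continuous.continuousOn ?_) fun z hz =>
        hcb (q := (z.1, 1)) (Or.inr hz) _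
      exact hcc.comp (by fun_prop : Continuous fun z : (Fin m → I) × I => ((z.1, (1 : I)), z.2))
  have hfc : Continuous fun z : ((Fin m → I) × I) × I => f (c z.1 z.2) := f.continuous.comp hcc
  obtain ⟨a, ha, hap⟩ := hp.1.fillsBox m ⟨fun z => f (c (z.1, 1) z.2), hfc.comp
      (by fun_prop : Continuous fun z : (Fin m → I) × I => ((z.1, (1 : I)), z.2))⟩ gA hgA (by
    rintro z (hz | hz)
    · change p (gA z) = f (c (z.1, 1) z.2)
      rw [gA0 z hz, hz, hc, boxContract_zero]
      exact hgf _ (Or.inr (Or.inr rfl))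
    · change p (gA z) = f (c (z.1, 1) z.2)
      rw [gAb z hz]
      exact hgf _ (hcb (q := (z.1, 1)) (Or.inr hz) _))
  -- at the end of the contraction there is a loop in the fibre, which is null-homotopic
  let q₀ : (Fin m → I) × I := (fun _ => 0, 0)
  set o := c q₀ 1
  have ho : ∀ q, c q 1 = o := fun q => boxContract_one m q q₀
  have hom : o ∈ prodBoundary m := hcb (Or.inl rfl) 1
  obtain ⟨ν, ν0, ν1, νb, νp⟩ := hp.exists_nullHomotopy m (g o) ⟨fun y => a (y, 1), by fun_prop⟩
    (fun y hy => by
      rw [ContinuousMap.coe_mk, ha _ (Or.inr hy), gAb _ hy, ho])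
    (fun y => (hap _).trans (by
      rw [hgf _ hom, ContinuousMap.coe_mk, ho]))
  -- a box in one dimension higher transports this back to a lift of `f`
  let gB : ((Fin m → I) × I) × I → E := fun z =>
    if z.2 = 0 then ν (z.1.1, unitInterval.symm z.1.2)
    else if z.1.2 = 1 then a (z.1.1, unitInterval.symm z.2) else g (c z.1 (unitInterval.symm z.2))
  have gB0 : ∀ z : ((Fin m → I) × I) × I, z.2 = 0 → gB z = ν (z.1.1, unitInterval.symm z.1.2) :=
    fun z hz => if_pos hz
  have gB1 : ∀ z : ((Fin m → I) × I) × I, z.1.2 = 1 →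
      gB z = a (z.1.1, unitInterval.symm z.2) := by
    intro z hz
    rcases eq_or_ne z.2 0 with h | h
    · rw [gB0 z h, hz, h]
      simp [ν0]
    · simp [gB, h, hz]
  have gBb : ∀ z : ((Fin m → I) × I) × I, z.1 ∈ openBox (Cube.boundary (Fin m)) →
      gB z = g (c z.1 (unitInterval.symm z.2)) := by
    intro z hz
    rcases eq_or_ne z.2 0 with h | h
    · rw [gB0 z h, h]
      simp only [unitInterval.symm_zero, ho]
      rcases hz with hz | hz
      · rw [hz]; simp [ν1]
      · exact νb _ hz _
    rcases eq_or_ne z.1.2 1 with h1 | h1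
    · rw [gB1 z h1]
      have hz' : z.1.1 ∈ Cube.boundary (Fin m) := by
        rcases hz with hz | hz
        · rw [h1] at hz; exact absurd hz one_ne_zero
        · exact hz
      rw [ha (z.1.1, unitInterval.symm z.2) (Or.inr hz'),
        gAb (z.1.1, unitInterval.symm z.2) hz', ← h1]
    · simp [gB, h, h1]
  have hbox : openBox (prodBoundary m) = {z : ((Fin m → I) × I) × I | z.2 = 0} ∪
      ({z | z.1.2 = 1} ∪ {z | z.1 ∈ openBox (Cube.boundary (Fin m))}) := by
    ext z
    simp only [openBox, prodBoundary, Set.mem_ofPred_eq, Set.mem_union]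
    tauto
  have hcl0 : IsClosed {z : ((Fin m → I) × I) × I | z.2 = 0} :=
    isClosed_eq (by fun_prop) continuous_const
  have hcl1 : IsClosed {z : ((Fin m → I) × I) × I | z.1.2 = 1} :=
    isClosed_eq (by fun_prop) continuous_const
  have hcl2 : IsClosed {z : ((Fin m → I) × I) × I | z.1 ∈ openBox (Cube.boundary (Fin m))} :=
    (isClosed_openBox (isClosed_cubeBoundary m)).preimage continuous_fst
  have hcs : Continuous fun z : ((Fin m → I) × I) × I => c z.1 (unitInterval.symm z.2) :=
    hcc.comp (by fun_prop : Continuous fun z : ((Fin m → I) × I) × I =>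
      (z.1, unitInterval.symm z.2))
  have hgB : ContinuousOn gB (openBox (prodBoundary m)) := by
    rw [hbox]
    refine ContinuousOn.union_of_isClosed ?_ (ContinuousOn.union_of_isClosed ?_ ?_ hcl1 hcl2) hcl0
      (hcl1.union hcl2)
    · refine ContinuousOn.congr (Continuous.continuousOn ?_) gB0
      fun_prop
    · refine ContinuousOn.congr (Continuous.continuousOn ?_) gB1
      fun_prop
    · refine ContinuousOn.congr ?_ gBb
      exact hg.comp hcs.continuousOn fun z hz => hcb hz _
  obtain ⟨G, hG, hGp⟩ := hp.1.fillsBox_prod m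
    ⟨fun z => f (c z.1 (unitInterval.symm z.2)), f.continuous.comp hcs⟩ gB hgB (by
      intro z hz
      rw [hbox] at hz
      rcases hz with hz | hz | hz
      · change p (gB z) = f (c z.1 (unitInterval.symm z.2))
        rw [gB0 z hz, νp, show z.2 = 0 from hz, unitInterval.symm_zero, ho, hgf _ hom]
      · change p (gB z) = f (c z.1 (unitInterval.symm z.2))
        rw [gB1 z hz, hap, ContinuousMap.coe_mk, ← show z.1.2 = 1 from hz]
      · change p (gB z) = f (c z.1 (unitInterval.symm z.2))
        rw [gBb z hz]
        exact hgf _ (hcb hz _))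
  refine ⟨⟨fun q => G (q, 1), by fun_prop⟩, fun q hq => ?_, fun q => ?_⟩
  · rw [ContinuousMap.coe_mk, hG _ (Or.inr hq)]
    by_cases hq' : q ∈ openBox (Cube.boundary (Fin m))
    · rw [gBb _ hq']
      simp [hc, boxContract_zero]
    · have h1 : q.2 = 1 := by
        simp only [openBox, prodBoundary, Set.mem_ofPred_eq] at hq hq'
        tauto
      rw [gB1 _ h1]
      simp only [unitInterval.symm_one]
      rw [ha _ (Or.inl rfl), gA0 _ rfl, ← h1]
  · exact (hGp (q, 1)).trans (by simp [hc, boxContract_zero])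

theorem IsAcyclicSerreFibration.surjective {p : C(E, B)} (hp : IsAcyclicSerreFibration p) :
    Function.Surjective p := by
  intro b
  obtain ⟨e, he⟩ := hp.2.1.2 (Quotient.mk _ b)
  induction e using Quotient.inductionOn with
  | _ e =>
  obtain ⟨P⟩ : Joined (p e) b := Quotient.exact he
  obtain ⟨K, -, hK⟩ := hp.1 0 ⟨fun _ => e, continuous_const⟩
    ⟨fun z => P z.2, P.continuous.comp continuous_snd⟩ fun y => by simp
  exact ⟨K (default, 1), by simp [hK]⟩

theorem IsAcyclicSerreFibration.liftsCubes {p : C(E, B)} (hp : IsAcyclicSerreFibration p) :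
    LiftsCubes p := by
  intro n f g hg hgf
  cases n with
  | zero =>
    obtain ⟨e, he⟩ := hp.surjective (f default)
    refine ⟨⟨fun _ => e, continuous_const⟩, ?_, fun y => ?_⟩
    · rintro y ⟨i, -⟩; exact i.elim0
    · rw [Subsingleton.elim y default]; exact he
  | succ m =>
    have hb : ∀ q ∈ prodBoundary m, (cubeSucc m).symm q ∈ Cube.boundary (Fin (m + 1)) :=
      fun q hq => (cubeSucc_mem_iff _).1 (by rwa [Homeomorph.apply_symm_apply])
    obtain ⟨G, hG, hGp⟩ := hp.exists_lift_prod m (f.comp ((cubeSucc m).symm : C(_, _)))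
      (fun q => g ((cubeSucc m).symm q)) (hg.comp (cubeSucc m).symm.continuous.continuousOn hb)
      fun q hq => hgf _ (hb q hq)
    refine ⟨G.comp (cubeSucc m : C(_, _)), fun y hy => ?_, fun y => ?_⟩
    · simpa using hG _ ((cubeSucc_mem_iff y).2 hy)
    · simpa using hGp (cubeSucc m y)

end Lifting

/-! ### A criterion for weak homotopy equivalences -/

section Compression

variable {E B : Type*} [TopologicalSpace E] [TopologicalSpace B]

/-- Every map of pairs from `(I^n, ∂I^n)` to the mapping cylinder of `p` can be compressed into
the source of `p`, relative to `∂I^n`. -/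
def CompressesCubes (p : C(E, B)) : Prop :=
  ∀ (n : ℕ) (φ : C(Fin n → I, B)) (g : C(Cube.boundary (Fin n), E)), (∀ y, p (g y) = φ y) →
    ∃ G : C(Fin n → I, E), (∀ y : Cube.boundary (Fin n), G y = g y) ∧
      (p.comp G).HomotopicRel φ (Cube.boundary (Fin n))

/-- Homotopies relative to the boundary of the cube lift along a map that compresses cubes. -/
theorem CompressesCubes.exists_homotopy {p : C(E, B)} (hp : CompressesCubes p) {n : ℕ}
    (γ₀ γ₁ : C(Fin n → I, E)) (hγ : ∀ y ∈ Cube.boundary (Fin n), γ₀ y = γ₁ y)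
    (h : (p.comp γ₀).HomotopicRel (p.comp γ₁) (Cube.boundary (Fin n))) :
    γ₀.HomotopicRel γ₁ (Cube.boundary (Fin n)) := by
  classical
  obtain ⟨H⟩ := h
  let g : (Fin n → I) × I → E := fun q => if q.2 = 1 then γ₁ q.1 else γ₀ q.1
  have g1 : ∀ q : (Fin n → I) × I, q.2 = 1 → g q = γ₁ q.1 := fun q hq => if_pos hq
  have g0 : ∀ q : (Fin n → I) × I, (q.2 = 0 ∨ q.1 ∈ Cube.boundary (Fin n)) → g q = γ₀ q.1 := by
    intro q hq
    by_cases h : q.2 = 1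
    · rw [g1 q h]
      rcases hq with hq | hq
      · rw [hq] at h; exact absurd h zero_ne_one
      · exact (hγ _ hq).symm
    · exact if_neg h
  have hbd : prodBoundary n = {q : (Fin n → I) × I | q.2 = 1} ∪
      {q | q.2 = 0 ∨ q.1 ∈ Cube.boundary (Fin n)} := by
    ext q
    simp only [prodBoundary, Set.mem_ofPred_eq, Set.mem_union]
    tauto
  have hg : ContinuousOn g (prodBoundary n) := by
    rw [hbd]
    refine ContinuousOn.union_of_isClosed
      (ContinuousOn.congr (Continuous.continuousOn (by fun_prop)) g1)
      (ContinuousOn.congr (Continuous.continuousOn (by fun_prop)) g0)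
      (isClosed_eq continuous_snd continuous_const)
      ((isClosed_eq continuous_snd continuous_const).union
        ((isClosed_cubeBoundary n).preimage continuous_fst))
  have hgb : ∀ q ∈ prodBoundary n, p (g q) = H (q.2, q.1) := by
    intro q hq
    rw [hbd] at hq
    rcases hq with hq | hq | hq
    · rw [g1 q hq, show q.2 = 1 from hq, H.apply_one]; rfl
    · rw [g0 q (Or.inl hq), hq, H.apply_zero]; rfl
    · rw [g0 q (Or.inr hq), H.eq_fst _ hq]; rfl
  have hcs : ∀ y : Cube.boundary (Fin (n + 1)), cubeSucc n y ∈ prodBoundary n :=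
    fun y => (cubeSucc_mem_iff y.1).2 y.2
  obtain ⟨G, hG, -⟩ := hp (n + 1) ⟨fun y => H ((cubeSucc n y).2, (cubeSucc n y).1), by fun_prop⟩
    ⟨fun y => g (cubeSucc n y), hg.comp_continuous (by fun_prop) hcs⟩ fun y => hgb _ (hcs y)
  have hG' : ∀ q ∈ prodBoundary n, G ((cubeSucc n).symm q) = g q := by
    intro q hq
    have := hG ⟨(cubeSucc n).symm q, (cubeSucc_mem_iff _).1 (by simpa using hq)⟩
    simpa using this
  refine ⟨⟨⟨⟨fun z => G ((cubeSucc n).symm (z.2, z.1)), by fun_prop⟩, fun y => ?_, fun y => ?_⟩,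
    fun t y hy => ?_⟩⟩
  · exact (hG' _ (Or.inr (Or.inl rfl))).trans (g0 _ (Or.inl rfl))
  · exact (hG' _ (Or.inr (Or.inr rfl))).trans (g1 _ rfl)
  · exact (hG' _ (Or.inl hy)).trans (g0 _ (Or.inr hy))

/-- Surjectivity is compression of maps whose boundary is constant, and injectivity is lifting of
homotopies. -/
theorem CompressesCubes.isWeakHomotopyEquiv {p : C(E, B)} (hp : CompressesCubes p) :
    IsWeakHomotopyEquiv p := by
  have hempty : Cube.boundary (Fin 0) = ∅ := by
    ext y; simp [Cube.boundary]
  refine ⟨⟨?_, ?_⟩, fun n hn x => ⟨?_, ?_⟩⟩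
  · intro a b hab
    induction a, b using Quotient.inductionOn₂ with
    | _ a b =>
    obtain ⟨P⟩ : Joined (p a) (p b) := Quotient.exact hab
    obtain ⟨H⟩ := hp.exists_homotopy (n := 0) ⟨fun _ => a, continuous_const⟩
      ⟨fun _ => b, continuous_const⟩ (by simp [hempty])
      ⟨⟨⟨⟨fun z => P z.1, by fun_prop⟩, fun y => by simp, fun y => by simp⟩,
        fun t y hy => by simp [hempty] at hy⟩⟩
    exact Quotient.sound ⟨⟨⟨fun t => H (t, default), by fun_prop⟩, by simp, by simp⟩⟩
  · intro b
    induction b using Quotient.inductionOn with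
    | _ b =>
    obtain ⟨G, -, ⟨H⟩⟩ := hp 0 ⟨fun _ => b, continuous_const⟩
      ⟨fun y => by exact absurd y.2 (by simp [hempty]), by
        rw [continuous_iff_continuousAt]
        rintro ⟨y, hy⟩
        simp [hempty] at hy⟩ (by rintro ⟨y, hy⟩; simp [hempty] at hy)
    refine ⟨Quotient.mk _ (G default), Quotient.sound ?_⟩
    exact ⟨⟨⟨fun t => H (t, default), by fun_prop⟩, by simp, by simp⟩⟩
  · intro a b hab
    induction a, b using Quotient.inductionOn₂ with
    | _ a b =>
    have h : GenLoop.Homotopic (⟨p.comp a.1, fun y hy => congrArg p (a.2 y hy)⟩ :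
      GenLoop (Fin n) B (p x)) ⟨p.comp b.1, fun y hy => congrArg p (b.2 y hy)⟩ :=
        Quotient.exact hab
    exact Quotient.sound (hp.exists_homotopy a.1 b.1
      (fun y hy => (a.2 y hy).trans (b.2 y hy).symm) h)
  · intro b
    induction b using Quotient.inductionOn with
    | _ b =>
    obtain ⟨G, hG, H⟩ := hp n b.1 ⟨fun _ => x, continuous_const⟩ fun y => (b.2 y y.2).symm
    exact ⟨Quotient.mk _ ⟨G, fun y hy => hG ⟨y, hy⟩⟩, Quotient.sound H⟩

end Compression

/-! ### Lifting over a neighbourhood of a closed subset of a cube -/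

section Grid

/-- A closed cell of the subdivision of the cube `I^n` into `N^n` small cubes, given by the lower
and upper ends, in units of `1 / N`, of its projections to the coordinate axes. -/
def gridCell {n : ℕ} (N : ℕ) (c : Fin n → ℕ × ℕ) : Set (Fin n → I) :=
  {x | ∀ i, ((c i).1 : ℝ) ≤ N * (x i : ℝ) ∧ N * (x i : ℝ) ≤ (c i).2}

/-- The data `c` describe a cell of the subdivision: each projection is a point or an interval of
length one, within `[0, N]`. -/
def IsGridCell {n : ℕ} (N : ℕ) (c : Fin n → ℕ × ℕ) : Prop :=
  ∀ i, (c i).1 ≤ (c i).2 ∧ (c i).2 ≤ (c i).1 + 1 ∧ (c i).2 ≤ N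

/-- The relation of being a face of a cell. -/
def IsGridFace {n : ℕ} (c' c : Fin n → ℕ × ℕ) : Prop :=
  ∀ i, (c i).1 ≤ (c' i).1 ∧ (c' i).2 ≤ (c i).2

/-- A finite set of cells that contains the faces of its elements. -/
structure IsGridComplex {n : ℕ} (N : ℕ) (S : Finset (Fin n → ℕ × ℕ)) : Prop where
  isGridCell : ∀ c ∈ S, IsGridCell N c
  face_mem : ∀ c ∈ S, ∀ c', IsGridCell N c' → IsGridFace c' c → c' ∈ S

/-- The union of the cells in a finite set. -/
def gridSpace {n : ℕ} (N : ℕ) (S : Finset (Fin n → ℕ × ℕ)) : Set (Fin n → I) :=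
  ⋃ c ∈ S, gridCell N c

theorem isClosed_gridCell {n : ℕ} (N : ℕ) (c : Fin n → ℕ × ℕ) : IsClosed (gridCell N c) := by
  have : gridCell N c = ⋂ i, {x : Fin n → I | ((c i).1 : ℝ) ≤ N * (x i : ℝ)} ∩
      {x | N * (x i : ℝ) ≤ (c i).2} := by
    ext x; simp [gridCell]
  rw [this]
  exact isClosed_iInter fun i => (isClosed_le continuous_const (by fun_prop)).inter
    (isClosed_le (by fun_prop) continuous_const)

theorem isClosed_gridSpace {n : ℕ} (N : ℕ) (S : Finset (Fin n → ℕ × ℕ)) :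
    IsClosed (gridSpace N S) :=
  S.finite_toSet.isClosed_biUnion fun c _ => isClosed_gridCell N c

theorem mem_gridSpace {n N : ℕ} {S : Finset (Fin n → ℕ × ℕ)} {x : Fin n → I} :
    x ∈ gridSpace N S ↔ ∃ c ∈ S, x ∈ gridCell N c := by
  simp [gridSpace]

/-- The parametrization of a cell by the cube on the coordinates in which it is not a point. -/
def gridParam {n : ℕ} (N : ℕ) (c : Fin n → ℕ × ℕ) {T : Type*} (idx : {i // (c i).1 < (c i).2} ≃ T)
    (y : T → I) (i : Fin n) : I :=
  Set.projIcc 0 1 zero_le_one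
    ((((c i).1 : ℝ) + if h : (c i).1 < (c i).2 then (y (idx ⟨i, h⟩) : ℝ) else 0) / N)

/-- The inverse of the parametrization of a cell. -/
def gridCoord {n : ℕ} (N : ℕ) (c : Fin n → ℕ × ℕ) {T : Type*} (idx : {i // (c i).1 < (c i).2} ≃ T)
    (x : Fin n → I) (j : T) : I :=
  Set.projIcc 0 1 zero_le_one (N * (x (idx.symm j).1 : ℝ) - (c (idx.symm j).1).1)

variable {n N : ℕ} {c : Fin n → ℕ × ℕ} {T : Type*} (idx : {i // (c i).1 < (c i).2} ≃ T)

theorem continuous_gridParam : Continuous (gridParam N c idx) := by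
  refine continuous_pi fun i => continuous_projIcc.comp ?_
  by_cases h : (c i).1 < (c i).2
  · simp only [h, dif_pos]; fun_prop
  · simp only [h, dif_neg, not_false_iff]; fun_prop

theorem continuous_gridCoord : Continuous (gridCoord N c idx) := by
  refine continuous_pi fun i => continuous_projIcc.comp ?_
  fun_prop

theorem gridParam_mul (hN : 0 < N) (hc : IsGridCell N c) (y : T → I) (i : Fin n) :
    N * (gridParam N c idx y i : ℝ) =
      (c i).1 + if h : (c i).1 < (c i).2 then (y (idx ⟨i, h⟩) : ℝ) else 0 := by
  have hN' : (0 : ℝ) < N := by exact_mod_cast hN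
  obtain ⟨h1, h2, h3⟩ := hc i
  have h2' : ((c i).2 : ℝ) ≤ N := by exact_mod_cast h3
  have key : (((c i).1 : ℝ) + if h : (c i).1 < (c i).2 then (y (idx ⟨i, h⟩) : ℝ) else 0) / N
      ∈ Set.Icc (0 : ℝ) 1 := by
    constructor
    · refine div_nonneg (add_nonneg (Nat.cast_nonneg _) ?_) hN'.le
      split_ifs
      · exact (y _).2.1
      · exact le_rfl
    · rw [div_le_one hN']
      split_ifs with h
      · have hh : ((c i).1 : ℝ) + 1 ≤ (c i).2 := by exact_mod_cast h
        have := (y (idx ⟨i, h⟩)).2.2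
        linarith
      · have hh : ((c i).1 : ℝ) ≤ (c i).2 := by exact_mod_cast h1
        linarith
  unfold gridParam
  rw [Set.projIcc_of_mem zero_le_one key]
  field_simp

theorem gridParam_mem (hN : 0 < N) (hc : IsGridCell N c) (y : T → I) :
    gridParam N c idx y ∈ gridCell N c := by
  intro i
  rw [gridParam_mul idx hN hc]
  split_ifs with h
  · have := (y (idx ⟨i, h⟩)).2
    have hh : ((c i).1 : ℝ) + 1 ≤ (c i).2 := by exact_mod_cast h
    constructor <;> linarith [this.1, this.2]
  · have hh : ((c i).1 : ℝ) ≤ (c i).2 := by exact_mod_cast (hc i).1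
    constructor <;> linarith

theorem gridCoord_mul (hc : IsGridCell N c) {x : Fin n → I} (hx : x ∈ gridCell N c) (j : T) :
    (gridCoord N c idx x j : ℝ) = N * (x (idx.symm j).1 : ℝ) - (c (idx.symm j).1).1 := by
  obtain ⟨h1, h2⟩ := hx (idx.symm j).1
  have h3 : ((c (idx.symm j).1).2 : ℝ) ≤ (c (idx.symm j).1).1 + 1 := by
    exact_mod_cast (hc (idx.symm j).1).2.1
  unfold gridCoord
  rw [Set.projIcc_of_mem zero_le_one (x := (N * (x (idx.symm j).1 : ℝ) - (c (idx.symm j).1).1))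
    ⟨by linarith, by linarith⟩]

theorem gridParam_gridCoord (hN : 0 < N) (hc : IsGridCell N c) {x : Fin n → I}
    (hx : x ∈ gridCell N c) : gridParam N c idx (gridCoord N c idx x) = x := by
  have hN' : (N : ℝ) ≠ 0 := by exact_mod_cast hN.ne'
  refine funext fun i => Subtype.ext (mul_left_cancel₀ hN' ?_)
  rw [gridParam_mul idx hN hc]
  split_ifs with h
  · rw [gridCoord_mul idx hc hx]
    simp
  · have hh : ((c i).2 : ℝ) ≤ (c i).1 := by exact_mod_cast not_lt.1 h
    linarith [(hx i).1, (hx i).2]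

/-- A cell none of whose coordinates is at an end of the cell meets only those cells of a complex
of which it is a face. -/
theorem mem_of_coord_notMem_boundary {d : ℕ} (idx : {i // (c i).1 < (c i).2} ≃ Fin d)
    (hc : IsGridCell N c) {S : Finset (Fin n → ℕ × ℕ)} (hS : IsGridComplex N S)
    {x : Fin n → I} (hx : x ∈ gridCell N c) (hxS : x ∈ gridSpace N S)
    (hb : gridCoord N c idx x ∉ Cube.boundary (Fin d)) : c ∈ S := by
  obtain ⟨c', hc', hxc'⟩ := mem_gridSpace.1 hxS
  refine hS.face_mem c' hc' c hc fun i => ?_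
  obtain ⟨h1, h2⟩ := hxc' i
  obtain ⟨h3, h4⟩ := hx i
  by_cases h : (c i).1 < (c i).2
  · have hj := gridCoord_mul idx hc hx (idx ⟨i, h⟩)
    rw [Equiv.symm_apply_apply] at hj
    have hne0 : gridCoord N c idx x (idx ⟨i, h⟩) ≠ 0 := fun h0 => hb ⟨_, Or.inl h0⟩
    have hne1 : gridCoord N c idx x (idx ⟨i, h⟩) ≠ 1 := fun h0 => hb ⟨_, Or.inr h0⟩
    have hp0 : 0 < (gridCoord N c idx x (idx ⟨i, h⟩) : ℝ) := unitInterval.pos_iff_ne_zero.2 hne0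
    have hp1 : (gridCoord N c idx x (idx ⟨i, h⟩) : ℝ) < 1 := unitInterval.lt_one_iff_ne_one.2 hne1
    rw [hj] at hp0 hp1
    have ha : ((c' i).1 : ℝ) < (c i).1 + 1 := by simp only at hp1; linarith
    have hb' : ((c i).1 : ℝ) < (c' i).2 := by simp only at hp0; linarith
    have ha' : (c' i).1 < (c i).1 + 1 := by exact_mod_cast ha
    have hb'' : (c i).1 < (c' i).2 := by exact_mod_cast hb'
    have := (hc i).2.1
    omega
  · have e := (hc i).1
    have e' : (c i).1 = (c i).2 := by omega
    have ha : ((c' i).1 : ℝ) ≤ (c i).2 := by linarith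
    have hb' : ((c i).1 : ℝ) ≤ (c' i).2 := by linarith
    have ha' : (c' i).1 ≤ (c i).2 := by exact_mod_cast ha
    have hb'' : (c i).1 ≤ (c' i).2 := by exact_mod_cast hb'
    omega

/-- The boundary of a cell is covered by faces of smaller dimension. -/
theorem exists_face_of_mem_boundary {d : ℕ} (idx : {i // (c i).1 < (c i).2} ≃ Fin d)
    (hN : 0 < N) (hc : IsGridCell N c) {y : Fin d → I} (hy : y ∈ Cube.boundary (Fin d)) :
    ∃ c', IsGridCell N c' ∧ IsGridFace c' c ∧ ∑ i, ((c' i).2 - (c' i).1) < ∑ i, ((c i).2 - (c i).1)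
      ∧ gridParam N c idx y ∈ gridCell N c' := by
  classical
  obtain ⟨j, hj⟩ := hy
  set i := (idx.symm j).1 with hi
  have hlt : (c i).1 < (c i).2 := (idx.symm j).2
  obtain ⟨k, hk, hk1, hk2⟩ : ∃ k : ℕ, (N * (gridParam N c idx y i : ℝ) = k) ∧ (c i).1 ≤ k ∧
      k ≤ (c i).2 := by
    have hv := gridParam_mul idx hN hc y i
    rw [dif_pos hlt] at hv
    have hji : idx ⟨i, hlt⟩ = j := by simp [hi]
    rw [hji] at hv
    rcases hj with hj | hj
    · exact ⟨(c i).1, by rw [hv, hj]; simp, le_rfl, hlt.le⟩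
    · exact ⟨(c i).1 + 1, by rw [hv, hj]; simp, by omega, hlt⟩
  refine ⟨Function.update c i (k, k), fun l => ?_, fun l => ?_, ?_, fun j' => ?_⟩
  · rcases eq_or_ne l i with rfl | hl
    · have : (c i).2 ≤ N := (hc i).2.2
      simp only [Function.update_self]
      omega
    · simpa [hl] using hc l
  · rcases eq_or_ne l i with rfl | hl
    · simp only [Function.update_self]
      omega
    · simp [hl]
  · refine Finset.sum_lt_sum (fun l _ => ?_) ⟨i, Finset.mem_univ _, ?_⟩
    · rcases eq_or_ne l i with rfl | hl
      · simp
      · simp [hl]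
    · simp only [Function.update_self]
      omega
  · rcases eq_or_ne j' i with hl | hl
    · rw [hl]; simp [hk]
    · simpa [hl] using gridParam_mem idx hN hc y j'

variable {E B : Type*} [TopologicalSpace E] [TopologicalSpace B]

/-- Lifts extend from a subcomplex of the subdivided cube, one cell at a time. -/
theorem LiftsCubes.exists_extension {p : C(E, B)} (hp : LiftsCubes p) (hN : 0 < N)
    {S : Finset (Fin n → ℕ × ℕ)} (hS : IsGridComplex N S) {b : (Fin n → I) → B}
    (hb : ContinuousOn b (gridSpace N S)) (k : ℕ) :
    ∀ (S₂ : Finset (Fin n → ℕ × ℕ)), IsGridComplex N S₂ → S₂ ⊆ S → (S.card ≤ S₂.card + k) →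
      ∀ l : (Fin n → I) → E, ContinuousOn l (gridSpace N S₂) →
      (∀ x ∈ gridSpace N S₂, p (l x) = b x) →
      ∃ L : (Fin n → I) → E, ContinuousOn L (gridSpace N S) ∧ (∀ x ∈ gridSpace N S, p (L x) = b x) ∧
        ∀ x ∈ gridSpace N S₂, L x = l x := by
  classical
  induction k with
  | zero =>
    intro S₂ _ hsub hcard l hl hlb
    obtain rfl : S₂ = S := Finset.eq_of_subset_of_card_le hsub (by simpa using hcard)
    exact ⟨l, hl, hlb, fun _ _ => rfl⟩
  | succ k ih =>
    intro S₂ hS₂ hsub hcard l hl hlb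
    by_cases hne : (S \ S₂).Nonempty
    swap
    · have : S ⊆ S₂ := by
        rwa [Finset.not_nonempty_iff_eq_empty, Finset.sdiff_eq_empty_iff_subset] at hne
      obtain rfl : S₂ = S := Finset.Subset.antisymm hsub this
      exact ⟨l, hl, hlb, fun _ _ => rfl⟩
    -- the next cell to be treated is one of minimal dimension
    obtain ⟨e, he, hmin⟩ := Finset.exists_min_image (S \ S₂) (fun c => ∑ i, ((c i).2 - (c i).1)) hne
    rw [Finset.mem_sdiff] at he
    have hce := hS.isGridCell e he.1
    have hface : ∀ c', IsGridCell N c' → IsGridFace c' e →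
        ∑ i, ((c' i).2 - (c' i).1) < ∑ i, ((e i).2 - (e i).1) → c' ∈ S₂ := by
      intro c' hc' hf hlt
      by_contra hn
      exact absurd (hmin c' (Finset.mem_sdiff.2 ⟨hS.face_mem e he.1 c' hc' hf, hn⟩)) (not_le.2 hlt)
    have hS₂' : IsGridComplex N (insert e S₂) := by
      refine ⟨fun c hc => hS.isGridCell c ?_, fun c hc c' hc' hf => ?_⟩
      · exact (Finset.insert_subset he.1 hsub) hc
      · rcases Finset.mem_insert.1 hc with rfl | hc
        · by_cases hlt : ∑ i, ((c' i).2 - (c' i).1) < ∑ i, ((c i).2 - (c i).1)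
          · exact Finset.mem_insert_of_mem (hface c' hc' hf hlt)
          · have hle : ∀ i ∈ Finset.univ, (c' i).2 - (c' i).1 ≤ (c i).2 - (c i).1 := fun i _ => by
              have := hf i; omega
            have heq := (Finset.sum_eq_sum_iff_of_le hle).1
              (le_antisymm (Finset.sum_le_sum hle) (not_lt.1 hlt))
            refine Finset.mem_insert.2 (Or.inl (funext fun i => Prod.ext ?_ ?_)) <;>
            · have h1 := hf i; have h2 := heq i (Finset.mem_univ _)
              have h3 := hc' i; have h4 := hce i
              omega
        · exact Finset.mem_insert_of_mem (hS₂.face_mem c hc c' hc' hf)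
    let idx := Fintype.equivFin {i // (e i).1 < (e i).2}
    have hes : gridCell N e ⊆ gridSpace N S := fun x hx => mem_gridSpace.2 ⟨e, he.1, hx⟩
    have hbd : ∀ y ∈ Cube.boundary (Fin _), gridParam N e idx y ∈ gridSpace N S₂ := by
      intro y hy
      obtain ⟨c', hc', hf, hlt, hm⟩ := exists_face_of_mem_boundary idx hN hce hy
      exact mem_gridSpace.2 ⟨c', hface c' hc' hf hlt, hm⟩
    obtain ⟨G, hG, hGp⟩ := hp _ ⟨fun y => b (gridParam N e idx y),
        hb.comp_continuous (continuous_gridParam idx) fun y => hes (gridParam_mem idx hN hce y)⟩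
      (fun y => l (gridParam N e idx y)) (hl.comp (continuous_gridParam idx).continuousOn hbd)
      fun y hy => hlb _ (hbd y hy)
    let l' : (Fin n → I) → E := fun x => if x ∈ gridSpace N S₂ then l x
      else G (gridCoord N e idx x)
    have hl'1 : ∀ x ∈ gridSpace N S₂, l' x = l x := fun x hx => if_pos hx
    have hl'2 : ∀ x ∈ gridCell N e, l' x = G (gridCoord N e idx x) := by
      intro x hx
      by_cases h : x ∈ gridSpace N S₂
      · have : gridCoord N e idx x ∈ Cube.boundary _ := by
          by_contra hn
          exact he.2 (mem_of_coord_notMem_boundary idx hce hS₂ hx h hn)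
        rw [hl'1 x h, hG _ this, gridParam_gridCoord idx hN hce hx]
      · exact if_neg h
    have hspace : gridSpace N (insert e S₂) = gridSpace N S₂ ∪ gridCell N e := by
      simp only [gridSpace, Finset.set_biUnion_insert, Set.union_comm]
    obtain ⟨L, hL, hLp, hLl⟩ := ih (insert e S₂) hS₂' (Finset.insert_subset he.1 hsub)
      (by rw [Finset.card_insert_of_notMem he.2]; omega) l' (by
        rw [hspace]
        refine ContinuousOn.union_of_isClosed (hl.congr hl'1) ?_ (isClosed_gridSpace N S₂)
          (isClosed_gridCell N e)
        exact (G.continuous.comp (continuous_gridCoord idx)).continuousOn.congr hl'2) (by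
        rw [hspace]
        rintro x (hx | hx)
        · rw [hl'1 x hx, hlb x hx]
        · rw [hl'2 x hx, hGp, ContinuousMap.coe_mk, gridParam_gridCoord idx hN hce hx])
    refine ⟨L, hL, hLp, fun x hx => ?_⟩
    rw [hLl x (by rw [hspace]; exact Or.inl hx), hl'1 x hx]

/-- Every point of the cube lies in a cell of full dimension. -/
theorem exists_mem_gridCell (hN : 0 < N) (x : Fin n → I) :
    ∃ c : Fin n → ℕ × ℕ, IsGridCell N c ∧ (∀ i, (c i).2 = (c i).1 + 1) ∧ x ∈ gridCell N c := by
  have hN' : (0 : ℝ) < N := by exact_mod_cast hN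
  have h : ∀ i, ∃ k : ℕ, k + 1 ≤ N ∧ (k : ℝ) ≤ N * (x i : ℝ) ∧ N * (x i : ℝ) ≤ (k + 1 : ℕ) := by
    intro i
    have h0 : 0 ≤ N * (x i : ℝ) := mul_nonneg hN'.le (x i).2.1
    rcases lt_or_ge (⌊N * (x i : ℝ)⌋₊) N with hlt | hge
    · exact ⟨_, hlt, Nat.floor_le h0, by push_cast; exact (Nat.lt_floor_add_one _).le⟩
    · refine ⟨N - 1, by omega, ?_, ?_⟩
      · have h1 : (N : ℝ) ≤ N * (x i : ℝ) := (Nat.le_floor_iff h0).1 hge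
        exact le_trans (by exact_mod_cast Nat.sub_le _ _) h1
      · rw [Nat.sub_add_cancel hN]
        have := (x i).2.2
        nlinarith
  choose k hk1 hk2 hk3 using h
  exact ⟨fun i => (k i, k i + 1), fun i => ⟨by simp, le_rfl, hk1 i⟩, fun i => rfl,
    fun i => ⟨hk2 i, hk3 i⟩⟩

/-- A lift given near a closed set `D` extends over a closed set `C` after being restricted to
`C ∩ D`: subdivide the cube so finely that each small cube which meets `C` or `D` stays in the
given neighbourhood of it. -/
theorem LiftsCubes.exists_lift {p : C(E, B)} (hp : LiftsCubes p) {C O D O' : Set (Fin n → I)}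
    (hC : IsClosed C) (hO : IsOpen O) (hCO : C ⊆ O) (hD : IsClosed D) (hO' : IsOpen O')
    (hDO : D ⊆ O') {b : (Fin n → I) → B} (hb : ContinuousOn b O) {l : (Fin n → I) → E}
    (hl : ContinuousOn l (O ∩ O')) (hlb : ∀ x ∈ O ∩ O', p (l x) = b x) :
    ∃ L : (Fin n → I) → E, ContinuousOn L C ∧ (∀ x ∈ C, p (L x) = b x) ∧
      ∀ x ∈ C ∩ D, L x = l x := by
  classical
  -- A ball of radius `ε` is contained in `O` or misses `C`, and likewise for `O'` and `D`.
  obtain ⟨ε, hε, hball⟩ := lebesgue_number_lemma_of_metric (s := (Set.univ : Set (Fin n → I)))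
    (c := fun q : Bool × Bool => (if q.1 then O else Cᶜ) ∩ (if q.2 then O' else Dᶜ))
    isCompact_univ (by
      rintro ⟨_ | _, _ | _⟩ <;> simp [hO, hO', hC, hD, IsOpen.inter]) (by
      intro x _
      by_cases h1 : x ∈ C <;> by_cases h2 : x ∈ D
      · exact Set.mem_iUnion.2 ⟨(true, true), by simp [hCO h1, hDO h2]⟩
      · exact Set.mem_iUnion.2 ⟨(true, false), by simp [hCO h1, h2]⟩
      · exact Set.mem_iUnion.2 ⟨(false, true), by simp [h1, hDO h2]⟩
      · exact Set.mem_iUnion.2 ⟨(false, false), by simp [h1, h2]⟩)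
  obtain ⟨M, hM⟩ := exists_nat_one_div_lt hε
  set N := M + 1
  have hN : 0 < N := Nat.succ_pos M
  have hN' : (0 : ℝ) < N := by exact_mod_cast hN
  have hMN : 1 / (N : ℝ) < ε := by simpa [N] using hM
  have hsmall : ∀ c : Fin n → ℕ × ℕ, IsGridCell N c → ∀ x ∈ gridCell N c,
      gridCell N c ⊆ Metric.ball x ε := by
    intro c hc x hx y hy
    refine lt_of_le_of_lt ((dist_pi_le_iff (by positivity)).2 fun i => ?_) hMN
    have h3 : ((c i).2 : ℝ) ≤ (c i).1 + 1 := by exact_mod_cast (hc i).2.1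
    have h4 := hx i
    have h5 := hy i
    rw [Subtype.dist_eq, Real.dist_eq, le_div_iff₀ hN', ← abs_of_pos hN', ← abs_mul, abs_le]
    constructor <;> nlinarith
  let A : Finset (Fin n → ℕ × ℕ) :=
    Fintype.piFinset fun _ => Finset.range (N + 1) ×ˢ Finset.range (N + 1)
  have hA : ∀ c, IsGridCell N c → c ∈ A := by
    intro c hc
    refine Fintype.mem_piFinset.2 fun i => ?_
    have := hc i
    simp only [Finset.mem_product, Finset.mem_range]
    omega
  -- the complex of all faces of cells that are contained in `U`
  let cx : Set (Fin n → I) → Finset (Fin n → ℕ × ℕ) := fun U => A.filter fun c =>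
    IsGridCell N c ∧ ∃ c', IsGridCell N c' ∧ IsGridFace c c' ∧ gridCell N c' ⊆ U
  have hcx : ∀ U, IsGridComplex N (cx U) := by
    intro U
    refine ⟨fun c hc => (Finset.mem_filter.1 hc).2.1, fun c hc c' hc' hf => ?_⟩
    obtain ⟨-, -, c'', hc'', hf', hU⟩ := Finset.mem_filter.1 hc
    exact Finset.mem_filter.2 ⟨hA c' hc', hc', c'', hc'',
      fun i => ⟨(hf' i).1.trans (hf i).1, (hf i).2.trans (hf' i).2⟩, hU⟩
  have hcxU : ∀ U, gridSpace N (cx U) ⊆ U := by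
    intro U x hx
    obtain ⟨c, hc, hxc⟩ := mem_gridSpace.1 hx
    obtain ⟨-, -, c', -, hf, hU⟩ := Finset.mem_filter.1 hc
    refine hU fun i => ⟨le_trans ?_ (hxc i).1, (hxc i).2.trans ?_⟩
    · exact_mod_cast (hf i).1
    · exact_mod_cast (hf i).2
  have hmem : ∀ (U : Set (Fin n → I)) (c : Fin n → ℕ × ℕ) (x : Fin n → I), IsGridCell N c →
      x ∈ gridCell N c → gridCell N c ⊆ U → x ∈ gridSpace N (cx U) := fun U c x hc hx hU =>
    mem_gridSpace.2 ⟨c, Finset.mem_filter.2 ⟨hA c hc, hc, c, hc, fun i => ⟨le_rfl, le_rfl⟩, hU⟩, hx⟩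
  have hsub : cx (O ∩ O') ⊆ cx O := by
    intro c hc
    obtain ⟨h1, h2, c', h3, h4, h5⟩ := Finset.mem_filter.1 hc
    exact Finset.mem_filter.2 ⟨h1, h2, c', h3, h4, h5.trans Set.inter_subset_left⟩
  have key : ∀ x ∈ C, x ∈ gridSpace N (cx O) ∧ (x ∈ D → x ∈ gridSpace N (cx (O ∩ O'))) := by
    intro x hx
    obtain ⟨c, hc, -, hxc⟩ := exists_mem_gridCell hN x
    obtain ⟨⟨q1, q2⟩, hq⟩ := hball x (Set.mem_univ x)
    have hcq := (hsmall c hc x hxc).trans hq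
    have hq1 : q1 = true := by
      by_contra h
      rw [Bool.not_eq_true] at h
      subst h
      exact (hcq hxc).1 hx
    subst hq1
    have hcO : gridCell N c ⊆ O := fun y hy => (hcq hy).1
    refine ⟨hmem O c x hc hxc hcO, fun hxD => ?_⟩
    have hq2 : q2 = true := by
      by_contra h
      rw [Bool.not_eq_true] at h
      subst h
      exact (hcq hxc).2 hxD
    subst hq2
    exact hmem _ c x hc hxc hcq
  obtain ⟨L, hL, hLp, hLl⟩ := hp.exists_extension hN (hcx O) (hb.mono (hcxU O)) (cx O).card
    (cx (O ∩ O')) (hcx _) hsub (Nat.le_add_left _ _) l (hl.mono (hcxU _))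
    fun x hx => hlb x (hcxU _ hx)
  exact ⟨L, hL.mono fun x hx => (key x hx).1, fun x hx => hLp x (key x hx).1,
    fun x hx => hLl x ((key x hx.1).2 hx.2)⟩

end Grid

/-! ### Compactly coherent spaces -/

section Coherent

/-- The product of a compactly coherent space with a compact Hausdorff space is compactly
coherent. The open sets are the continuous maps to the Sierpiński space, for which one can pass to
the adjoint map into the space of maps out of the compact factor. -/
theorem CompactlyCoherentSpace.prod {Z L : Type*} [TopologicalSpace Z] [TopologicalSpace L]
    [CompactlyCoherentSpace Z] [CompactSpace L] [T2Space L] : CompactlyCoherentSpace (Z × L) := by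
  refine CompactlyCoherentSpace.of_isOpen fun A hA => ?_
  have hK : ∀ K : Set (Z × L), IsCompact K → ContinuousOn (fun z => z ∈ A) K := by
    intro K hK
    rw [continuousOn_iff_continuous_domRestrict]
    exact continuous_Prop.2 (hA K hK)
  let G : Z → C(L, Prop) := fun z => ⟨fun l => (z, l) ∈ A,
    (hK (Set.range fun l => (z, l)) (isCompact_range (by fun_prop))).comp_continuous
      (f := fun l => (z, l)) (by fun_prop) fun l => Set.mem_range_self l⟩
  have hG : Continuous G := by
    rw [CompactlyCoherentSpace.isCoherentWith.continuous_iff]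
    intro K hKc
    rw [continuousOn_iff_continuous_domRestrict]
    have : CompactSpace K := isCompact_iff_compactSpace.1 hKc
    refine ContinuousMap.continuous_of_continuous_uncurry _ ?_
    exact (hK (K ×ˢ Set.univ) (hKc.prod isCompact_univ)).comp_continuous
      (f := fun w : K × L => (w.1.1, w.2)) (by fun_prop) fun w => ⟨w.1.2, Set.mem_univ _⟩
  have := ContinuousMap.continuous_uncurry_of_continuous ⟨G, hG⟩
  exact continuous_Prop.1 this

instance {Z : Type*} [TopologicalSpace Z] [CompactlyCoherentSpace Z] {n : ℕ} :
    CompactlyCoherentSpace (Z × stdSimplex ℝ (Fin n)) := CompactlyCoherentSpace.prod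

instance {Z : Type*} [TopologicalSpace Z] [CompactlyCoherentSpace Z] {n : ℕ} :
    CompactlyCoherentSpace ((Z × stdSimplex ℝ (Fin n)) × I) := CompactlyCoherentSpace.prod

/-- A closed subspace of a compactly coherent space is compactly coherent. -/
theorem CompactlyCoherentSpace.of_isClosed_subset {Z : Type*} [TopologicalSpace Z]
    [CompactlyCoherentSpace Z] {A : Set Z} (hA : IsClosed A) : CompactlyCoherentSpace A := by
  refine CompactlyCoherentSpace.of_isClosed fun s hs => ?_
  have h : IsClosed (Subtype.val '' s : Set Z) := by
    rw [CompactlyCoherentSpace.isClosed_iff]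
    intro K hK
    have hKA : IsCompact (Subtype.val ⁻¹' K : Set A) :=
      hA.isClosedEmbedding_subtypeVal.isCompact_preimage hK
    let D : Set K := {k | k.1 ∈ A}
    have hD : IsClosed D := hA.preimage continuous_subtype_val
    let g : D → (Subtype.val ⁻¹' K : Set A) := fun d => ⟨⟨d.1.1, d.2⟩, d.1.2⟩
    have hg : Continuous g := by fun_prop
    have heq : Subtype.val ⁻¹' (Subtype.val '' s : Set Z) =
        (Subtype.val '' (g ⁻¹' (Subtype.val ⁻¹' s)) : Set K) := by
      ext k
      constructor
      · rintro ⟨a, ha, hak⟩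
        exact ⟨⟨k, by simp only [D, Set.mem_ofPred_eq]; rw [← hak]; exact a.2⟩, by
          simpa [g, ← hak] using ha, rfl⟩
      · rintro ⟨d, hd, rfl⟩
        exact ⟨_, hd, rfl⟩
    rw [heq]
    exact hD.isClosedEmbedding_subtypeVal.isClosedMap _ ((hs _ hKA).preimage hg)
  have : s = Subtype.val ⁻¹' (Subtype.val '' s : Set Z) := by
    rw [Set.preimage_image_eq _ Subtype.val_injective]
  rw [this]
  exact h.preimage continuous_subtype_val

theorem TopologicalCategory.continuous_comp_of_coherent (X : TopologicalCategory.{u}) {Z : Type*}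
    [TopologicalSpace Z] [CompactlyCoherentSpace Z] {a b : Z → X.Mor} (ha : Continuous a)
    (hb : Continuous b) (h : ∀ z, X.tgt (a z) = X.src (b z)) :
    Continuous fun z => X.comp (a z) (b z) (h z) :=
  X.continuous_comp.comp (continuous_mk_comp_of_coherent
    (Continuous.subtype_mk (ha.prodMk hb) h))

end Coherent

/-! ### Points of a geometric realization -/

section Realization

/-- The map of simplices induced by a map of vertices, as a sum over fibres. -/
theorem stdSimplex_map_apply {m n : ℕ} (θ : Fin m → Fin n) (t : stdSimplex ℝ (Fin m)) (j : Fin n) :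
    stdSimplex.map θ t j = ∑ i with θ i = j, t i := by
  rw [stdSimplex.map_coe, FunOnFinite.linearMap_apply_apply]

theorem stdSimplex_map_eq_self {n : ℕ} {e : Fin n → Fin n} {t : stdSimplex ℝ (Fin n)}
    (h : ∀ i, 0 < t i → e i = i) : stdSimplex.map e t = t := by
  refine stdSimplex.ext (funext fun j => ?_)
  rw [stdSimplex_map_apply]
  have h0 : ∀ i, e i ≠ i → t i = 0 := fun i hi =>
    le_antisymm (not_lt.1 fun hp => hi (h i hp)) (stdSimplex.zero_le t i)
  by_cases hj : e j = j
  · refine Finset.sum_eq_single_of_mem j (by simpa using hj) fun i hi hij => h0 i fun h => hij ?_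
    rw [← h]; simpa using hi
  · rw [h0 j hj]
    refine Finset.sum_eq_zero fun i hi => h0 i fun h => hj ?_
    have : e i = j := by simpa using hi
    rw [← this, h, h]

namespace GeometricRealization

variable {S : SimplicialObject TopCat.{u}}

theorem continuous_mk (n : SimplexCategory) : Continuous
    fun z : S.obj (Opposite.op n) × SimplexCategory.toTop₀.obj n => mk S n z.1 z.2 :=
  continuous_quot_mk.comp (continuous_sigmaMk.comp continuous_id)

theorem mk_map {m n : SimplexCategory} (θ : m ⟶ n) (x : S.obj (Opposite.op n))
    (t : SimplexCategory.toTop₀.obj m) :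
    mk S m (S.map θ.op x) t = mk S n x (SimplexCategory.toTop₀.map θ t) :=
  Quot.sound (PreRealization.Rel.glue θ x t)

theorem isQuotientMap_mk :
    IsQuotientMap (fun p : PreRealization S => (Quot.mk _ p : GeometricRealization S)) :=
  isQuotientMap_quot_mk

end GeometricRealization

end Realization

/-! ### The collage of a functor -/

namespace TopologicalFunctor

open TopologicalCategory CompactCoherentification

variable {X Y : TopologicalCategory.{u}} (f : TopologicalFunctor X Y)

/-- Data for an `n`-simplex of the nerve of the collage of `f`, whose vertices `i` with
`κ i = true` are objects of `X`, and whose other vertices are objects of `Y`: the objects and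
morphisms in `Y` of the shadow of the simplex, and those in `X`. -/
abbrev CollageData (n : ℕ) (κ : Fin (n + 1) →o Bool) : Type u :=
  ((Fin (n + 1) → Y.Obj) × (OrdMor n → Y.Mor)) ×
    (({i // κ i = true} → X.Obj) × ({q : OrdMor n // κ q.1.1 = true} → X.Mor))

theorem _root_.OrderHom.bool_mono {n : ℕ} {κ : Fin (n + 1) →o Bool} {i j : Fin (n + 1)}
    (hij : i ≤ j) (h : κ i = true) : κ j = true :=
  top_le_iff.1 (h.ge.trans (κ.monotone hij))

/-- The conditions for an `n`-simplex of the nerve of the collage of `f`, which is the category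
whose objects are those of `X` and of `Y`, and in which the morphisms `y → x` are the morphisms
`y → f x` of `Y`: the shadow is a simplex of the nerve of `Y`, and on the vertices in `X` it is the
image of a simplex in `X`. -/
structure IsCollageSimplex (n : ℕ) (κ : Fin (n + 1) →o Bool)
    (p : CollageData (X := X) (Y := Y) n κ) : Prop where
  shadow : Y.IsSimplex n p.1
  obj (i : {i // κ i = true}) : f.obj (p.2.1 i) = p.1.1 i.1
  mor (q : {q : OrdMor n // κ q.1.1 = true}) : f.mor (p.2.2 q) = p.1.2 q.1
  src (q : {q : OrdMor n // κ q.1.1 = true}) : X.src (p.2.2 q) = p.2.1 ⟨q.1.1.1, q.2⟩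
  tgt (q : {q : OrdMor n // κ q.1.1 = true}) :
    X.tgt (p.2.2 q) = p.2.1 ⟨q.1.1.2, OrderHom.bool_mono q.1.2 q.2⟩
  ident (i : {i // κ i = true}) : p.2.2 ⟨⟨(i.1, i.1), le_rfl⟩, i.2⟩ = X.ident (p.2.1 i)
  comp (i j k : Fin (n + 1)) (hij : i ≤ j) (hjk : j ≤ k) (hi : κ i = true) :
    p.2.2 ⟨⟨(i, k), hij.trans hjk⟩, hi⟩ =
      X.comp (p.2.2 ⟨⟨(i, j), hij⟩, hi⟩) (p.2.2 ⟨⟨(j, k), hjk⟩, OrderHom.bool_mono hij hi⟩)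
        ((tgt ⟨⟨(i, j), hij⟩, hi⟩).trans
          (src ⟨⟨(j, k), hjk⟩, OrderHom.bool_mono hij hi⟩).symm)

/-- The space of `n`-simplices of the nerve of the collage of `f`. -/
abbrev CollageSpace (n : ℕ) : Type u :=
  Σ κ : Fin (n + 1) →o Bool, 𝐤 {p : CollageData (X := X) (Y := Y) n κ // f.IsCollageSimplex n κ p}

/-- Restriction of a simplex of the collage along a monotone map. -/
def collageRestrict {m n : ℕ} (θ : Fin (m + 1) →o Fin (n + 1)) (κ : Fin (n + 1) →o Bool)
    (p : {p : CollageData (X := X) (Y := Y) n κ // f.IsCollageSimplex n κ p}) :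
    {p : CollageData (X := X) (Y := Y) m (κ.comp θ) // f.IsCollageSimplex m (κ.comp θ) p} :=
  ⟨((fun i => p.1.1.1 (θ i), fun q => p.1.1.2 (q.map θ)),
    (fun i => p.1.2.1 ⟨θ i.1, i.2⟩, fun q => p.1.2.2 ⟨q.1.map θ, q.2⟩)),
    { shadow := (Y.simplexRestrict θ ⟨p.1.1, p.2.shadow⟩).2
      obj := fun i => p.2.obj ⟨θ i.1, i.2⟩
      mor := fun q => p.2.mor ⟨q.1.map θ, q.2⟩
      src := fun q => p.2.src ⟨q.1.map θ, q.2⟩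
      tgt := fun q => p.2.tgt ⟨q.1.map θ, q.2⟩
      ident := fun i => p.2.ident ⟨θ i.1, i.2⟩
      comp := fun i j k hij hjk hi =>
        p.2.comp (θ i) (θ j) (θ k) (θ.monotone hij) (θ.monotone hjk) hi }⟩

theorem continuous_collageRestrict {m n : ℕ} (θ : Fin (m + 1) →o Fin (n + 1))
    (κ : Fin (n + 1) →o Bool) : Continuous (f.collageRestrict θ κ) := by
  unfold collageRestrict
  fun_prop

/-- The map of spaces of simplices given by restriction along a monotone map. -/
def collageMap {m n : ℕ} (θ : Fin (m + 1) →o Fin (n + 1)) (c : f.CollageSpace n) :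
    f.CollageSpace m :=
  ⟨c.1.comp θ, CompactCoherentification.map (f.collageRestrict θ c.1) c.2⟩

theorem continuous_collageMap {m n : ℕ} (θ : Fin (m + 1) →o Fin (n + 1)) :
    Continuous (f.collageMap θ) := by
  refine continuous_sigma fun κ => ?_
  exact (@continuous_sigmaMk _ (fun κ : Fin (m + 1) →o Bool =>
    𝐤 {p : CollageData (X := X) (Y := Y) m κ // f.IsCollageSimplex m κ p}) _ (κ.comp θ)).comp
      (CompactCoherentification.continuous_map_of_continuous (f.continuous_collageRestrict θ κ))

/-- The nerve of the collage of `f`, a simplicial space. -/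
def collage : SimplicialObject TopCat.{u} where
  obj n := TopCat.of (f.CollageSpace n.unop.len)
  map θ := TopCat.ofHom ⟨f.collageMap θ.unop.toOrderHom, f.continuous_collageMap _⟩
  map_id _ := rfl
  map_comp _ _ := rfl

/-- The classifying space of the collage of `f`. -/
abbrev CollageRealization : Type u := GeometricRealization f.collage

/-- The point of the classifying space of the collage given by a simplex and a point of `Δ^n`. -/
def cpt {n : ℕ} (c : f.CollageSpace n) (t : stdSimplex ℝ (Fin (n + 1))) : f.CollageRealization :=
  GeometricRealization.mk f.collage (SimplexCategory.mk n) c t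

theorem exists_cpt (b : f.CollageRealization) :
    ∃ (n : ℕ) (c : f.CollageSpace n) (t : stdSimplex ℝ (Fin (n + 1))), b = f.cpt c t := by
  obtain ⟨⟨n, c, t⟩⟩ := b
  exact ⟨n.len, c, t, rfl⟩

theorem continuous_cpt (n : ℕ) : Continuous
    fun z : f.CollageSpace n × stdSimplex ℝ (Fin (n + 1)) => f.cpt z.1 z.2 :=
  GeometricRealization.continuous_mk (S := f.collage) (SimplexCategory.mk n)

theorem cpt_map {m n : ℕ} (θ : Fin (m + 1) →o Fin (n + 1)) (c : f.CollageSpace n)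
    (t : stdSimplex ℝ (Fin (m + 1))) :
    f.cpt (f.collageMap θ c) t = f.cpt c (stdSimplex.map θ t) :=
  GeometricRealization.mk_map (S := f.collage) (SimplexCategory.mkHom θ) c t

/-- The shadow of a simplex of the collage. -/
def shadow {n : ℕ} (c : f.CollageSpace n) : Y.NerveSpace n :=
  CompactCoherentification.map (fun p => ⟨p.1.1, p.2.shadow⟩) c.2

theorem continuous_shadow (n : ℕ) : Continuous (f.shadow (n := n)) := by
  refine continuous_sigma fun κ => ?_
  have h : Continuous fun p : {p : CollageData (X := X) (Y := Y) n κ // f.IsCollageSimplex n κ p} =>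
      (⟨p.1.1, p.2.shadow⟩ : {p : (Fin (n + 1) → Y.Obj) × (OrdMor n → Y.Mor) // Y.IsSimplex n p}) :=
    Continuous.subtype_mk (continuous_fst.comp continuous_subtype_val) _
  exact CompactCoherentification.continuous_map_of_continuous h

/-- The functor from the collage to `Y` that is the identity on `Y` and `f` on `X`, as a map of
simplicial spaces. -/
def shadowMap : f.collage ⟶ Y.nerve where
  app _ := TopCat.ofHom ⟨f.shadow, f.continuous_shadow _⟩
  naturality _ _ _ := rfl

/-- Part of a simplex of `X` may be replaced by its image in `Y`. -/
def mixed {n : ℕ} (κ : Fin (n + 1) →o Bool) (x : X.NerveSpace n) : f.CollageSpace n :=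
  ⟨κ, CompactCoherentification.map (fun p =>
    ⟨((f.simplexMap n p).1, (fun i => p.1.1 i.1, fun q => p.1.2 q.1)),
      { shadow := (f.simplexMap n p).2
        obj := fun _ => rfl
        mor := fun _ => rfl
        src := fun q => p.2.src q.1
        tgt := fun q => p.2.tgt q.1
        ident := fun i => p.2.ident i.1
        comp := fun i j k hij hjk _ => p.2.comp i j k hij hjk }⟩) x⟩

theorem continuous_mixed {n : ℕ} (κ : Fin (n + 1) →o Bool) : Continuous (f.mixed κ) := by
  refine continuous_sigmaMk.comp (CompactCoherentification.continuous_map_of_continuous ?_)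
  refine Continuous.subtype_mk (Continuous.prodMk ?_ ?_) _
  · exact continuous_subtype_val.comp (f.continuous_simplexMap n)
  · fun_prop

/-- Restriction of a simplex of the nerve along a monotone map. -/
def _root_.TopologicalCategory.nerveRestrict (X : TopologicalCategory.{u}) {m n : ℕ}
    (θ : Fin (m + 1) →o Fin (n + 1)) (x : X.NerveSpace n) : X.NerveSpace m :=
  CompactCoherentification.map (X.simplexRestrict θ) x

theorem collageMap_mixed {m n : ℕ} (θ : Fin (m + 1) →o Fin (n + 1)) (κ : Fin (n + 1) →o Bool)
    (x : X.NerveSpace n) :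
    f.collageMap θ (f.mixed κ x) = f.mixed (κ.comp θ) (X.nerveRestrict θ x) := rfl

/-- The inclusion of `X` into the collage, as a map of simplicial spaces. -/
def inclX : X.nerve ⟶ f.collage where
  app _ := TopCat.ofHom ⟨f.mixed ⊤, f.continuous_mixed _⟩
  naturality _ _ _ := rfl

/-- A simplex of `Y` as a simplex of the collage. -/
def ofY {n : ℕ} (y : Y.NerveSpace n) : f.CollageSpace n :=
  ⟨⊥, CompactCoherentification.map (fun p =>
    ⟨(p.1, (fun i => absurd i.2 Bool.false_ne_true, fun q => absurd q.2 Bool.false_ne_true)),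
      { shadow := p.2
        obj := fun i => absurd i.2 Bool.false_ne_true
        mor := fun q => absurd q.2 Bool.false_ne_true
        src := fun q => absurd q.2 Bool.false_ne_true
        tgt := fun q => absurd q.2 Bool.false_ne_true
        ident := fun i => absurd i.2 Bool.false_ne_true
        comp := fun _ _ _ _ _ hi => absurd hi Bool.false_ne_true }⟩) y⟩

theorem continuous_ofY (n : ℕ) : Continuous (f.ofY (n := n)) := by
  refine continuous_sigmaMk.comp (CompactCoherentification.continuous_map_of_continuous ?_)
  refine Continuous.subtype_mk (Continuous.prodMk (by fun_prop) (Continuous.prodMk ?_ ?_)) _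
  · exact continuous_pi fun i => absurd i.2 Bool.false_ne_true
  · exact continuous_pi fun q => absurd q.2 Bool.false_ne_true

theorem collageMap_ofY {m n : ℕ} (θ : Fin (m + 1) →o Fin (n + 1)) (y : Y.NerveSpace n) :
    f.collageMap θ (f.ofY y) = f.ofY (Y.nerveRestrict θ y) := by
  refine congrArg (Sigma.mk (⊥ : Fin (m + 1) →o Bool)) ?_
  refine congrArg (CompactCoherentification.mk _) (Subtype.ext (Prod.ext rfl (Prod.ext ?_ ?_)))
  · exact funext fun i => absurd i.2 Bool.false_ne_true
  · exact funext fun q => absurd q.2 Bool.false_ne_true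

theorem mixed_bot {n : ℕ} (x : X.NerveSpace n) :
    f.mixed ⊥ x = f.ofY (CompactCoherentification.map (f.simplexMap n) x) := by
  refine congrArg (Sigma.mk (⊥ : Fin (n + 1) →o Bool)) ?_
  refine congrArg (CompactCoherentification.mk _) (Subtype.ext (Prod.ext rfl (Prod.ext ?_ ?_)))
  · exact funext fun i => absurd i.2 Bool.false_ne_true
  · exact funext fun q => absurd q.2 Bool.false_ne_true

/-- The inclusion of `Y` into the collage, as a map of simplicial spaces. -/
def inclY : Y.nerve ⟶ f.collage where
  app n := TopCat.ofHom ⟨f.ofY, f.continuous_ofY _⟩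
  naturality m n θ := by
    ext y
    exact (f.collageMap_ofY θ.unop.toOrderHom y).symm

theorem map_shadowMap_inclY (b : Y.ClassifyingSpace) :
    GeometricRealization.map f.shadowMap (GeometricRealization.map f.inclY b) = b := by
  obtain ⟨⟨n, y, t⟩⟩ := b
  rfl

theorem map_shadowMap_inclX (b : X.ClassifyingSpace) :
    GeometricRealization.map f.shadowMap (GeometricRealization.map f.inclX b) =
      f.classifyingMap b := by
  obtain ⟨⟨n, y, t⟩⟩ := b
  rfl

end TopologicalFunctor

/-! ### Points of a geometric realization as step functions -/

open Finset in
/-- The index at time `τ` of a point `t` of the simplex, if the vertex `i` is given the half-open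
interval of length `t i`, and these intervals follow one another. -/
def timeIndex {n : ℕ} (t : stdSimplex ℝ (Fin (n + 1))) (τ : Set.Ico (0 : ℝ) 1) : Fin (n + 1) :=
  (univ.filter fun i => (τ : ℝ) < ∑ j ∈ Iic i, t j).min' ⟨Fin.last n, by
    rw [mem_filter]
    refine ⟨mem_univ _, ?_⟩
    have h : Iic (Fin.last n) = univ := by ext i; simp [Fin.le_last]
    rw [h, stdSimplex.sum_eq_one]
    exact τ.2.2⟩

namespace timeIndex

open Finset

variable {m n : ℕ} {s t : stdSimplex ℝ (Fin (n + 1))} {τ τ' : Set.Ico (0 : ℝ) 1}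

theorem le_iff {i : Fin (n + 1)} : timeIndex t τ ≤ i ↔ (τ : ℝ) < ∑ j ∈ Iic i, t j := by
  constructor
  · intro h
    have h1 : timeIndex t τ ∈ univ.filter fun i => (τ : ℝ) < ∑ j ∈ Iic i, t j := min'_mem _ _
    refine (mem_filter.1 h1).2.trans_le ?_
    exact sum_le_sum_of_subset_of_nonneg (Iic_subset_Iic.2 h)
      fun j _ _ => stdSimplex.zero_le t j
  · intro h
    exact min'_le _ _ (by simpa using h)

theorem lt_sum_Iic : (τ : ℝ) < ∑ j ∈ Iic (timeIndex t τ), t j := le_iff.1 le_rfl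

theorem sum_Iio_le : ∑ j ∈ Iio (timeIndex t τ), t j ≤ τ := by
  by_contra! h
  obtain h0 | ⟨k, hk⟩ := Fin.eq_zero_or_eq_succ (timeIndex t τ)
  · rw [h0] at h
    have : Iio (0 : Fin (n + 1)) = ∅ := by ext i; simp
    rw [this, sum_empty] at h
    exact absurd τ.2.1 (not_le.2 h)
  · have : Iio (timeIndex t τ) = Iic k.castSucc := by
      ext i
      rw [hk, mem_Iio, mem_Iic]
      exact Fin.le_castSucc_iff.symm
    rw [this] at h
    have h1 := le_iff.2 h
    rw [hk, Fin.le_def] at h1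
    simp at h1

theorem eq_iff {i : Fin (n + 1)} :
    timeIndex t τ = i ↔ ∑ j ∈ Iio i, t j ≤ τ ∧ (τ : ℝ) < ∑ j ∈ Iic i, t j := by
  constructor
  · rintro rfl
    exact ⟨sum_Iio_le, lt_sum_Iic⟩
  · rintro ⟨h1, h2⟩
    refine le_antisymm (le_iff.2 h2) ?_
    by_contra! h
    refine absurd ((lt_sum_Iic (t := t) (τ := τ)).trans_le ?_) (not_lt.2 h1)
    refine sum_le_sum_of_subset_of_nonneg (fun j hj => ?_) fun j _ _ => stdSimplex.zero_le t j
    exact mem_Iio.2 ((mem_Iic.1 hj).trans_lt h)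

theorem mono (h : τ ≤ τ') : timeIndex t τ ≤ timeIndex t τ' :=
  le_iff.2 (lt_of_le_of_lt h lt_sum_Iic)

theorem map (θ : Fin (m + 1) →o Fin (n + 1)) (t : stdSimplex ℝ (Fin (m + 1))) :
    timeIndex (stdSimplex.map θ t) τ = θ (timeIndex t τ) := by
  have key (l : Fin (n + 1)) : ∑ j ∈ Iic l, stdSimplex.map θ t j =
      ∑ i ∈ univ.filter (fun i => θ i ≤ l), t i := by
    simp_rw [stdSimplex_map_apply]
    rw [sum_sigma' ]
    refine sum_bij' (fun x _ => x.2) (fun i _ => ⟨θ i, i⟩) ?_ ?_ ?_ ?_ ?_ <;> simp_all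
  refine eq_of_forall_ge_iff fun l => ?_
  rw [le_iff, key]
  constructor
  · intro h
    by_contra! h1
    refine absurd (h.trans_le ?_) (not_lt.2 (sum_Iio_le (t := t) (τ := τ)))
    refine sum_le_sum_of_subset_of_nonneg (fun i hi => ?_) fun j _ _ => stdSimplex.zero_le t j
    rw [mem_Iio]
    by_contra! h2
    exact absurd ((θ.monotone h2).trans (mem_filter.1 hi).2) (not_le.2 h1)
  · intro h
    refine (lt_sum_Iic (t := t) (τ := τ)).trans_le ?_
    refine sum_le_sum_of_subset_of_nonneg (fun i hi => ?_) fun j _ _ => stdSimplex.zero_le t j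
    exact mem_filter.2 ⟨mem_univ _, (θ.monotone (mem_Iic.1 hi)).trans h⟩

/-- A point of the simplex is determined by its indices at all times. -/
theorem ext (h : ∀ τ, timeIndex s τ = timeIndex t τ) : s = t := by
  have nonneg (r : stdSimplex ℝ (Fin (n + 1))) (S : Finset (Fin (n + 1))) : 0 ≤ ∑ j ∈ S, r j :=
    sum_nonneg fun j _ => stdSimplex.zero_le r j
  have le_one (r : stdSimplex ℝ (Fin (n + 1))) (S : Finset (Fin (n + 1))) : ∑ j ∈ S, r j ≤ 1 := by
    rw [← stdSimplex.sum_eq_one r]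
    exact sum_le_sum_of_subset_of_nonneg (subset_univ _) fun j _ _ => stdSimplex.zero_le r j
  have key (i : Fin (n + 1)) : ∑ j ∈ Iic i, s j = ∑ j ∈ Iic i, t j := by
    refine le_antisymm ?_ ?_ <;> by_contra! h1
    · have h2 := (le_iff (t := s) (τ := ⟨_, nonneg t (Iic i), h1.trans_le (le_one s _)⟩)).2 h1
      rw [h, le_iff] at h2
      exact lt_irrefl _ h2
    · have h2 := (le_iff (t := t) (τ := ⟨_, nonneg s (Iic i), h1.trans_le (le_one t _)⟩)).2 h1
      rw [← h, le_iff] at h2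
      exact lt_irrefl _ h2
  have key' (i : Fin (n + 1)) : ∑ j ∈ Iio i, s j = ∑ j ∈ Iio i, t j := by
    obtain rfl | ⟨k, rfl⟩ := Fin.eq_zero_or_eq_succ i
    · have : Iio (0 : Fin (n + 1)) = ∅ := by ext i; simp
      rw [this, sum_empty, sum_empty]
    · have : Iio k.succ = Iic k.castSucc := by
        ext i
        rw [mem_Iio, mem_Iic]
        exact Fin.le_castSucc_iff.symm
      rw [this, key]
  refine DFunLike.ext _ _ fun i => ?_
  have h1 := key i
  have : Iic i = insert i (Iio i) := by
    ext j
    simp [le_iff_eq_or_lt]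
  rw [this, sum_insert (by simp), sum_insert (by simp), key' i] at h1
  linarith

/-- The indices of a point of the simplex at several times. -/
def hom {N : ℕ} (t : stdSimplex ℝ (Fin (n + 1))) (τ : Fin (N + 1) →o Set.Ico (0 : ℝ) 1) :
    Fin (N + 1) →o Fin (n + 1) where
  toFun k := timeIndex t (τ k)
  monotone' _ _ h := mono (τ.monotone h)

/-- The points of two simplices have a common refinement, which is given by indices at certain
times. -/
theorem exists_refinement (s : stdSimplex ℝ (Fin (m + 1))) (t : stdSimplex ℝ (Fin (n + 1))) :
    ∃ (N : ℕ) (τ : Fin (N + 1) →o Set.Ico (0 : ℝ) 1) (q : stdSimplex ℝ (Fin (N + 1))),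
      stdSimplex.map (hom s τ) q = s ∧ stdSimplex.map (hom t τ) q = t := by
  -- the times at which the intervals of the two points begin
  let P : Finset ℝ := ((insert 0 ((univ.image fun i => ∑ j ∈ Iic i, s j) ∪
    (univ.image fun i => ∑ j ∈ Iic i, t j))).filter fun x => x < 1)
  have hP0 : (0 : ℝ) ∈ P := by simp [P]
  have hP (x : ℝ) (hx : x ∈ P) : 0 ≤ x ∧ x < 1 := by
    refine ⟨?_, (mem_filter.1 hx).2⟩
    have h := (mem_filter.1 hx).1
    simp only [mem_insert, mem_union, mem_image, mem_univ, true_and] at h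
    obtain rfl | ⟨i, rfl⟩ | ⟨i, rfl⟩ := h
    · exact le_rfl
    · exact sum_nonneg fun j _ => stdSimplex.zero_le s j
    · exact sum_nonneg fun j _ => stdSimplex.zero_le t j
  obtain ⟨N, hN⟩ : ∃ N, P.card = N + 1 := Nat.exists_eq_succ_of_ne_zero (card_pos.2 ⟨0, hP0⟩).ne'
  let p : Fin (N + 1) ↪o ℝ := P.orderEmbOfFin hN
  have hp (k : Fin (N + 1)) : p k ∈ P := P.orderEmbOfFin_mem hN k
  have hpsurj (x : ℝ) (hx : x ∈ P) : ∃ k, p k = x := by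
    have : x ∈ Set.range p := by
      rw [P.range_orderEmbOfFin hN]
      exact hx
    exact this
  let g : ℕ → ℝ := fun k => if h : k < N + 1 then p ⟨k, h⟩ else 1
  have hgp (k : Fin (N + 1)) : g k = p k := dif_pos k.2
  have hgmono (k : ℕ) (hk : k < N + 1) : g k ≤ g (k + 1) := by
    by_cases h : k + 1 < N + 1
    · simp only [g, dif_pos h, dif_pos hk]
      exact p.monotone (Fin.mk_le_mk.2 k.le_succ)
    · simp only [g, dif_neg h, dif_pos hk]
      exact (hP _ (hp _)).2.le
  have hg0 : g 0 = 0 := by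
    obtain ⟨k, hk⟩ := hpsurj 0 hP0
    refine le_antisymm ?_ ?_
    · rw [← hk]
      exact (hgp 0).le.trans (p.monotone (Fin.zero_le k))
    · rw [show g 0 = p 0 from hgp 0]
      exact (hP _ (hp 0)).1
  have hg1 : g (N + 1) = 1 := dif_neg (lt_irrefl _)
  have hsum (k : ℕ) : ∑ j ∈ range k, (g (j + 1) - g j) = g k := by
    rw [sum_range_sub, hg0, sub_zero]
  let q : stdSimplex ℝ (Fin (N + 1)) := ⟨fun k => g (k + 1) - g k,
    fun k => sub_nonneg.2 (hgmono k k.2), by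
      rw [Fin.sum_univ_eq_sum_range (fun k => g (k + 1) - g k), hsum, hg1]⟩
  have hq (k : Fin (N + 1)) : q k = g (k + 1) - g k := rfl
  have hIic (k : Fin (N + 1)) : ∑ j ∈ Iic k, q j = g (k + 1) := by
    have h := sum_map (Iic k) Fin.valEmbedding (fun k => g (k + 1) - g k)
    rw [Fin.map_valEmbedding_Iic] at h
    rw [← hsum]
    refine Eq.trans h.symm (sum_congr ?_ fun _ _ => rfl)
    ext i
    simp
  have hIio (k : Fin (N + 1)) : ∑ j ∈ Iio k, q j = g k := by
    have h := sum_map (Iio k) Fin.valEmbedding (fun k => g (k + 1) - g k)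
    rw [Fin.map_valEmbedding_Iio] at h
    rw [← hsum]
    refine Eq.trans h.symm (sum_congr ?_ fun _ _ => rfl)
    ext i
    simp
  let τ : Fin (N + 1) →o Set.Ico (0 : ℝ) 1 :=
    ⟨fun k => ⟨p k, hP _ (hp k)⟩, fun _ _ h => p.monotone h⟩
  have main {l : ℕ} (r : stdSimplex ℝ (Fin (l + 1)))
      (hr : ∀ i, ∑ j ∈ Iic i, r j < 1 → ∑ j ∈ Iic i, r j ∈ P) :
      stdSimplex.map (hom r τ) q = r := by
    refine ext fun x => ?_
    rw [map]
    set k := timeIndex q x with hk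
    change timeIndex r (τ k) = _
    have h1 : p k ≤ x := by
      rw [← hgp, ← hIio, hk]
      exact sum_Iio_le
    have h2 : (x : ℝ) < g (k + 1) := by
      rw [← hIic, hk]
      exact lt_sum_Iic
    refine le_antisymm (mono h1) (le_iff.2 ?_)
    have h3 := lt_sum_Iic (t := r) (τ := τ k)
    by_contra! h4
    obtain ⟨k', hk'⟩ := hpsurj _ (hr _ (h4.trans_lt x.2.2))
    rw [← hk'] at h3 h4
    have h5 : k < k' := p.lt_iff_lt.1 h3
    have h6 : g (k + 1) ≤ p k' := by
      have h7 : (k : ℕ) + 1 < N + 1 := by omega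
      simp only [g, dif_pos h7]
      exact p.monotone (Fin.mk_le_of_le_val h5)
    linarith
  refine ⟨N, τ, q, main s fun i hi => ?_, main t fun i hi => ?_⟩ <;>
    refine mem_filter.2 ⟨mem_insert_of_mem ?_, hi⟩
  · exact mem_union_left _ (mem_image_of_mem _ (mem_univ i))
  · exact mem_union_right _ (mem_image_of_mem _ (mem_univ i))

end timeIndex

namespace GeometricRealization

variable {S : SimplicialObject TopCat.{u}}

/-- Two representatives define the same point of the realization if and only if the simplices
found at any increasing sequence of times are the same. -/
theorem mk_eq_mk_iff {m n : SimplexCategory} {x : S.obj (Opposite.op m)}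
    {y : S.obj (Opposite.op n)} {s : SimplexCategory.toTop₀.obj m}
    {t : SimplexCategory.toTop₀.obj n} :
    mk S m x s = mk S n y t ↔ ∀ (N : ℕ) (τ : Fin (N + 1) →o Set.Ico (0 : ℝ) 1),
      S.map (SimplexCategory.mkHom (timeIndex.hom s τ) : SimplexCategory.mk N ⟶ m).op x =
        S.map (SimplexCategory.mkHom (timeIndex.hom t τ) : SimplexCategory.mk N ⟶ n).op y := by
  constructor
  · intro h N τ
    let G : GeometricRealization S → S.obj (Opposite.op (SimplexCategory.mk N)) :=
      Quot.lift (fun p => S.map (SimplexCategory.mkHom (timeIndex.hom p.2.2 τ) :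
        SimplexCategory.mk N ⟶ p.1).op p.2.1) (by
        rintro _ _ ⟨θ, x, t⟩
        have h1 : (SimplexCategory.mkHom (timeIndex.hom (SimplexCategory.toTop₀.map θ t) τ) :
              SimplexCategory.mk N ⟶ _) =
            (SimplexCategory.mkHom (timeIndex.hom t τ) : SimplexCategory.mk N ⟶ _) ≫ θ := by
          refine SimplexCategory.Hom.ext _ _ (OrderHom.ext _ _ (funext fun k => ?_))
          exact timeIndex.map θ.toOrderHom t
        simp only [h1, op_comp, S.map_comp]
        rfl)
    exact congrArg G h
  · intro h
    obtain ⟨N, τ, q, hs, ht⟩ := timeIndex.exists_refinement s t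
    have h1 := mk_map (S := S)
      (SimplexCategory.mkHom (timeIndex.hom s τ) : SimplexCategory.mk N ⟶ m) x q
    have h2 := mk_map (S := S)
      (SimplexCategory.mkHom (timeIndex.hom t τ) : SimplexCategory.mk N ⟶ n) y q
    rw [h N τ, h2] at h1
    have e1 : SimplexCategory.toTop₀.map
      (SimplexCategory.mkHom (timeIndex.hom s τ) : SimplexCategory.mk N ⟶ m) q = s := hs
    have e2 : SimplexCategory.toTop₀.map
      (SimplexCategory.mkHom (timeIndex.hom t τ) : SimplexCategory.mk N ⟶ n) q = t := ht
    rw [e1, e2] at h1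
    exact h1.symm

end GeometricRealization

/-! ### The homotopy between the two inclusions -/

open Finset in
/-- A point of the simplex in which the interval of the vertex `l` is cut at time `a`, so that the
vertex `l` is doubled; if `a` does not lie in this interval, then the nearest point of the
interval is used. -/
def cutSimplex {n : ℕ} (l : Fin (n + 1)) (t : stdSimplex ℝ (Fin (n + 1))) (a : ℝ) :
    stdSimplex ℝ (Fin (n + 2)) :=
  ⟨l.castSucc.insertNth (α := fun _ => ℝ) (max 0 (min (a - ∑ i ∈ Iio l, t i) (t l)))
    (Function.update t l (t l - max 0 (min (a - ∑ i ∈ Iio l, t i) (t l)))), by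
    have h0 := stdSimplex.zero_le t
    refine ⟨fun i => ?_, ?_⟩
    · refine Fin.succAboveCases l.castSucc ?_ (fun j => ?_) i
      · rw [Fin.insertNth_apply_same]
        exact le_max_left _ _
      · rw [Fin.insertNth_apply_succAbove, Function.update_apply]
        split_ifs
        · exact sub_nonneg.2 (max_le (h0 l) (min_le_right _ _))
        · exact h0 j
    · rw [Fin.sum_univ_succAbove _ l.castSucc]
      simp only [Fin.insertNth_apply_same, Fin.insertNth_apply_succAbove]
      rw [sum_update_of_mem (mem_univ l), ← add_assoc, add_sub_cancel, add_comm,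
        sum_sdiff_eq_sub (subset_univ _), sum_singleton, sub_add_cancel, stdSimplex.sum_eq_one]⟩

namespace cutSimplex

open Finset

variable {n : ℕ} (l : Fin (n + 1)) (t : stdSimplex ℝ (Fin (n + 1))) (a : ℝ)

theorem continuous :
    Continuous fun z : stdSimplex ℝ (Fin (n + 1)) × ℝ => cutSimplex l z.1 z.2 := by
  have h (i : Fin (n + 1)) : Continuous fun z : stdSimplex ℝ (Fin (n + 1)) × ℝ => z.1 i :=
    (continuous_apply i).comp (continuous_subtype_val.comp continuous_fst)
  have hc : Continuous fun z : stdSimplex ℝ (Fin (n + 1)) × ℝ =>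
      max 0 (min (z.2 - ∑ i ∈ Iio l, z.1 i) (z.1 l)) :=
    continuous_const.max ((continuous_snd.sub (continuous_finsetSum _ fun i _ => h i)).min (h l))
  refine Continuous.subtype_mk (continuous_pi fun i => ?_) _
  refine Fin.succAboveCases l.castSucc ?_ (fun j => ?_) i
  · simpa only [Fin.insertNth_apply_same] using hc
  · simp only [Fin.insertNth_apply_succAbove, Function.update_apply]
    split_ifs
    · exact (h l).sub hc
    · exact h j

/-- Degeneracies, as monotone maps. -/
def _root_.Fin.predAboveHom (l : Fin (n + 1)) : Fin (n + 2) →o Fin (n + 1) :=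
  ⟨l.predAbove, Fin.predAbove_right_monotone l⟩

theorem apply_castSucc : cutSimplex l t a l.castSucc =
    max 0 (min (a - ∑ i ∈ Iio l, t i) (t l)) :=
  Fin.insertNth_apply_same (α := fun _ => ℝ) _ _ _

theorem apply_succAbove (k : Fin (n + 1)) : cutSimplex l t a (l.castSucc.succAbove k) =
    Function.update t l (t l - max 0 (min (a - ∑ i ∈ Iio l, t i) (t l))) k :=
  Fin.insertNth_apply_succAbove (α := fun _ => ℝ) _ _ _ _

theorem map_predAbove : stdSimplex.map (Fin.predAboveHom l) (cutSimplex l t a) = t := by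
  refine stdSimplex.ext (funext fun j => ?_)
  rw [stdSimplex_map_apply, sum_filter, Fin.sum_univ_succAbove _ l.castSucc]
  change (if l.predAbove l.castSucc = j then _ else _) +
    ∑ k, (if l.predAbove (l.castSucc.succAbove k) = j then _ else _) = _
  simp only [Fin.predAbove_succAbove, Fin.predAbove_castSucc_self]
  rw [sum_ite_eq' univ j, if_pos (mem_univ j), apply_castSucc, apply_succAbove,
    Function.update_apply]
  by_cases h : l = j
  · subst h
    simp
  · rw [if_neg h, if_neg (Ne.symm h), zero_add]

/-- The order-preserving map to `Bool` that is true after the vertex `l`. -/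
def cut (l : Fin (n + 1)) : Fin (n + 2) →o Bool :=
  ⟨fun i => decide (l.castSucc < i), fun i j h => by
    by_cases hi : l.castSucc < i
    · simp [hi, hi.trans_le h]
    · simp [hi]⟩

variable {l t a}

theorem cut_timeIndex (h1 : ∑ i ∈ Iio l, t i ≤ a) (h2 : a ≤ ∑ i ∈ Iic l, t i)
    (τ : Set.Ico (0 : ℝ) 1) : cut l (timeIndex (cutSimplex l t a) τ) = decide (a ≤ τ) := by
  have ins {k : ℕ} (i : Fin k) : Iic i = insert i (Iio i) := by
    ext j
    simp [le_iff_eq_or_lt]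
  have key : ∑ i ∈ Iic l.castSucc, cutSimplex l t a i = a := by
    rw [ins, sum_insert (by simp), apply_castSucc, ← Fin.map_castSuccEmb_Iio, sum_map]
    have h3 : ∑ i ∈ Iio l, cutSimplex l t a (Fin.castSuccEmb i) = ∑ i ∈ Iio l, t i := by
      refine sum_congr rfl fun i hi => ?_
      have hil := mem_Iio.1 hi
      have h4 := apply_succAbove l t a i
      rw [Fin.succAbove_of_castSucc_lt _ _ (Fin.castSucc_lt_castSucc_iff.2 hil),
        Function.update_of_ne hil.ne] at h4
      exact h4
    rw [ins, sum_insert (by simp)] at h2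
    rw [h3, min_eq_left (by linarith), max_eq_right (by linarith), sub_add_cancel]
  refine decide_eq_decide.2 ?_
  rw [← not_le, timeIndex.le_iff, key, not_lt]

theorem exists_mem (t : stdSimplex ℝ (Fin (n + 1))) (a : I) :
    ∃ l, ∑ i ∈ Iio l, t i ≤ a ∧ (a : ℝ) ≤ ∑ i ∈ Iic l, t i := by
  by_cases ha : (a : ℝ) < 1
  · exact ⟨timeIndex t ⟨a, a.2.1, ha⟩, timeIndex.sum_Iio_le (τ := ⟨a, a.2.1, ha⟩),
      (timeIndex.lt_sum_Iic (τ := ⟨a, a.2.1, ha⟩)).le⟩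
  · have h1 : (a : ℝ) = 1 := le_antisymm a.2.2 (not_lt.1 ha)
    refine ⟨Fin.last n, ?_, ?_⟩
    · rw [h1, ← stdSimplex.sum_eq_one t]
      exact sum_le_sum_of_subset_of_nonneg (subset_univ _) fun j _ _ => stdSimplex.zero_le t j
    · have h : Iic (Fin.last n) = univ := by ext i; simp [Fin.le_last]
      rw [h1, h, stdSimplex.sum_eq_one]

end cutSimplex

namespace TopologicalCategory

variable (X : TopologicalCategory.{u})

/-- The point of the classifying space given by a simplex and a point of `Δ^n`. -/
def npt {n : ℕ} (x : X.NerveSpace n) (t : stdSimplex ℝ (Fin (n + 1))) : X.ClassifyingSpace :=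
  GeometricRealization.mk X.nerve (SimplexCategory.mk n) x t

theorem exists_npt (b : X.ClassifyingSpace) :
    ∃ (n : ℕ) (x : X.NerveSpace n) (t : stdSimplex ℝ (Fin (n + 1))), b = X.npt x t := by
  obtain ⟨⟨n, c, t⟩⟩ := b
  exact ⟨n.len, c, t, rfl⟩

theorem continuous_npt (n : ℕ) : Continuous
    fun z : X.NerveSpace n × stdSimplex ℝ (Fin (n + 1)) => X.npt z.1 z.2 :=
  GeometricRealization.continuous_mk (S := X.nerve) (SimplexCategory.mk n)

theorem npt_map {m n : ℕ} (θ : Fin (m + 1) →o Fin (n + 1)) (x : X.NerveSpace n)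
    (t : stdSimplex ℝ (Fin (m + 1))) :
    X.npt (X.nerveRestrict θ x) t = X.npt x (stdSimplex.map θ t) :=
  GeometricRealization.mk_map (S := X.nerve) (SimplexCategory.mkHom θ) x t

variable {X} in
theorem npt_eq_iff {m n : ℕ} {x : X.NerveSpace m} {y : X.NerveSpace n}
    {s : stdSimplex ℝ (Fin (m + 1))} {t : stdSimplex ℝ (Fin (n + 1))} :
    X.npt x s = X.npt y t ↔ ∀ (N : ℕ) (τ : Fin (N + 1) →o Set.Ico (0 : ℝ) 1),
      X.nerveRestrict (timeIndex.hom s τ) x = X.nerveRestrict (timeIndex.hom t τ) y :=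
  GeometricRealization.mk_eq_mk_iff (S := X.nerve) (m := .mk m) (n := .mk n)

end TopologicalCategory

namespace TopologicalFunctor

open TopologicalCategory

variable {X Y : TopologicalCategory.{u}} (f : TopologicalFunctor X Y)

variable {f} in
theorem cpt_eq_iff {m n : ℕ} {c : f.CollageSpace m} {d : f.CollageSpace n}
    {s : stdSimplex ℝ (Fin (m + 1))} {t : stdSimplex ℝ (Fin (n + 1))} :
    f.cpt c s = f.cpt d t ↔ ∀ (N : ℕ) (τ : Fin (N + 1) →o Set.Ico (0 : ℝ) 1),
      f.collageMap (timeIndex.hom s τ) c = f.collageMap (timeIndex.hom t τ) d :=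
  GeometricRealization.mk_eq_mk_iff (S := f.collage) (m := .mk m) (n := .mk n)

/-- The point of the classifying space of the collage that is obtained from a point of the
classifying space of `X` by replacing the part before time `a` by its image in `Y`, if `a` lies
in the interval of the vertex `l`. -/
def cutPoint {n : ℕ} (l : Fin (n + 1)) (x : X.NerveSpace n) (t : stdSimplex ℝ (Fin (n + 1)))
    (a : ℝ) : f.CollageRealization :=
  f.cpt (f.mixed (cutSimplex.cut l) (X.nerveRestrict (Fin.predAboveHom l) x)) (cutSimplex l t a)

/-- The times in a sequence that are not before `a`. -/
def notBefore {N : ℕ} (a : ℝ) (τ : Fin (N + 1) →o Set.Ico (0 : ℝ) 1) : Fin (N + 1) →o Bool :=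
  ⟨fun i => decide (a ≤ τ i), fun i j hij => by
    by_cases hi : a ≤ τ i
    · simp [hi, hi.trans (τ.monotone hij)]
    · simp [hi]⟩

/-- Cutting at time `a`, seen at a sequence of times: the values before `a` are moved to `Y`. -/
theorem collageMap_cut {n : ℕ} {l : Fin (n + 1)} (x : X.NerveSpace n)
    {t : stdSimplex ℝ (Fin (n + 1))} {a : ℝ} (hl : ∑ i ∈ Finset.Iio l, t i ≤ a)
    (hl' : a ≤ ∑ i ∈ Finset.Iic l, t i) {N : ℕ} (τ : Fin (N + 1) →o Set.Ico (0 : ℝ) 1) :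
    f.collageMap (timeIndex.hom (cutSimplex l t a) τ)
        (f.mixed (cutSimplex.cut l) (X.nerveRestrict (Fin.predAboveHom l) x)) =
      f.mixed (notBefore a τ) (X.nerveRestrict (timeIndex.hom t τ) x) := by
  rw [collageMap_mixed]
  have h1 : (cutSimplex.cut l).comp (timeIndex.hom (cutSimplex l t a) τ) = notBefore a τ :=
    OrderHom.ext _ _ (funext fun i => cutSimplex.cut_timeIndex hl hl' (τ i))
  have h2 : (Fin.predAboveHom l).comp (timeIndex.hom (cutSimplex l t a) τ) =
      timeIndex.hom t τ := by
    refine OrderHom.ext _ _ (funext fun i => ?_)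
    have h3 := timeIndex.map (τ := τ i) (Fin.predAboveHom l) (cutSimplex l t a)
    rw [cutSimplex.map_predAbove] at h3
    exact h3.symm
  rw [h1, ← h2]
  rfl

/-- The point `cutPoint` depends neither on the representative nor on the choice of the vertex. -/
theorem cutPoint_congr {m n : ℕ} {k : Fin (m + 1)} {l : Fin (n + 1)} {x : X.NerveSpace m}
    {y : X.NerveSpace n} {s : stdSimplex ℝ (Fin (m + 1))} {t : stdSimplex ℝ (Fin (n + 1))} {a : ℝ}
    (hk : ∑ i ∈ Finset.Iio k, s i ≤ a) (hk' : a ≤ ∑ i ∈ Finset.Iic k, s i)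
    (hl : ∑ i ∈ Finset.Iio l, t i ≤ a) (hl' : a ≤ ∑ i ∈ Finset.Iic l, t i)
    (h : X.npt x s = X.npt y t) : f.cutPoint k x s a = f.cutPoint l y t a := by
  refine cpt_eq_iff.2 fun N τ => ?_
  rw [f.collageMap_cut x hk hk', f.collageMap_cut y hl hl', npt_eq_iff.1 h N τ]

theorem _root_.continuous_sigma_prod {ι Z W : Type*} {A : ι → Type*} [TopologicalSpace Z]
    [TopologicalSpace W] [∀ i, TopologicalSpace (A i)] {g : (Σ i, A i) × Z → W}
    (h : ∀ i, Continuous fun z : A i × Z => g (⟨i, z.1⟩, z.2)) : Continuous g := by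
  have h1 : Continuous fun s : Σ i, A i × Z => g (⟨s.1, s.2.1⟩, s.2.2) := continuous_sigma h
  exact h1.comp Homeomorph.sigmaProdDistrib.continuous

/-- The homotopy from the composite `BX → BY → M` to the inclusion `BX → M`, where `M` is the
classifying space of the collage. -/
theorem exists_cylinder : ∃ D : C(X.ClassifyingSpace × I, f.CollageRealization),
    (∀ b, D (b, 0) = GeometricRealization.map f.inclX b) ∧
    (∀ b, D (b, 1) = GeometricRealization.map f.inclY (f.classifyingMap b)) ∧
    ∀ b a, GeometricRealization.map f.shadowMap (D (b, a)) = f.classifyingMap b := by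
  -- `D` replaces the part of a point before time `a` by its image in `Y`. The vertex `l` whose
  -- interval contains `a` is not unique, but this does not matter by `cutPoint_congr`.
  choose l hl hl' using fun (n : ℕ) => cutSimplex.exists_mem (n := n)
  let D₀ : PreRealization X.nerve → I → f.CollageRealization := fun p a =>
    f.cutPoint (l p.1.len p.2.2 a) p.2.1 p.2.2 a
  let D : X.ClassifyingSpace → I → f.CollageRealization := Quot.lift D₀ (by
    rintro _ _ ⟨θ, x, t⟩
    exact funext fun a => f.cutPoint_congr (hl _ _ _) (hl' _ _ _) (hl _ _ _) (hl' _ _ _)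
      (X.npt_map θ.toOrderHom x t))
  have hD₀ : Continuous fun z : PreRealization X.nerve × I => D₀ z.1 z.2 := by
    refine continuous_sigma_prod fun n => ?_
    let C (k : Fin (n.len + 1)) :
        Set ((X.NerveSpace n.len × stdSimplex ℝ (Fin (n.len + 1))) × I) :=
      {z | ∑ i ∈ Finset.Iio k, z.1.2 i ≤ z.2 ∧ (z.2 : ℝ) ≤ ∑ i ∈ Finset.Iic k, z.1.2 i}
    have ht (i : Fin (n.len + 1)) : Continuous
        fun z : (X.NerveSpace n.len × stdSimplex ℝ (Fin (n.len + 1))) × I => z.1.2 i :=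
      (continuous_apply i).comp
        (continuous_subtype_val.comp (continuous_snd.comp continuous_fst))
    have ha : Continuous
        fun z : (X.NerveSpace n.len × stdSimplex ℝ (Fin (n.len + 1))) × I => (z.2 : ℝ) :=
      continuous_subtype_val.comp continuous_snd
    refine (locallyFinite_of_finite C).continuous
      (Set.iUnion_eq_univ_iff.2 fun z => ⟨l _ z.1.2 z.2, hl _ _ _, hl' _ _ _⟩) (fun k => ?_)
      fun k => ?_
    · exact (isClosed_le (continuous_finsetSum _ fun i _ => ht i) ha).inter
        (isClosed_le ha (continuous_finsetSum _ fun i _ => ht i))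
    · have hc : Continuous
          fun z : (X.NerveSpace n.len × stdSimplex ℝ (Fin (n.len + 1))) × I =>
            f.cutPoint k z.1.1 z.1.2 z.2 := by
        refine (f.continuous_cpt _).comp (Continuous.prodMk ?_ ?_)
        · exact (f.continuous_mixed _).comp ((CompactCoherentification.continuous_map_of_continuous
            (X.continuous_simplexRestrict _)).comp (continuous_fst.comp continuous_fst))
        · exact (cutSimplex.continuous k).comp ((continuous_snd.comp continuous_fst).prodMk ha)
      exact hc.continuousOn.congr fun z hz =>
        f.cutPoint_congr (hl _ _ _) (hl' _ _ _) hz.1 hz.2 rfl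
  have hD : Continuous fun z : X.ClassifyingSpace × I => D z.1 z.2 :=
    GeometricRealization.isQuotientMap_mk.continuous_lift_prod_left hD₀
  refine ⟨⟨fun z => D z.1 z.2, hD⟩, ?_, ?_, ?_⟩
  · rintro ⟨n, x, t⟩
    refine cpt_eq_iff.2 fun N τ => (f.collageMap_cut x (hl _ _ _) (hl' _ _ _) τ).trans ?_
    have h : notBefore (0 : I) τ = ⊤ :=
      OrderHom.ext _ _ (funext fun i => decide_eq_true (τ i).2.1)
    rw [h]
    rfl
  · rintro ⟨n, x, t⟩
    have h0 : GeometricRealization.map f.inclY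
        (f.classifyingMap (Quot.mk (PreRealization.Rel X.nerve) ⟨n, x, t⟩)) =
        f.cpt (f.mixed ⊥ x) t :=
      congrArg (fun c => f.cpt c t) (f.mixed_bot (n := n.len) x).symm
    rw [h0]
    refine cpt_eq_iff.2 fun N τ => (f.collageMap_cut x (hl _ _ _) (hl' _ _ _) τ).trans ?_
    have h : notBefore (1 : I) τ = ⊥ :=
      OrderHom.ext _ _ (funext fun i => decide_eq_false (not_le.2 (τ i).2.2))
    rw [h]
    rfl
  · rintro ⟨n, x, t⟩ a
    refine (GeometricRealization.mk_map (S := Y.nerve)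
      (SimplexCategory.mkHom (Fin.predAboveHom (l n.len t a)))
      (CompactCoherentification.map (f.simplexMap n.len) x)
      (cutSimplex (l n.len t a) t a)).trans ?_
    refine congrArg (GeometricRealization.mk Y.nerve n _) ?_
    exact cutSimplex.map_predAbove _ _ _

end TopologicalFunctor

/-! ### The filtration of the collage by the number of vertices in `Y` -/

theorem isClosed_sigma_prod {ι Z : Type*} {A : ι → Type*} [TopologicalSpace Z]
    [∀ i, TopologicalSpace (A i)] {s : Set ((Σ i, A i) × Z)}
    (h : ∀ i, IsClosed {z : A i × Z | (⟨i, z.1⟩, z.2) ∈ s}) : IsClosed s := by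
  rw [← Homeomorph.sigmaProdDistrib.symm.isClosed_preimage, isClosed_sigma_iff]
  exact h

open Finset in
/-- The beginning of the interval of a vertex. -/
def startTime {n : ℕ} (t : stdSimplex ℝ (Fin (n + 1))) (i : Fin (n + 1)) (hi : 0 < t i) :
    Set.Ico (0 : ℝ) 1 :=
  ⟨∑ j ∈ Iio i, t j, sum_nonneg fun j _ => stdSimplex.zero_le t j, by
    have h := sum_le_sum_of_subset_of_nonneg (subset_univ (insert i (Iio i)))
      fun j _ _ => stdSimplex.zero_le t j
    rw [sum_insert (by simp), stdSimplex.sum_eq_one] at h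
    linarith⟩

open Finset in
theorem timeIndex_startTime {n : ℕ} (t : stdSimplex ℝ (Fin (n + 1))) (i : Fin (n + 1))
    (hi : 0 < t i) : timeIndex t (startTime t i hi) = i := by
  refine timeIndex.eq_iff.2 ⟨le_rfl, ?_⟩
  have : Iic i = insert i (Iio i) := by
    ext j
    simp [le_iff_eq_or_lt]
  rw [this, sum_insert (by simp)]
  simpa [startTime] using hi

theorem startTime_mono {n : ℕ} (t : stdSimplex ℝ (Fin (n + 1))) {i j : Fin (n + 1)} (hij : i ≤ j)
    (hi : 0 < t i) (hj : 0 < t j) : startTime t i hi ≤ startTime t j hj :=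
  Finset.sum_le_sum_of_subset_of_nonneg (Finset.Iio_subset_Iio hij)
    fun j _ _ => stdSimplex.zero_le t j

namespace TopologicalCategory

variable (Y : TopologicalCategory.{u})

theorem comp_eq_right (a b : Y.Mor) (hab : Y.tgt a = Y.src b) (ha : a ∈ Set.range Y.ident) :
    Y.comp a b hab = b := by
  obtain ⟨y, rfl⟩ := ha
  obtain rfl : y = Y.src b := (Y.tgt_ident y).symm.trans hab
  exact Y.ident_comp b

theorem comp_eq_left (a b : Y.Mor) (hab : Y.tgt a = Y.src b) (hb : b ∈ Set.range Y.ident) :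
    Y.comp a b hab = a := by
  obtain ⟨y, rfl⟩ := hb
  obtain rfl : Y.tgt a = y := hab.trans (Y.src_ident y)
  exact Y.comp_ident a

theorem comp_congr {a a' b b' : Y.Mor} (hab : Y.tgt a = Y.src b) (ha : a = a') (hb : b = b') :
    Y.comp a b hab = Y.comp a' b' (ha ▸ hb ▸ hab) := by
  subst ha hb
  rfl

end TopologicalCategory

namespace TopologicalFunctor

open TopologicalCategory

variable {X Y : TopologicalCategory.{u}} (f : TopologicalFunctor X Y)

/-- The shadow of a morphism of a simplex of the collage. -/
def shMor {n : ℕ} (c : f.CollageSpace n) (i j : Fin (n + 1)) (h : i ≤ j) : Y.Mor :=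
  ((CompactCoherentification.mk _).symm c.2).1.1.2 ⟨(i, j), h⟩

/-- The shadow of a vertex of a simplex of the collage. -/
def shObj {n : ℕ} (c : f.CollageSpace n) (i : Fin (n + 1)) : Y.Obj :=
  ((CompactCoherentification.mk _).symm c.2).1.1.1 i

/-- The morphism in `X` between two vertices in `X` of a simplex of the collage. -/
def xMor {n : ℕ} (c : f.CollageSpace n) (i j : Fin (n + 1)) (h : i ≤ j) (hi : c.1 i = true) :
    X.Mor :=
  ((CompactCoherentification.mk _).symm c.2).1.2.2 ⟨⟨(i, j), h⟩, hi⟩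

/-- A vertex in `X` of a simplex of the collage. -/
def xObj {n : ℕ} (c : f.CollageSpace n) (i : Fin (n + 1)) (hi : c.1 i = true) : X.Obj :=
  ((CompactCoherentification.mk _).symm c.2).1.2.1 ⟨i, hi⟩

section Accessors

variable {f} {n : ℕ} (c : f.CollageSpace n)

theorem isCollageSimplex : f.IsCollageSimplex n c.1 ((CompactCoherentification.mk _).symm c.2).1 :=
  ((CompactCoherentification.mk _).symm c.2).2

theorem src_shMor (i j : Fin (n + 1)) (h : i ≤ j) : Y.src (f.shMor c i j h) = f.shObj c i :=
  (isCollageSimplex c).shadow.src ⟨(i, j), h⟩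

theorem tgt_shMor (i j : Fin (n + 1)) (h : i ≤ j) : Y.tgt (f.shMor c i j h) = f.shObj c j :=
  (isCollageSimplex c).shadow.tgt ⟨(i, j), h⟩

theorem shMor_congr {i j i' j' : Fin (n + 1)} (hij : i ≤ j) (hij' : i' ≤ j') (h : i = i')
    (h' : j = j') : f.shMor c i j hij = f.shMor c i' j' hij' := by
  subst h h'
  rfl

theorem shMor_self (i : Fin (n + 1)) : f.shMor c i i le_rfl = Y.ident (f.shObj c i) :=
  (isCollageSimplex c).shadow.ident i

theorem shMor_comp (i j k : Fin (n + 1)) (hij : i ≤ j) (hjk : j ≤ k) :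
    f.shMor c i k (hij.trans hjk) = Y.comp (f.shMor c i j hij) (f.shMor c j k hjk)
      ((tgt_shMor c i j hij).trans (src_shMor c j k hjk).symm) :=
  (isCollageSimplex c).shadow.comp i j k hij hjk

theorem continuous_shMor (i j : Fin (n + 1)) (h : i ≤ j) :
    Continuous fun c : f.CollageSpace n => f.shMor c i j h :=
  continuous_sigma fun _ => (continuous_apply (⟨(i, j), h⟩ : OrdMor n)).comp
    (continuous_snd.comp (continuous_fst.comp
      (continuous_subtype_val.comp CompactCoherentification.continuous_mk_symm)))

theorem continuous_shObj (i : Fin (n + 1)) :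
    Continuous fun c : f.CollageSpace n => f.shObj c i :=
  continuous_sigma fun _ => (continuous_apply i).comp
    (continuous_fst.comp (continuous_fst.comp
      (continuous_subtype_val.comp CompactCoherentification.continuous_mk_symm)))

variable {c} in
theorem collage_ext {c' : f.CollageSpace n} (h1 : ∀ i, c.1 i = c'.1 i)
    (h2 : ∀ i j h, f.shMor c i j h = f.shMor c' i j h)
    (h3 : ∀ i j h hi hi', f.xMor c i j h hi = f.xMor c' i j h hi') : c = c' := by
  obtain ⟨κ, p⟩ := c
  obtain ⟨κ', p'⟩ := c'
  obtain rfl : κ = κ' := OrderHom.ext _ _ (funext h1)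
  refine congrArg (Sigma.mk κ) ((CompactCoherentification.mk _).symm.injective ?_)
  have hp := isCollageSimplex (f := f) ⟨κ, p⟩
  have hp' := isCollageSimplex (f := f) ⟨κ, p'⟩
  refine Subtype.ext (Prod.ext (Prod.ext (funext fun i => ?_) (funext fun q => ?_))
    (Prod.ext (funext fun i => ?_) (funext fun q => ?_)))
  · exact (src_shMor (f := f) ⟨κ, p⟩ i i le_rfl).symm.trans
      ((congrArg Y.src (h2 i i le_rfl)).trans (src_shMor (f := f) ⟨κ, p'⟩ i i le_rfl))
  · exact h2 q.1.1 q.1.2 q.2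
  · exact (hp.src ⟨⟨(i.1, i.1), le_rfl⟩, i.2⟩).symm.trans
      ((congrArg X.src (h3 i.1 i.1 le_rfl i.2 i.2)).trans
        (hp'.src ⟨⟨(i.1, i.1), le_rfl⟩, i.2⟩))
  · exact h3 q.1.1.1 q.1.1.2 q.1.2 q.2 q.2

end Accessors

/-- The type of the vertices and the shadows of the morphisms of a simplex, at two times, are
determined by the point of the realization. -/
theorem eval_two {m n : ℕ} {c : f.CollageSpace m} {d : f.CollageSpace n}
    {s : stdSimplex ℝ (Fin (m + 1))} {t : stdSimplex ℝ (Fin (n + 1))} (h : f.cpt c s = f.cpt d t)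
    {τ τ' : Set.Ico (0 : ℝ) 1} (hτ : τ ≤ τ') :
    c.1 (timeIndex s τ) = d.1 (timeIndex t τ) ∧ c.1 (timeIndex s τ') = d.1 (timeIndex t τ') ∧
      f.shMor c _ _ (timeIndex.mono (t := s) hτ) = f.shMor d _ _ (timeIndex.mono (t := t) hτ) := by
  have h1 := cpt_eq_iff.1 h 1 ⟨![τ, τ'], by
    intro i j hij
    fin_cases i <;> fin_cases j <;> simp_all⟩
  exact ⟨congrArg (fun c : f.CollageSpace 1 => c.1 0) h1,
    congrArg (fun c : f.CollageSpace 1 => c.1 1) h1,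
    congrArg (fun c : f.CollageSpace 1 => f.shMor c 0 1 (Fin.zero_le _)) h1⟩

/-- The points of the classifying space of the collage that are represented by simplices with at
most `r` vertices in `Y`. -/
def collageFil (r : ℕ) : Set f.CollageRealization :=
  {b | ∃ (n : ℕ) (c : f.CollageSpace n) (t : stdSimplex ℝ (Fin (n + 1))),
    (∀ i : Fin (n + 1), r ≤ i → c.1 i = true) ∧ f.cpt c t = b}

theorem collageFil_mono {r s : ℕ} (h : r ≤ s) : f.collageFil r ⊆ f.collageFil s := by
  rintro b ⟨n, c, t, hc, rfl⟩
  exact ⟨n, c, t, fun i hi => hc i (h.trans hi), rfl⟩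

theorem cpt_mem_collageFil {n : ℕ} (c : f.CollageSpace n) (t : stdSimplex ℝ (Fin (n + 1))) :
    f.cpt c t ∈ f.collageFil (n + 1) :=
  ⟨n, c, t, fun i hi => absurd i.2 (not_lt.2 hi), rfl⟩

/-- A representative is reduced if the weights of its vertices in `Y` are positive, and
consecutive such vertices are not connected by identities. -/
def IsReduced {n : ℕ} (c : f.CollageSpace n) (t : stdSimplex ℝ (Fin (n + 1))) : Prop :=
  (∀ i, c.1 i = false → 0 < t i) ∧
    ∀ i : Fin n, c.1 i.succ = false →
      f.shMor c i.castSucc i.succ (Fin.castSucc_lt_succ).le ∉ Set.range Y.ident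

theorem eq_false_of_le {n : ℕ} (c : f.CollageSpace n) {i j : Fin (n + 1)} (hij : i ≤ j)
    (h : c.1 j = false) : c.1 i = false := by
  by_contra h1
  rw [Bool.not_eq_false] at h1
  rw [OrderHom.bool_mono hij h1] at h
  exact absurd h (by decide)

/-- A reduced representative has the least possible number of vertices in `Y`: another
representative has different vertices at the beginnings of the intervals of these vertices, as they
are separated by morphisms that are not identities. -/
theorem IsReduced.bounded {n r : ℕ} {c : f.CollageSpace n} {t : stdSimplex ℝ (Fin (n + 1))}
    (h : f.IsReduced c t) (hr : f.cpt c t ∈ f.collageFil r) (i : Fin (n + 1)) (hi : r ≤ i) :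
    c.1 i = true := by
  obtain ⟨n', c', t', hc', hcc⟩ := hr
  by_contra hci
  rw [Bool.not_eq_true] at hci
  have hfalse (j : Fin (n + 1)) (hj : j ≤ i) : c.1 j = false := f.eq_false_of_le c hj hci
  have key (k : ℕ) (hk : k ≤ i) (hk' : k < n + 1) :
      k ≤ timeIndex t' (startTime t ⟨k, hk'⟩ (h.1 _ (hfalse _ hk))) := by
    induction k with
    | zero => exact Nat.zero_le _
    | succ k ih =>
      have ih' := ih (by omega) (by omega)
      have hlt : (⟨k, by omega⟩ : Fin (n + 1)) ≤ ⟨k + 1, hk'⟩ := Fin.mk_le_mk.2 k.le_succ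
      have h0 := h.1 _ (hfalse ⟨k, by omega⟩ (Fin.mk_le_of_le_val (by omega)))
      have h1 := h.1 _ (hfalse ⟨k + 1, hk'⟩ hk)
      have hst := startTime_mono t hlt h0 h1
      refine lt_of_le_of_lt ih' (lt_of_le_of_ne (timeIndex.mono hst) fun heq => ?_)
      have h2 := (f.eval_two hcc.symm hst).2.2
      refine h.2 ⟨k, by omega⟩ (hfalse ⟨k + 1, hk'⟩ hk) ?_
      have h3 : f.shMor c ⟨k, by omega⟩ ⟨k + 1, hk'⟩ hlt ∈ Set.range Y.ident := by
        have e1 := timeIndex_startTime t _ h0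
        have e2 := timeIndex_startTime t _ h1
        have e3 := Fin.ext heq
        rw [shMor_congr c hlt (timeIndex.mono hst) e1.symm e2.symm, h2,
          shMor_congr c' _ le_rfl rfl e3.symm, shMor_self]
        exact ⟨_, rfl⟩
      exact h3
  have h1 := key i le_rfl i.2
  have h0 := h.1 i hci
  have h2 := (f.eval_two hcc.symm (le_refl (startTime t i h0))).1
  rw [timeIndex_startTime, hci, hc' _ (hi.trans h1)] at h2
  exact absurd h2 (by decide)

/-- The face maps, as monotone maps. -/
def _root_.Fin.succAboveHom {n : ℕ} (i : Fin (n + 2)) : Fin (n + 1) →o Fin (n + 2) :=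
  ⟨i.succAbove, (Fin.strictMono_succAbove i).monotone⟩

/-- A vertex of weight zero can be omitted. -/
theorem cpt_face {n : ℕ} (i : Fin (n + 2)) (k : Fin (n + 1)) (c : f.CollageSpace (n + 1))
    (t : stdSimplex ℝ (Fin (n + 2))) (h : i = k.castSucc ∨ i = k.succ) (hi : t i = 0) :
    f.cpt (f.collageMap i.succAboveHom c) (stdSimplex.map k.predAboveHom t) = f.cpt c t := by
  rw [cpt_map, stdSimplex.map_comp_apply]
  congr 1
  refine stdSimplex_map_eq_self fun j hj => ?_
  have hji : j ≠ i := by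
    rintro rfl
    exact hj.ne' hi
  change i.succAbove (k.predAbove j) = j
  obtain rfl | rfl := h
  · exact Fin.succAbove_predAbove hji
  · exact Fin.succ_succAbove_predAbove hji

/-- If two consecutive vertices in `Y` are connected by an identity, then the second one can be
omitted, and its weight is added to that of the first one. -/
theorem cpt_face_of_ident {n : ℕ} (k : Fin (n + 1)) (c : f.CollageSpace (n + 1))
    (t : stdSimplex ℝ (Fin (n + 2))) (hk : c.1 k.succ = false)
    (h : f.shMor c k.castSucc k.succ (Fin.castSucc_lt_succ).le ∈ Set.range Y.ident) :
    f.cpt (f.collageMap k.succ.succAboveHom c) (stdSimplex.map k.predAboveHom t) = f.cpt c t := by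
  have hk' : c.1 k.castSucc = false := f.eq_false_of_le c (Fin.castSucc_lt_succ).le hk
  rw [cpt_map, stdSimplex.map_comp_apply]
  have he (j : Fin (n + 2)) :
      (k.succ.succAboveHom.comp k.predAboveHom j = j ∧ j ≠ k.succ) ∨
        (k.succ.succAboveHom.comp k.predAboveHom j = k.castSucc ∧ j = k.succ) := by
    by_cases hj : j = k.succ
    · subst hj
      refine Or.inr ⟨?_, rfl⟩
      change k.succ.succAbove (k.predAbove k.succ) = k.castSucc
      rw [Fin.predAbove_succ_self, Fin.succAbove_succ_self]
    · exact Or.inl ⟨Fin.succ_succAbove_predAbove hj, hj⟩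
  have hc : f.collageMap (k.succ.succAboveHom.comp k.predAboveHom) c = c := by
    have hobj : f.shObj c k.castSucc = f.shObj c k.succ := by
      obtain ⟨y, hy⟩ := h
      rw [← src_shMor c _ _ (Fin.castSucc_lt_succ).le,
        ← tgt_shMor c k.castSucc _ (Fin.castSucc_lt_succ).le, ← hy, Y.src_ident, Y.tgt_ident]
    have hid : f.shMor c k.castSucc k.succ (Fin.castSucc_lt_succ).le =
        Y.ident (f.shObj c k.castSucc) := by
      obtain ⟨y, hy⟩ := h
      rw [← src_shMor c _ _ (Fin.castSucc_lt_succ).le, ← hy, Y.src_ident]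
    have genx {i j i' j' : Fin (n + 2)} (hij : i ≤ j) (hi hi')
        (hij' : i' ≤ j') (h : i = i') (h' : j = j') :
        f.xMor c i j hij hi = f.xMor c i' j' hij' hi' := by
      subst h h'
      rfl
    refine collage_ext (fun i => ?_) (fun i j hij => ?_) fun i j hij hi hi' => ?_
    · change c.1 (k.succ.succAboveHom.comp k.predAboveHom i) = c.1 i
      obtain ⟨h1, -⟩ | ⟨h1, rfl⟩ := he i
      · rw [h1]
      · rw [h1, hk, hk']
    · have hm := (k.succ.succAboveHom.comp k.predAboveHom).monotone hij
      change f.shMor c (k.succ.succAboveHom.comp k.predAboveHom i)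
        (k.succ.succAboveHom.comp k.predAboveHom j) hm = _
      obtain ⟨h1, h1'⟩ | ⟨h1, rfl⟩ := he i <;> obtain ⟨h2, h2'⟩ | ⟨h2, rfl⟩ := he j
      · exact shMor_congr c _ _ h1 h2
      · have h3 : i ≤ k.castSucc := by
          rw [Fin.le_castSucc_iff]
          exact lt_of_le_of_ne hij h1'
        rw [shMor_congr c hm h3 h1 h2, shMor_comp c i _ _ h3 (Fin.castSucc_lt_succ).le,
          Y.comp_eq_left _ _ _ h]
      · rw [shMor_congr c hm ((Fin.castSucc_lt_succ).le.trans hij) h1 h2,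
          shMor_comp c _ _ _ (Fin.castSucc_lt_succ).le hij, Y.comp_eq_right _ _ _ h]
      · rw [shMor_congr c hm le_rfl h1 h2, shMor_self, shMor_self, hobj]
    · have hne {i : Fin (n + 2)} (hi : c.1 i = true) :
          k.succ.succAboveHom.comp k.predAboveHom i = i := by
        obtain ⟨h1, -⟩ | ⟨h1, rfl⟩ := he i
        · exact h1
        · rw [hk] at hi
          exact absurd hi (by decide)
      exact genx _ _ _ _ (hne hi') (hne (OrderHom.bool_mono hij hi'))
  have h1 := f.cpt_map (k.succ.succAboveHom.comp k.predAboveHom) c t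
  rw [hc] at h1
  exact h1.symm

/-- A simplex that is not reduced can be replaced by one of its faces. -/
theorem cpt_mem_of_not_isReduced {n r : ℕ} (c : f.CollageSpace n) (t : stdSimplex ℝ (Fin (n + 1)))
    (hc : ∀ i : Fin (n + 1), r + 1 ≤ i → c.1 i = true) (h : ¬ f.IsReduced c t) :
    f.cpt c t ∈ f.collageFil r := by
  have key {n : ℕ} (c : f.CollageSpace (n + 1)) (t : stdSimplex ℝ (Fin (n + 2)))
      (hc : ∀ i : Fin (n + 2), r + 1 ≤ i → c.1 i = true) (i : Fin (n + 2)) (hi : c.1 i = false)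
      (j : Fin (n + 1)) (hj : r ≤ j) : (f.collageMap i.succAboveHom c).1 j = true := by
    refine hc _ ?_
    have hir : (i : ℕ) ≤ r := by
      by_contra! h1
      rw [hc i h1] at hi
      exact absurd hi (by decide)
    change r + 1 ≤ (i.succAbove j : ℕ)
    rw [Fin.succAbove_of_le_castSucc _ _ (Fin.le_def.2 (by simpa using hir.trans hj)),
      Fin.val_succ]
    omega
  obtain _ | n := n
  · refine absurd ⟨fun i _ => ?_, fun i => i.elim0⟩ h
    have := stdSimplex.sum_eq_one t
    rw [Fin.sum_univ_one] at this
    rw [show i = 0 from Fin.ext (by omega), this]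
    exact one_pos
  · rw [IsReduced, not_and_or] at h
    push Not at h
    obtain ⟨i, hi, hti⟩ | ⟨i, hi, hid⟩ := h
    · have hti' := le_antisymm hti (stdSimplex.zero_le t i)
      obtain ⟨k, hk⟩ : ∃ k : Fin (n + 1), i = k.castSucc ∨ i = k.succ := by
        obtain rfl | ⟨k, rfl⟩ := Fin.eq_zero_or_eq_succ i
        · exact ⟨0, Or.inl rfl⟩
        · exact ⟨k, Or.inr rfl⟩
      rw [← f.cpt_face i k c t hk hti']
      exact ⟨n, _, _, key c t hc i hi, rfl⟩
    · rw [← f.cpt_face_of_ident i c t hi hid]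
      exact ⟨n, _, _, key c t hc _ hi, rfl⟩

theorem _root_.TopologicalCategory.isClosed_range_ident (X : TopologicalCategory.{u}) :
    IsClosed (Set.range X.ident) := by
  have h : Set.range X.ident = {a | X.ident (X.src a) = a} := by
    ext a
    constructor
    · rintro ⟨x, rfl⟩
      exact congrArg X.ident (X.src_ident x)
    · intro h
      exact ⟨_, h⟩
  rw [h]
  exact isClosed_eq (X.ident.continuous.comp X.src.continuous) continuous_id

/-- A subset of a stage of the filtration is closed if its preimages in the spaces of
representatives with few vertices in `Y` are closed: by induction, as points of the stage have no
reduced representatives with more vertices in `Y`, so that the other representatives have a face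
that can be used instead. -/
theorem isClosed_of_subset_collageFil {r : ℕ} {A : Set f.CollageRealization}
    (hA : A ⊆ f.collageFil r)
    (h : ∀ (n : ℕ) (κ : Fin (n + 1) →o Bool), (∀ i : Fin (n + 1), r ≤ i → κ i = true) →
      IsClosed {z : 𝐤 {p : CollageData (X := X) (Y := Y) n κ // f.IsCollageSimplex n κ p} ×
        stdSimplex ℝ (Fin (n + 1)) | f.cpt ⟨κ, z.1⟩ z.2 ∈ A}) : IsClosed A := by
  refine (GeometricRealization.isQuotientMap_mk (S := f.collage)).isClosed_preimage.1 ?_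
  rw [isClosed_sigma_iff]
  intro n
  suffices hn : ∀ n : ℕ, IsClosed {z : f.CollageSpace n × stdSimplex ℝ (Fin (n + 1)) |
      f.cpt z.1 z.2 ∈ A} from hn n.len
  intro n
  induction n with
  | zero =>
    refine isClosed_sigma_prod fun κ => ?_
    by_cases hκ : ∀ i : Fin 1, r ≤ i → κ i = true
    · exact h 0 κ hκ
    · convert isClosed_empty
      refine Set.eq_empty_of_forall_notMem fun z hz => hκ ?_
      refine IsReduced.bounded (c := ⟨κ, z.1⟩) (t := z.2) (f := f)
        ⟨fun i _ => ?_, fun i => i.elim0⟩ (hA hz)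
      have := stdSimplex.sum_eq_one z.2
      rw [Fin.sum_univ_one] at this
      rw [show i = 0 from Fin.ext (by omega), this]
      exact one_pos
  | succ n ih =>
    refine isClosed_sigma_prod fun κ => ?_
    by_cases hκ : ∀ i : Fin (n + 2), r ≤ i → κ i = true
    · exact h _ κ hκ
    have hcl (i : Fin (n + 2)) (k : Fin (n + 1)) :
        IsClosed {z : 𝐤 {p : CollageData (X := X) (Y := Y) (n + 1) κ //
            f.IsCollageSimplex (n + 1) κ p} × stdSimplex ℝ (Fin (n + 2)) |
          f.cpt (f.collageMap i.succAboveHom ⟨κ, z.1⟩) (stdSimplex.map k.predAboveHom z.2) ∈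
            A} := by
      refine ih.preimage (f := fun z : 𝐤 {p : CollageData (X := X) (Y := Y) (n + 1) κ //
            f.IsCollageSimplex (n + 1) κ p} × stdSimplex ℝ (Fin (n + 2)) =>
        (f.collageMap i.succAboveHom ⟨κ, z.1⟩, stdSimplex.map k.predAboveHom z.2)) ?_
      exact ((f.continuous_collageMap _).comp (continuous_sigmaMk.comp continuous_fst)).prodMk
        ((stdSimplex.continuous_map _).comp continuous_snd)
    have heq : {z : 𝐤 {p : CollageData (X := X) (Y := Y) (n + 1) κ //
            f.IsCollageSimplex (n + 1) κ p} × stdSimplex ℝ (Fin (n + 2)) |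
          f.cpt ⟨κ, z.1⟩ z.2 ∈ A} =
        (⋃ (k : Fin (n + 1)) (i : Fin (n + 2)) (_ : i = k.castSucc ∨ i = k.succ),
          {z | z.2 i = 0} ∩ {z | f.cpt (f.collageMap i.succAboveHom ⟨κ, z.1⟩)
            (stdSimplex.map k.predAboveHom z.2) ∈ A}) ∪
        (⋃ (k : Fin (n + 1)) (_ : κ k.succ = false),
          {z | f.shMor ⟨κ, z.1⟩ k.castSucc k.succ (Fin.castSucc_lt_succ).le ∈ Set.range Y.ident} ∩
            {z | f.cpt (f.collageMap k.succ.succAboveHom ⟨κ, z.1⟩)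
              (stdSimplex.map k.predAboveHom z.2) ∈ A}) := by
      ext z
      simp only [Set.mem_union, Set.mem_iUnion, Set.mem_inter_iff, Set.mem_ofPred_eq]
      constructor
      · intro hz
        have hred : ¬ f.IsReduced ⟨κ, z.1⟩ z.2 := fun hred => hκ (hred.bounded f (hA hz))
        rw [IsReduced, not_and_or] at hred
        push Not at hred
        obtain ⟨i, hi, hti⟩ | ⟨i, hi, hid⟩ := hred
        · have hti' := le_antisymm hti (stdSimplex.zero_le z.2 i)
          obtain ⟨k, hk⟩ : ∃ k : Fin (n + 1), i = k.castSucc ∨ i = k.succ := by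
            obtain rfl | ⟨k, rfl⟩ := Fin.eq_zero_or_eq_succ i
            · exact ⟨0, Or.inl rfl⟩
            · exact ⟨k, Or.inr rfl⟩
          exact Or.inl ⟨k, i, hk, hti', by rwa [f.cpt_face i k _ _ hk hti']⟩
        · exact Or.inr ⟨i, hi, hid, by rwa [f.cpt_face_of_ident i _ _ hi hid]⟩
      · rintro (⟨k, i, hk, hti, hz⟩ | ⟨i, hi, hid, hz⟩)
        · rwa [f.cpt_face i k _ _ hk hti] at hz
        · rwa [f.cpt_face_of_ident i _ _ hi hid] at hz
    change IsClosed {z : 𝐤 {p : CollageData (X := X) (Y := Y) (n + 1) κ //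
            f.IsCollageSimplex (n + 1) κ p} × stdSimplex ℝ (Fin (n + 2)) |
          f.cpt ⟨κ, z.1⟩ z.2 ∈ A}
    rw [heq]
    refine IsClosed.union ?_ ?_
    · refine isClosed_iUnion_of_finite fun k => isClosed_iUnion_of_finite fun i =>
        isClosed_iUnion_of_finite fun _ => IsClosed.inter ?_ (hcl i k)
      exact isClosed_eq ((continuous_apply i).comp (continuous_subtype_val.comp continuous_snd))
        continuous_const
    · refine isClosed_iUnion_of_finite fun k =>
        isClosed_iUnion_of_finite fun _ => IsClosed.inter ?_ (hcl _ k)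
      exact Y.isClosed_range_ident.preimage
        ((continuous_shMor _ _ _).comp (continuous_sigmaMk.comp continuous_fst))

theorem isClosed_collageFil (r : ℕ) : IsClosed (f.collageFil r) := by
  refine f.isClosed_of_subset_collageFil subset_rfl fun n κ hκ => ?_
  convert isClosed_univ
  exact Set.eq_univ_of_forall fun z => ⟨n, ⟨κ, z.1⟩, z.2, hκ, rfl⟩

/-- The classifying space of the collage has the weak topology with respect to the filtration. -/
theorem isClosed_of_forall_inter_collageFil {A : Set f.CollageRealization}
    (h : ∀ r, IsClosed (A ∩ f.collageFil r)) : IsClosed A := by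
  refine (GeometricRealization.isQuotientMap_mk (S := f.collage)).isClosed_preimage.1 ?_
  rw [isClosed_sigma_iff]
  intro n
  suffices hn : IsClosed {z : f.CollageSpace n.len × stdSimplex ℝ (Fin (n.len + 1)) |
      f.cpt z.1 z.2 ∈ A} from hn
  convert (h (n.len + 1)).preimage (f.continuous_cpt n.len) using 1
  ext z
  exact ⟨fun hz => ⟨hz, f.cpt_mem_collageFil z.1 z.2⟩, fun hz => hz.1⟩

/-- A simplex of the collage all of whose vertices are in `X` is a simplex of `X`. -/
theorem exists_mixed_eq (n : ℕ) :
    ∃ x : 𝐤 {p : CollageData (X := X) (Y := Y) n ⊤ // f.IsCollageSimplex n ⊤ p} →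
      X.NerveSpace n, Continuous x ∧ ∀ p, f.mixed ⊤ (x p) = ⟨⊤, p⟩ := by
  refine ⟨CompactCoherentification.map fun p =>
      ⟨(fun i => p.1.2.1 ⟨i, rfl⟩, fun q => p.1.2.2 ⟨q, rfl⟩),
        { src := fun q => p.2.src ⟨q, rfl⟩
          tgt := fun q => p.2.tgt ⟨q, rfl⟩
          ident := fun i => p.2.ident ⟨i, rfl⟩
          comp := fun i j k hij hjk => p.2.comp i j k hij hjk rfl }⟩,
    CompactCoherentification.continuous_map_of_continuous (by fun_prop), fun p => ?_⟩
  refine collage_ext (fun _ => rfl) (fun i j hij => ?_) fun i j hij _ _ => rfl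
  exact (isCollageSimplex (f := f) ⟨⊤, p⟩).mor ⟨⟨(i, j), hij⟩, rfl⟩

/-- `BX` is embedded in the classifying space of the collage as the zeroth stage of the
filtration. -/
theorem isClosedEmbedding_inclX : IsClosedEmbedding (GeometricRealization.map f.inclX) := by
  have hinj : Function.Injective (GeometricRealization.map f.inclX) := by
    intro a b h
    obtain ⟨m, x, s, rfl⟩ := X.exists_npt a
    obtain ⟨n, y, t, rfl⟩ := X.exists_npt b
    refine npt_eq_iff.2 fun N τ => ?_
    have h1 : f.mixed ⊤ (X.nerveRestrict (timeIndex.hom s τ) x) =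
        f.mixed ⊤ (X.nerveRestrict (timeIndex.hom t τ) y) :=
      (cpt_eq_iff (f := f) (c := f.mixed ⊤ x) (d := f.mixed ⊤ y)).1 h N τ
    refine (CompactCoherentification.mk _).symm.injective (Subtype.ext (Prod.ext ?_ ?_))
    · exact funext fun i => congrArg
        (fun p => ((CompactCoherentification.mk _).symm p).1.2.1 ⟨i, rfl⟩)
        (eq_of_heq (Sigma.mk.inj h1).2)
    · exact funext fun q => congrArg
        (fun p => ((CompactCoherentification.mk _).symm p).1.2.2 ⟨q, rfl⟩)
        (eq_of_heq (Sigma.mk.inj h1).2)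
  refine IsClosedEmbedding.of_continuous_injective_isClosedMap
    (GeometricRealization.map f.inclX).continuous hinj fun A hA => ?_
  refine f.isClosed_of_subset_collageFil (r := 0) ?_ fun n κ hκ => ?_
  · rintro _ ⟨a, -, rfl⟩
    obtain ⟨m, x, s, rfl⟩ := X.exists_npt a
    exact ⟨m, f.mixed ⊤ x, s, fun _ _ => rfl, rfl⟩
  · obtain rfl : κ = ⊤ := OrderHom.ext _ _ (funext fun i => hκ i (Nat.zero_le _))
    obtain ⟨x, hx, hmixed⟩ := f.exists_mixed_eq n
    convert (hA.preimage (X.continuous_npt n)).preimage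
      ((hx.comp continuous_fst).prodMk continuous_snd) using 1
    ext z
    have h1 : f.cpt ⟨⊤, z.1⟩ z.2 = GeometricRealization.map f.inclX (X.npt (x z.1) z.2) := by
      rw [← hmixed]
      rfl
    rw [Set.mem_ofPred_eq, h1]
    exact hinj.mem_set_image

theorem range_inclX : Set.range (GeometricRealization.map f.inclX) = f.collageFil 0 := by
  refine Set.Subset.antisymm ?_ ?_
  · rintro _ ⟨a, rfl⟩
    obtain ⟨m, x, s, rfl⟩ := X.exists_npt a
    exact ⟨m, f.mixed ⊤ x, s, fun _ _ => rfl, rfl⟩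
  · rintro _ ⟨n, ⟨κ, p⟩, t, hκ, rfl⟩
    obtain rfl : κ = ⊤ := OrderHom.ext _ _ (funext fun i => hκ i (Nat.zero_le _))
    obtain ⟨x, -, hx⟩ := f.exists_mixed_eq n
    refine ⟨X.npt (x p) t, ?_⟩
    rw [← hx p]
    rfl

end TopologicalFunctor

/-! ### Prolonging simplices by vertices in `Y` -/

/-- The extension of a monotone map by a new first element. -/
def liftHom {m n : ℕ} (θ : Fin (m + 1) →o Fin (n + 1)) : Fin (m + 2) →o Fin (n + 2) :=
  ⟨Fin.cases 0 fun i => (θ i).succ, fun i j h => by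
    induction i using Fin.cases with
    | zero => exact Fin.zero_le _
    | succ i =>
      induction j using Fin.cases with
      | zero => exact absurd h (not_le.2 (Fin.succ_pos i))
      | succ j => exact Fin.succ_le_succ_iff.2 (θ.monotone (Fin.succ_le_succ_iff.1 h))⟩

/-- The inclusion of the elements other than the first one. -/
def succHom (n : ℕ) : Fin (n + 1) →o Fin (n + 2) := ⟨Fin.succ, (Fin.strictMono_succ).monotone⟩

/-- The extension of a monotone map to `Bool` by the value `false`. -/
def consBool {n : ℕ} (κ : Fin (n + 1) →o Bool) : Fin (n + 2) →o Bool :=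
  ⟨Fin.cases false κ, fun i j h => by
    induction i using Fin.cases with
    | zero => exact Bool.false_le _
    | succ i =>
      induction j using Fin.cases with
      | zero => exact absurd h (not_le.2 (Fin.succ_pos i))
      | succ j => exact κ.monotone (Fin.succ_le_succ_iff.1 h)⟩

namespace TopologicalFunctor

open TopologicalCategory

variable {X Y : TopologicalCategory.{u}} (f : TopologicalFunctor X Y)

section Continuity

variable {f} {n : ℕ} {κ : Fin (n + 1) →o Bool}

theorem continuous_xMor (i j : Fin (n + 1)) (h : i ≤ j) (hi : κ i = true) : Continuous
    fun p : 𝐤 {p : CollageData (X := X) (Y := Y) n κ // f.IsCollageSimplex n κ p} =>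
      f.xMor ⟨κ, p⟩ i j h hi :=
  (continuous_apply (⟨⟨(i, j), h⟩, hi⟩ : {q : OrdMor n // κ q.1.1 = true})).comp
    (continuous_snd.comp (continuous_snd.comp
      (continuous_subtype_val.comp CompactCoherentification.continuous_mk_symm)))

theorem continuous_xObj (i : Fin (n + 1)) (hi : κ i = true) : Continuous
    fun p : 𝐤 {p : CollageData (X := X) (Y := Y) n κ // f.IsCollageSimplex n κ p} =>
      f.xObj ⟨κ, p⟩ i hi :=
  (continuous_apply (⟨i, hi⟩ : {i // κ i = true})).comp
    (continuous_fst.comp (continuous_snd.comp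
      (continuous_subtype_val.comp CompactCoherentification.continuous_mk_symm)))

end Continuity

/-- Continuity can be checked separately for the different types of simplices. -/
theorem continuous_of_types {n : ℕ} {Z W : Type*} [TopologicalSpace Z] [CompactlyCoherentSpace Z]
    [TopologicalSpace W] {c : Z → f.CollageSpace n} (hc : Continuous c) {g : Z → W}
    (h : ∀ (κ : Fin (n + 1) →o Bool) (A : Set Z) [CompactlyCoherentSpace A]
      (p : A → 𝐤 {p : CollageData (X := X) (Y := Y) n κ // f.IsCollageSimplex n κ p}),
      Continuous p → (∀ z : A, c z = ⟨κ, p z⟩) → Continuous fun z : A => g z) : Continuous g := by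
  let A (κ : Fin (n + 1) →o Bool) : Set Z := {z | (c z).1 = κ}
  have hA (κ : Fin (n + 1) →o Bool) : IsClosed (A κ) := by
    have h1 := @isClosed_range_sigmaMk _ (fun κ : Fin (n + 1) →o Bool =>
      𝐤 {p : CollageData (X := X) (Y := Y) n κ // f.IsCollageSimplex n κ p}) _ κ
    convert h1.preimage hc using 1
    ext z
    constructor
    · rintro rfl
      exact ⟨(c z).2, rfl⟩
    · rintro ⟨p, hp⟩
      exact (congrArg Sigma.fst hp).symm
  have : Finite (Fin (n + 1) →o Bool) := DFunLike.finite _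
  refine (locallyFinite_of_finite A).continuous
    (Set.iUnion_eq_univ_iff.2 fun z => ⟨(c z).1, rfl⟩) hA fun κ => ?_
  rw [continuousOn_iff_continuous_domRestrict]
  have := CompactlyCoherentSpace.of_isClosed_subset (hA κ)
  have hp (z : A κ) : ∃ p : 𝐤 {p : CollageData (X := X) (Y := Y) n κ //
      f.IsCollageSimplex n κ p}, c z = ⟨κ, p⟩ := by
    obtain ⟨z, rfl⟩ := z
    exact ⟨(c z).2, rfl⟩
  choose p hp using hp
  refine h κ (A κ) p ?_ hp
  refine (@IsEmbedding.sigmaMk _ (fun κ : Fin (n + 1) →o Bool =>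
        𝐤 {p : CollageData (X := X) (Y := Y) n κ // f.IsCollageSimplex n κ p})
          _ κ).continuous_iff.2 ?_
  exact (hc.comp continuous_subtype_val).congr hp

section Cons

variable {n : ℕ} (a : Y.Mor) (c : f.CollageSpace n)

/-- The morphisms of a simplex that is prolonged by a new first vertex. -/
def consMor (h : Y.tgt a = f.shObj c 0) : ∀ i j : Fin (n + 2), i ≤ j → Y.Mor :=
  Fin.cases (fun j _ => Fin.cases (Y.ident (Y.src a)) (fun j =>
      Y.comp a (f.shMor c 0 j (Fin.zero_le _)) (h.trans (src_shMor c _ _ _).symm)) j)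
    fun i => Fin.cases (fun hi => absurd hi (not_le.2 (Fin.succ_pos i)))
      fun j hj => f.shMor c i j (Fin.succ_le_succ_iff.1 hj)

/-- The vertices in `X` of a simplex that is prolonged by a new first vertex. -/
def consXObj : ∀ i : Fin (n + 2), consBool c.1 i = true → X.Obj :=
  Fin.cases (fun h => absurd h Bool.false_ne_true) fun i hi => f.xObj c i hi

/-- The morphisms in `X` of a simplex that is prolonged by a new first vertex. -/
def consXMor : ∀ i j : Fin (n + 2), i ≤ j → consBool c.1 i = true → X.Mor :=
  Fin.cases (fun _ _ h => absurd h Bool.false_ne_true)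
    fun i => Fin.cases (fun hi => absurd hi (not_le.2 (Fin.succ_pos i)))
      fun j hj hi => f.xMor c i j (Fin.succ_le_succ_iff.1 hj) hi

open Classical in
/-- The simplex obtained from a simplex of the collage by adding a new first vertex in `Y`, where
`a` is the new first edge (or, if `a` does not end at the first vertex, a degenerate simplex). -/
def cons : f.CollageSpace (n + 1) :=
  if h : Y.tgt a = f.shObj c 0 then
    ⟨consBool c.1, CompactCoherentification.mk _
      ⟨((Fin.cons (Y.src a) (f.shObj c), fun q => f.consMor a c h q.1.1 q.1.2 q.2),
        (fun i => f.consXObj c i.1 i.2, fun q => f.consXMor c q.1.1.1 q.1.1.2 q.1.2 q.2)),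
        { shadow :=
            { src := by
                rintro ⟨⟨i, j⟩, hij⟩
                induction i using Fin.cases with
                | zero =>
                  induction j using Fin.cases with
                  | zero => exact Y.src_ident _
                  | succ j => exact Y.src_comp _ _ _
                | succ i =>
                  induction j using Fin.cases with
                  | zero => exact absurd hij (not_le.2 (Fin.succ_pos i))
                  | succ j => exact src_shMor c _ _ _
              tgt := by
                rintro ⟨⟨i, j⟩, hij⟩
                induction i using Fin.cases with
                | zero =>
                  induction j using Fin.cases with
                  | zero => exact Y.tgt_ident _
                  | succ j => exact (Y.tgt_comp _ _ _).trans (tgt_shMor c _ _ _)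
                | succ i =>
                  induction j using Fin.cases with
                  | zero => exact absurd hij (not_le.2 (Fin.succ_pos i))
                  | succ j => exact tgt_shMor c _ _ _
              ident := by
                intro i
                induction i using Fin.cases with
                | zero => rfl
                | succ i => exact shMor_self c i
              comp := by
                intro i j k hij hjk
                induction i using Fin.cases with
                | zero =>
                  induction j using Fin.cases with
                  | zero =>
                    refine (Y.comp_eq_right _ _ _ ⟨Y.src a, rfl⟩).symm
                  | succ j =>
                    induction k using Fin.cases with
                    | zero => exact absurd hjk (not_le.2 (Fin.succ_pos j))
                    | succ k =>
                      refine Eq.trans ?_ (Y.assoc a (f.shMor c 0 j (Fin.zero_le _))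
                        (f.shMor c j k (Fin.succ_le_succ_iff.1 hjk))
                        (h.trans (src_shMor c _ _ _).symm)
                        ((tgt_shMor c _ _ _).trans (src_shMor c _ _ _).symm)).symm
                      exact Y.comp_congr _ rfl
                        (shMor_comp c 0 j k (Fin.zero_le _) (Fin.succ_le_succ_iff.1 hjk))
                | succ i =>
                  induction j using Fin.cases with
                  | zero => exact absurd hij (not_le.2 (Fin.succ_pos i))
                  | succ j =>
                    induction k using Fin.cases with
                    | zero => exact absurd hjk (not_le.2 (Fin.succ_pos j))
                    | succ k =>
                      exact shMor_comp c i j k (Fin.succ_le_succ_iff.1 hij)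
                        (Fin.succ_le_succ_iff.1 hjk) }
          obj := by
            rintro ⟨i, hi⟩
            induction i using Fin.cases with
            | zero => exact absurd hi Bool.false_ne_true
            | succ i => exact (isCollageSimplex c).obj ⟨i, hi⟩
          mor := by
            rintro ⟨⟨⟨i, j⟩, hij⟩, hi⟩
            induction i using Fin.cases with
            | zero => exact absurd hi Bool.false_ne_true
            | succ i =>
              induction j using Fin.cases with
              | zero => exact absurd hij (not_le.2 (Fin.succ_pos i))
              | succ j => exact (isCollageSimplex c).mor ⟨⟨(i, j), Fin.succ_le_succ_iff.1 hij⟩, hi⟩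
          src := by
            rintro ⟨⟨⟨i, j⟩, hij⟩, hi⟩
            induction i using Fin.cases with
            | zero => exact absurd hi Bool.false_ne_true
            | succ i =>
              induction j using Fin.cases with
              | zero => exact absurd hij (not_le.2 (Fin.succ_pos i))
              | succ j => exact (isCollageSimplex c).src ⟨⟨(i, j), Fin.succ_le_succ_iff.1 hij⟩, hi⟩
          tgt := by
            rintro ⟨⟨⟨i, j⟩, hij⟩, hi⟩
            induction i using Fin.cases with
            | zero => exact absurd hi Bool.false_ne_true
            | succ i =>
              induction j using Fin.cases with
              | zero => exact absurd hij (not_le.2 (Fin.succ_pos i))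
              | succ j => exact (isCollageSimplex c).tgt ⟨⟨(i, j), Fin.succ_le_succ_iff.1 hij⟩, hi⟩
          ident := by
            rintro ⟨i, hi⟩
            induction i using Fin.cases with
            | zero => exact absurd hi Bool.false_ne_true
            | succ i => exact (isCollageSimplex c).ident ⟨i, hi⟩
          comp := by
            intro i j k hij hjk hi
            induction i using Fin.cases with
            | zero => exact absurd hi Bool.false_ne_true
            | succ i =>
              induction j using Fin.cases with
              | zero => exact absurd hij (not_le.2 (Fin.succ_pos i))
              | succ j =>
                induction k using Fin.cases with
                | zero => exact absurd hjk (not_le.2 (Fin.succ_pos j))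
                | succ k =>
                  exact (isCollageSimplex c).comp i j k (Fin.succ_le_succ_iff.1 hij)
                    (Fin.succ_le_succ_iff.1 hjk) hi }⟩⟩
  else f.collageMap (Fin.predAboveHom 0) c

variable {f a c}

theorem cons_zero (h : Y.tgt a = f.shObj c 0) : (f.cons a c).1 0 = false := by
  rw [cons, dif_pos h]
  rfl

theorem cons_succ (h : Y.tgt a = f.shObj c 0) (i : Fin (n + 1)) :
    (f.cons a c).1 i.succ = c.1 i := by
  rw [cons, dif_pos h]
  rfl

theorem shMor_cons_zero (h : Y.tgt a = f.shObj c 0) (j : Fin (n + 1)) :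
    f.shMor (f.cons a c) 0 j.succ (Fin.zero_le _) =
      Y.comp a (f.shMor c 0 j (Fin.zero_le _)) (h.trans (src_shMor c _ _ _).symm) := by
  rw [cons, dif_pos h]
  rfl

theorem shObj_cons_zero (h : Y.tgt a = f.shObj c 0) : f.shObj (f.cons a c) 0 = Y.src a := by
  rw [cons, dif_pos h]
  rfl

theorem collageMap_succ_cons (h : Y.tgt a = f.shObj c 0) :
    f.collageMap (succHom n) (f.cons a c) = c := by
  rw [cons, dif_pos h]
  rfl

theorem eq_cons {d : f.CollageSpace (n + 1)} (h : Y.tgt a = f.shObj c 0) (h0 : d.1 0 = false)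
    (h1 : f.collageMap (succHom n) d = c)
    (h2 : f.shMor d 0 1 (Fin.zero_le _) = a) : d = f.cons a c := by
  have e1 := collageMap_succ_cons h
  have hsrc : f.shObj d 0 = f.shObj (f.cons a c) 0 := by
    rw [shObj_cons_zero h, ← h2, src_shMor]
  refine collage_ext (fun i => ?_) (fun i j hij => ?_) fun i j hij hi hi' => ?_
  · induction i using Fin.cases with
    | zero => rw [h0, cons_zero h]
    | succ i =>
      rw [cons_succ h]
      exact congrArg (fun c : f.CollageSpace n => c.1 i) h1
  · induction i using Fin.cases with
    | zero =>
      induction j using Fin.cases with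
      | zero => rw [shMor_self, shMor_self, hsrc]
      | succ j =>
        rw [shMor_cons_zero h, shMor_comp d 0 1 j.succ (Fin.zero_le _)
          (Fin.succ_le_succ_iff.2 (Fin.zero_le j))]
        exact Y.comp_congr _ h2
          (congrArg (fun c : f.CollageSpace n => f.shMor c 0 j (Fin.zero_le _)) h1)
    | succ i =>
      induction j using Fin.cases with
      | zero => exact absurd hij (not_le.2 (Fin.succ_pos i))
      | succ j =>
        exact congrArg (fun c : f.CollageSpace n => f.shMor c i j (Fin.succ_le_succ_iff.1 hij))
          (h1.trans e1.symm)
  · induction i using Fin.cases with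
    | zero =>
      rw [h0] at hi
      exact absurd hi Bool.false_ne_true
    | succ i =>
      induction j using Fin.cases with
      | zero => exact absurd hij (not_le.2 (Fin.succ_pos i))
      | succ j =>
        have gen {c c' : f.CollageSpace n} (h : c = c') (hi hi') :
            f.xMor c i j (Fin.succ_le_succ_iff.1 hij) hi =
              f.xMor c' i j (Fin.succ_le_succ_iff.1 hij) hi' := by
          subst h
          rfl
        exact gen (h1.trans e1.symm) hi hi'

theorem collageMap_lift_cons (h : Y.tgt a = f.shObj c 0) {m : ℕ} (θ : Fin (m + 1) →o Fin (n + 1)) :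
    f.collageMap (liftHom θ) (f.cons a c) =
      f.cons (Y.comp a (f.shMor c 0 (θ 0) (Fin.zero_le _)) (h.trans (src_shMor c _ _ _).symm))
        (f.collageMap θ c) := by
  refine eq_cons ?_ ?_ ?_ ?_
  · exact (Y.tgt_comp _ _ _).trans (tgt_shMor c _ _ _)
  · exact cons_zero h
  · exact congrArg (f.collageMap θ) (collageMap_succ_cons h)
  · exact shMor_cons_zero h _

theorem continuous_cons {Z : Type*} [TopologicalSpace Z] [CompactlyCoherentSpace Z] {a : Z → Y.Mor}
    {c : Z → f.CollageSpace n} (ha : Continuous a) (hc : Continuous c)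
    (h : ∀ z, Y.tgt (a z) = f.shObj (c z) 0) : Continuous fun z => f.cons (a z) (c z) := by
  refine f.continuous_of_types hc fun κ A _ p hp hcp => ?_
  have h' (z : A) : Y.tgt (a z) = f.shObj ⟨κ, p z⟩ 0 := by rw [← hcp, h]
  have ha' : Continuous fun z : A => a z := ha.comp continuous_subtype_val
  have hsh (i j : Fin (n + 1)) (hij : i ≤ j) : Continuous fun z : A => f.shMor ⟨κ, p z⟩ i j hij :=
    (continuous_shMor i j hij).comp (continuous_sigmaMk.comp hp)
  simp_rw [hcp, cons, dif_pos (h' _)]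
  refine (@continuous_sigmaMk _ (fun κ : Fin (n + 2) →o Bool =>
    𝐤 {p : CollageData (X := X) (Y := Y) (n + 1) κ // f.IsCollageSimplex (n + 1) κ p}) _
      (consBool κ)).comp (continuous_mk_comp_of_coherent (Continuous.subtype_mk
        (Continuous.prodMk (Continuous.prodMk ?_ ?_) (Continuous.prodMk ?_ ?_)) _))
  · refine continuous_pi fun i => ?_
    induction i using Fin.cases with
    | zero => exact Y.src.continuous.comp ha'
    | succ i => exact (continuous_shObj i).comp (continuous_sigmaMk.comp hp)
  · refine continuous_pi ?_
    rintro ⟨⟨i, j⟩, hij⟩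
    induction i using Fin.cases with
    | zero =>
      induction j using Fin.cases with
      | zero => exact Y.ident.continuous.comp (Y.src.continuous.comp ha')
      | succ j => exact Y.continuous_comp_of_coherent ha' (hsh 0 j (Fin.zero_le _)) _
    | succ i =>
      induction j using Fin.cases with
      | zero => exact absurd hij (not_le.2 (Fin.succ_pos i))
      | succ j => exact hsh i j _
  · refine continuous_pi ?_
    rintro ⟨i, hi⟩
    induction i using Fin.cases with
    | zero => exact absurd hi Bool.false_ne_true
    | succ i => exact (continuous_xObj i hi).comp hp
  · refine continuous_pi ?_
    rintro ⟨⟨⟨i, j⟩, hij⟩, hi⟩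
    induction i using Fin.cases with
    | zero => exact absurd hi Bool.false_ne_true
    | succ i =>
      induction j using Fin.cases with
      | zero => exact absurd hij (not_le.2 (Fin.succ_pos i))
      | succ j =>
        exact (continuous_xMor (f := f) (κ := κ) i j (Fin.succ_le_succ_iff.1 hij) hi).comp hp

end Cons

end TopologicalFunctor

/-! ### Joins with a string of vertices in `Y` -/

/-- The extension of a monotone map by `r` new first elements. -/
def liftHomN {m n : ℕ} (θ : Fin (m + 1) →o Fin (n + 1)) :
    ∀ r : ℕ, Fin (m + r + 1) →o Fin (n + r + 1)
  | 0 => θ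
  | r + 1 => liftHom (liftHomN θ r)

/-- The inclusion of the elements other than the first `r`. -/
def shiftHom (n r : ℕ) : Fin (n + 1) →o Fin (n + r + 1) :=
  ⟨fun i => ⟨i + r, by omega⟩, fun _ _ h => Fin.mk_le_mk.2 (Nat.add_le_add_right h r)⟩

/-- The family obtained from `w` by adding the first `r` elements of the sequence `s` in front. -/
def consW {m : ℕ} (w : Fin (m + 1) → ℝ) : ∀ (r : ℕ), (ℕ → ℝ) → Fin (m + r + 1) → ℝ
  | 0, _ => w
  | r + 1, s => Fin.cons (s 0) (consW w r fun i => s (i + 1))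

theorem consW_apply {m : ℕ} (w : Fin (m + 1) → ℝ) (r : ℕ) (s : ℕ → ℝ) (i : Fin (m + r + 1)) :
    consW w r s i = if h : r ≤ i then w ⟨i - r, by omega⟩ else s i := by
  induction r generalizing s with
  | zero => simp [consW]
  | succ r ih =>
    induction i using Fin.cases with
    | zero => simp [consW]
    | succ i =>
      rw [consW, Fin.cons_succ, ih]
      simp only [Fin.val_succ, Nat.add_le_add_iff_right, Nat.add_sub_add_right]

theorem sum_consW {m : ℕ} (w : Fin (m + 1) → ℝ) (r : ℕ) (s : ℕ → ℝ) :
    ∑ i, consW w r s i = ∑ i ∈ Finset.range r, s i + ∑ i, w i := by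
  induction r generalizing s with
  | zero => simp [consW]
  | succ r ih =>
    have h := Fin.sum_univ_succ (n := m + r + 1) (consW w (r + 1) s)
    simp only [consW, Fin.cons_zero, Fin.cons_succ] at h
    rw [Finset.sum_range_succ', show ∑ i, consW w (r + 1) s i = _ from h, ih]
    ring

theorem linearMap_liftHom {m n : ℕ} (θ : Fin (m + 1) →o Fin (n + 1)) (x : ℝ)
    (w : Fin (m + 1) → ℝ) :
    FunOnFinite.linearMap ℝ ℝ (liftHom θ) (Fin.cons x w : Fin (m + 2) → ℝ) =
      (Fin.cons x (FunOnFinite.linearMap ℝ ℝ θ w) : Fin (n + 2) → ℝ) := by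
  refine funext fun j => ?_
  rw [FunOnFinite.linearMap_apply_apply, Finset.sum_filter, Fin.sum_univ_succ]
  induction j using Fin.cases with
  | zero =>
    have h0 : liftHom θ 0 = 0 := rfl
    have h (i) : liftHom θ (Fin.succ i) ≠ 0 := (Fin.succ_pos (θ i)).ne'
    simp [h0, h]
  | succ j =>
    have h0 : liftHom θ 0 ≠ j.succ := (Fin.succ_pos j).ne
    have h (i) : liftHom θ (Fin.succ i) = j.succ ↔ θ i = j := Fin.succ_inj
    simp only [h0, h, if_false, zero_add, Fin.cons_succ]
    rw [FunOnFinite.linearMap_apply_apply, Finset.sum_filter]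

theorem linearMap_liftHomN {m n : ℕ} (θ : Fin (m + 1) →o Fin (n + 1)) (w : Fin (m + 1) → ℝ)
    (r : ℕ) (s : ℕ → ℝ) :
    FunOnFinite.linearMap ℝ ℝ (liftHomN θ r) (consW w r s) =
      consW (FunOnFinite.linearMap ℝ ℝ θ w) r s := by
  induction r generalizing s with
  | zero => rfl
  | succ r ih => exact (linearMap_liftHom _ _ _).trans (congrArg _ (ih _))

theorem consW_mem {m : ℕ} {w : Fin (m + 1) → ℝ} {r : ℕ} {s : ℕ → ℝ} (hs : ∀ i < r, 0 ≤ s i)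
    (hw : ∀ i, 0 ≤ w i) (h : ∑ i ∈ Finset.range r, s i + ∑ i, w i = 1) :
    consW w r s ∈ stdSimplex ℝ (Fin (m + r + 1)) := by
  refine ⟨fun i => ?_, (sum_consW w r s).trans h⟩
  rw [consW_apply]
  split_ifs with hi
  · exact hw _
  · exact hs _ (not_le.1 hi)

namespace TopologicalCategory

/-- The edges `a 0, …, a (r - 1)` form a string of composable morphisms through the objects
`o 0, …, o r`. -/
def IsString (Y : TopologicalCategory.{u}) (r : ℕ) (a : ℕ → Y.Mor) (o : ℕ → Y.Obj) : Prop :=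
  ∀ i < r, Y.src (a i) = o i ∧ Y.tgt (a i) = o (i + 1)

theorem IsString.tail {Y : TopologicalCategory.{u}} {r : ℕ} {a : ℕ → Y.Mor} {o : ℕ → Y.Obj}
    (h : Y.IsString (r + 1) a o) : Y.IsString r (fun i => a (i + 1)) fun i => o (i + 1) :=
  fun i hi => h (i + 1) (Nat.succ_lt_succ hi)

end TopologicalCategory

namespace TopologicalFunctor

open TopologicalCategory

variable {X Y : TopologicalCategory.{u}} (f : TopologicalFunctor X Y)

/-- The simplex obtained from a simplex of the collage by adding `r` vertices in `Y` in front,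
where `a 0, …, a (r - 1)` are the new edges. -/
def consN {m : ℕ} (c : f.CollageSpace m) : ∀ (r : ℕ), (ℕ → Y.Mor) → f.CollageSpace (m + r)
  | 0, _ => c
  | r + 1, a => f.cons (a 0) (consN c r fun i => a (i + 1))

/-- The edge from the vertex `i` to the vertex `i + 1`, where junk is used if `i` is too large. -/
def edge {n : ℕ} (c : f.CollageSpace n) (i : ℕ) : Y.Mor :=
  if h : i < n then f.shMor c ⟨i, by omega⟩ ⟨i + 1, by omega⟩ (Fin.mk_le_mk.2 i.le_succ)
  else Y.ident (f.shObj c 0)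

/-- The shadow of the vertex `i`, where junk is used if `i` is too large. -/
def vtx {n : ℕ} (c : f.CollageSpace n) (i : ℕ) : Y.Obj :=
  if h : i < n + 1 then f.shObj c ⟨i, h⟩ else f.shObj c 0

variable {f} {m : ℕ} {c : f.CollageSpace m} {r : ℕ} {a : ℕ → Y.Mor} {o : ℕ → Y.Obj}

theorem edge_of_lt {n : ℕ} (c : f.CollageSpace n) {i : ℕ} (h : i < n) : f.edge c i =
    f.shMor c ⟨i, by omega⟩ ⟨i + 1, by omega⟩ (Fin.mk_le_mk.2 i.le_succ) := dif_pos h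

theorem vtx_of_lt {n : ℕ} (c : f.CollageSpace n) {i : ℕ} (h : i < n + 1) :
    f.vtx c i = f.shObj c ⟨i, h⟩ := dif_pos h

theorem isString_edge {n : ℕ} (c : f.CollageSpace n) {r : ℕ} (hr : r ≤ n) :
    Y.IsString r (f.edge c) (f.vtx c) := by
  intro i hi
  rw [edge_of_lt c (by omega), vtx_of_lt c (by omega), vtx_of_lt c (by omega)]
  exact ⟨src_shMor _ _ _ _, tgt_shMor _ _ _ _⟩

theorem shObj_consN (h : Y.IsString r a o) (hc : f.shObj c 0 = o r) :
    f.shObj (f.consN c r a) 0 = o 0 := by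
  induction r generalizing a o with
  | zero => exact hc
  | succ r ih =>
    refine (shObj_cons_zero ?_).trans (h 0 r.succ_pos).1
    rw [ih h.tail hc]
    exact (h 0 r.succ_pos).2

theorem tgt_eq_shObj_consN (h : Y.IsString (r + 1) a o) (hc : f.shObj c 0 = o (r + 1)) :
    Y.tgt (a 0) = f.shObj (f.consN c r fun i => a (i + 1)) 0 := by
  rw [shObj_consN h.tail hc]
  exact (h 0 r.succ_pos).2

theorem consN_type_of_lt (h : Y.IsString r a o) (hc : f.shObj c 0 = o r) (i : Fin (m + r + 1))
    (hi : i < r) : (f.consN c r a).1 i = false := by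
  induction r generalizing a o with
  | zero => exact absurd hi (Nat.not_lt_zero _)
  | succ r ih =>
    induction i using Fin.cases with
    | zero => exact cons_zero (tgt_eq_shObj_consN h hc)
    | succ i =>
      refine (cons_succ (tgt_eq_shObj_consN h hc) i).trans (ih h.tail hc i ?_)
      rw [Fin.val_succ] at hi
      omega

theorem collageMap_shift_consN (h : Y.IsString r a o) (hc : f.shObj c 0 = o r) :
    f.collageMap (shiftHom m r) (f.consN c r a) = c := by
  induction r generalizing a o with
  | zero => rfl
  | succ r ih =>
    have h1 := congrArg (f.collageMap (shiftHom m r))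
      (collageMap_succ_cons (tgt_eq_shObj_consN h hc))
    exact h1.trans (ih h.tail hc)

theorem edge_consN (h : Y.IsString r a o) (hc : f.shObj c 0 = o r) {i : ℕ} (hi : i < r) :
    f.edge (f.consN c r a) i = a i := by
  induction r generalizing a o i with
  | zero => exact absurd hi (Nat.not_lt_zero _)
  | succ r ih =>
    have h1 := tgt_eq_shObj_consN h hc
    rw [edge_of_lt _ (by omega)]
    cases i with
    | zero =>
      refine (shMor_cons_zero h1 0).trans ?_
      exact Y.comp_eq_left _ _ _ ⟨_, (shMor_self _ _).symm⟩
    | succ i =>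
      have h2 := ih h.tail hc (i := i) (by omega)
      rw [edge_of_lt _ (by omega)] at h2
      refine Eq.trans ?_ h2
      exact congrArg (fun c : f.CollageSpace (m + r) => f.shMor c ⟨i, by omega⟩ ⟨i + 1, by omega⟩
        (Fin.mk_le_mk.2 i.le_succ)) (collageMap_succ_cons h1)

theorem consN_congr {a a' : ℕ → Y.Mor} (h : ∀ i < r, a i = a' i) :
    f.consN c r a = f.consN c r a' := by
  induction r generalizing a a' with
  | zero => rfl
  | succ r ih =>
    rw [consN, consN, h 0 r.succ_pos, ih fun i hi => h (i + 1) (Nat.succ_lt_succ hi)]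

theorem eq_consN {r : ℕ} (d : f.CollageSpace (m + r))
    (hd : ∀ i : Fin (m + r + 1), i < r → d.1 i = false) :
    d = f.consN (f.collageMap (shiftHom m r) d) r (f.edge d) := by
  induction r with
  | zero => rfl
  | succ r ih =>
    have hs : Y.IsString (r + 1) (f.edge d) (f.vtx d) := isString_edge d (by omega)
    have h1 := ih (f.collageMap (succHom (m + r)) d) fun i hi => hd i.succ (by simpa using hi)
    rw [consN_congr (a' := fun i => f.edge d (i + 1)) fun i hi => by
      rw [edge_of_lt _ (by omega), edge_of_lt _ (by omega)]
      rfl] at h1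
    refine eq_cons ?_ (hd 0 r.succ_pos) h1 ?_
    · refine tgt_eq_shObj_consN hs ?_
      rw [vtx_of_lt _ (by omega)]
      change f.shObj d _ = f.shObj d _
      congr 1
      exact Fin.ext (Nat.zero_add _)
    · rw [edge_of_lt _ (by omega)]
      rfl

theorem collageMap_lift_consN (h : Y.IsString r a o) (hc : f.shObj c 0 = o r) {l : ℕ}
    (θ : Fin (l + 1) →o Fin (m + 1)) (hθ : θ 0 = 0) :
    f.collageMap (liftHomN θ r) (f.consN c r a) = f.consN (f.collageMap θ c) r a := by
  induction r generalizing a o with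
  | zero => rfl
  | succ r ih =>
    have h1 := tgt_eq_shObj_consN h hc
    refine (collageMap_lift_cons h1 (liftHomN θ r)).trans ?_
    rw [ih h.tail hc]
    have h0 : liftHomN θ r 0 = 0 := by
      cases r with
      | zero => exact hθ
      | succ r => rfl
    refine congrArg (fun b => f.cons b _) (Y.comp_eq_left _ _ _ ?_)
    have gen {n : ℕ} (c : f.CollageSpace n) (j : Fin (n + 1)) (hj : j = 0) :
        f.shMor c 0 j (Fin.zero_le _) ∈ Set.range Y.ident := by
      subst hj
      exact ⟨_, (shMor_self _ _).symm⟩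
    exact gen _ _ h0

theorem continuous_consN {Z : Type*} [TopologicalSpace Z] [CompactlyCoherentSpace Z]
    {a : Z → ℕ → Y.Mor} {o : Z → ℕ → Y.Obj} {c : Z → f.CollageSpace m}
    (ha : ∀ i < r, Continuous fun z => a z i) (hc : Continuous c)
    (h : ∀ z, Y.IsString r (a z) (o z)) (hco : ∀ z, f.shObj (c z) 0 = o z r) :
    Continuous fun z => f.consN (c z) r (a z) := by
  induction r generalizing a o with
  | zero => exact hc
  | succ r ih =>
    exact continuous_cons (ha 0 r.succ_pos)
      (ih (a := fun z i => a z (i + 1)) (o := fun z i => o z (i + 1))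
        (fun i hi => ha (i + 1) (Nat.succ_lt_succ hi)) (fun z => (h z).tail) hco)
      fun z => tgt_eq_shObj_consN (h z) (hco z)

variable (f) in
open Classical in
/-- The point of the classifying space of the collage with given weights; if they do not form a
point of the simplex, then a vertex is used instead. -/
def wpt {n : ℕ} (c : f.CollageSpace n) (w : Fin (n + 1) → ℝ) : f.CollageRealization :=
  f.cpt c (if h : w ∈ stdSimplex ℝ (Fin (n + 1)) then ⟨w, h⟩ else stdSimplex.vertex 0)

theorem wpt_of_mem {n : ℕ} (c : f.CollageSpace n) {w : Fin (n + 1) → ℝ}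
    (h : w ∈ stdSimplex ℝ (Fin (n + 1))) : f.wpt c w = f.cpt c ⟨w, h⟩ := by
  rw [wpt, dif_pos h]

theorem continuous_wpt {n : ℕ} {Z : Type*} [TopologicalSpace Z] {c : Z → f.CollageSpace n}
    {w : Z → Fin (n + 1) → ℝ} (hc : Continuous c) (hw : Continuous w)
    (h : ∀ z, w z ∈ stdSimplex ℝ (Fin (n + 1))) : Continuous fun z => f.wpt (c z) (w z) := by
  simp_rw [wpt_of_mem _ (h _)]
  exact (f.continuous_cpt n).comp (hc.prodMk (hw.subtype_mk h))

theorem wpt_map {m n : ℕ} (θ : Fin (m + 1) →o Fin (n + 1)) (c : f.CollageSpace n)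
    {w : Fin (m + 1) → ℝ} (h : w ∈ stdSimplex ℝ (Fin (m + 1))) :
    f.wpt (f.collageMap θ c) w = f.wpt c (FunOnFinite.linearMap ℝ ℝ θ w) := by
  have h1 : FunOnFinite.linearMap ℝ ℝ θ w ∈ stdSimplex ℝ (Fin (n + 1)) := by
    have := (stdSimplex.map θ ⟨w, h⟩).2
    exact this
  rw [wpt_of_mem _ h, wpt_of_mem _ h1, cpt_map]
  rfl

/-- The point of the classifying space of the collage that is given by a string of edges in `Y`,
followed by a simplex of the collage. -/
def joinPt (c : f.CollageSpace m) (w : Fin (m + 1) → ℝ) (r : ℕ) (a : ℕ → Y.Mor) (s : ℕ → ℝ) :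
    f.CollageRealization :=
  f.wpt (f.consN c r a) (consW w r s)

/-- Joins are compatible with restriction of the second factor, if the first vertex is kept. -/
theorem joinPt_map (h : Y.IsString r a o) (hc : f.shObj c 0 = o r) {l : ℕ}
    (θ : Fin (l + 1) →o Fin (m + 1)) (hθ : θ 0 = 0) {w : Fin (l + 1) → ℝ} {s : ℕ → ℝ}
    (hw : consW w r s ∈ stdSimplex ℝ (Fin (l + r + 1))) :
    joinPt (f.collageMap θ c) w r a s = joinPt c (FunOnFinite.linearMap ℝ ℝ θ w) r a s := by
  rw [joinPt, joinPt, ← collageMap_lift_consN h hc θ hθ, wpt_map _ _ hw, linearMap_liftHomN]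

theorem continuous_consW {Z : Type*} [TopologicalSpace Z] {w : Z → Fin (m + 1) → ℝ}
    {s : Z → ℕ → ℝ} (hw : Continuous w) (hs : ∀ i < r, Continuous fun z => s z i) :
    Continuous fun z => consW (w z) r (s z) := by
  refine continuous_pi fun i => ?_
  simp_rw [consW_apply]
  split_ifs with hi
  · exact (continuous_apply _).comp hw
  · exact hs _ (not_le.1 hi)

theorem continuous_joinPt {Z : Type*} [TopologicalSpace Z] [CompactlyCoherentSpace Z]
    {a : Z → ℕ → Y.Mor} {o : Z → ℕ → Y.Obj} {c : Z → f.CollageSpace m} {w : Z → Fin (m + 1) → ℝ}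
    {s : Z → ℕ → ℝ} (ha : ∀ i < r, Continuous fun z => a z i) (hc : Continuous c)
    (h : ∀ z, Y.IsString r (a z) (o z)) (hco : ∀ z, f.shObj (c z) 0 = o z r) (hw : Continuous w)
    (hs : ∀ i < r, Continuous fun z => s z i)
    (hm : ∀ z, consW (w z) r (s z) ∈ stdSimplex ℝ (Fin (m + r + 1))) :
    Continuous fun z => joinPt (c z) (w z) r (a z) (s z) :=
  continuous_wpt (continuous_consN ha hc h hco) (continuous_consW hw hs) hm

end TopologicalFunctor

/-! ### The strata of the filtration -/

/-- The weights of a point of the simplex as a sequence that is extended by zero. -/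
def wtN {n : ℕ} (t : stdSimplex ℝ (Fin (n + 1))) (i : ℕ) : ℝ :=
  if h : i < n + 1 then t ⟨i, h⟩ else 0

section Weights

open Finset

variable {n : ℕ} (t : stdSimplex ℝ (Fin (n + 1)))

theorem wtN_of_lt {i : ℕ} (h : i < n + 1) : wtN t i = t ⟨i, h⟩ := dif_pos h

theorem wtN_nonneg (i : ℕ) : 0 ≤ wtN t i := by
  rw [wtN]
  split_ifs
  · exact stdSimplex.zero_le t _
  · exact le_rfl

theorem continuous_wtN (i : ℕ) : Continuous fun t : stdSimplex ℝ (Fin (n + 1)) => wtN t i := by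
  by_cases h : i < n + 1
  · simp_rw [wtN_of_lt _ h]
    exact (continuous_apply _).comp continuous_subtype_val
  · simp_rw [wtN, dif_neg h]
    exact continuous_const

theorem sum_Iio_eq (i : Fin (n + 1)) : ∑ j ∈ Iio i, t j = ∑ j ∈ range i, wtN t j := by
  have h := sum_map (Iio i) Fin.valEmbedding (wtN t)
  rw [Fin.map_valEmbedding_Iio] at h
  refine Eq.trans (sum_congr rfl fun j _ => (wtN_of_lt t j.2).symm) (h.symm.trans ?_)
  refine sum_congr ?_ fun _ _ => rfl
  ext j
  simp

theorem sum_Iic_eq (i : Fin (n + 1)) : ∑ j ∈ Iic i, t j = ∑ j ∈ range (i + 1), wtN t j := by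
  have : Iic i = insert i (Iio i) := by
    ext j
    simp [le_iff_eq_or_lt]
  rw [this, sum_insert (by simp), sum_Iio_eq, sum_range_succ, wtN_of_lt t i.2, add_comm]

theorem sum_wtN {k : ℕ} (hk : n + 1 ≤ k) : ∑ j ∈ range k, wtN t j = 1 := by
  rw [← stdSimplex.sum_eq_one t, ← sum_subset (range_subset_range.2 hk) fun i _ hi => ?_,
    ← Fin.sum_univ_eq_sum_range]
  · exact sum_congr rfl fun i _ => wtN_of_lt t i.2
  · rw [wtN, dif_neg]
    simpa using hi

theorem sum_wtN_le (k : ℕ) : ∑ j ∈ range k, wtN t j ≤ 1 := by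
  rw [← sum_wtN t (le_max_right k (n + 1))]
  exact sum_le_sum_of_subset_of_nonneg (range_subset_range.2 (le_max_left _ _))
    fun j _ _ => wtN_nonneg t j

theorem timeIndex_eq_iff {τ : Set.Ico (0 : ℝ) 1} {i : Fin (n + 1)} : timeIndex t τ = i ↔
    ∑ j ∈ range i, wtN t j ≤ τ ∧ (τ : ℝ) < ∑ j ∈ range (i + 1), wtN t j := by
  rw [timeIndex.eq_iff, sum_Iio_eq, sum_Iic_eq]

end Weights

/-- The map to `Bool` that is false on the first `r + 1` elements. -/
def topType (n r : ℕ) : Fin (n + 1) →o Bool :=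
  ⟨fun i => decide (r < i), fun i j h => by
    by_cases hi : r < i
    · simp [hi, hi.trans_le (Fin.le_def.1 h)]
    · simp [hi]⟩

theorem topType_eq_false {n r : ℕ} {i : Fin (n + 1)} : topType n r i = false ↔ (i : ℕ) ≤ r := by
  change decide (r < i) = false ↔ _
  simp

theorem topType_eq_true {n r : ℕ} {i : Fin (n + 1)} : topType n r i = true ↔ r < i := by
  change decide (r < i) = true ↔ _
  simp

namespace TopologicalFunctor

open TopologicalCategory

variable {X Y : TopologicalCategory.{u}} (f : TopologicalFunctor X Y)

/-- The representatives of points of the classifying space of the collage by simplices that have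
exactly `r + 1` vertices in `Y`. -/
abbrev Stratum (r : ℕ) : Type u :=
  Σ m : ℕ, 𝐤 {p : CollageData (X := X) (Y := Y) (m + r) (topType (m + r) r) //
    f.IsCollageSimplex (m + r) (topType (m + r) r) p} × stdSimplex ℝ (Fin (m + r + 1))

namespace Stratum

variable {f} {r : ℕ}

/-- The simplex of a representative. -/
def simplex (z : f.Stratum r) : f.CollageSpace (z.1 + r) := ⟨_, z.2.1⟩

/-- The weights of a representative. -/
def weights (z : f.Stratum r) : stdSimplex ℝ (Fin (z.1 + r + 1)) := z.2.2

/-- The point defined by a representative. -/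
def pt (z : f.Stratum r) : f.CollageRealization := f.cpt z.simplex z.weights

theorem continuous_pt : Continuous (pt : f.Stratum r → f.CollageRealization) :=
  continuous_sigma fun m => (f.continuous_cpt (m + r)).comp
    ((continuous_sigmaMk.comp continuous_fst).prodMk continuous_snd)

theorem continuous_simplex (m : ℕ) : Continuous
    fun p : 𝐤 {p : CollageData (X := X) (Y := Y) (m + r) (topType (m + r) r) //
        f.IsCollageSimplex (m + r) (topType (m + r) r) p} × stdSimplex ℝ (Fin (m + r + 1)) =>
      (⟨topType (m + r) r, p.1⟩ : f.CollageSpace (m + r)) :=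
  (@continuous_sigmaMk _ (fun κ : Fin (m + r + 1) →o Bool =>
    𝐤 {p : CollageData (X := X) (Y := Y) (m + r) κ // f.IsCollageSimplex (m + r) κ p}) _ _).comp
      continuous_fst

/-- A weight of a representative. -/
def wt (z : f.Stratum r) (i : ℕ) : ℝ := wtN z.weights i

theorem continuous_wt (i : ℕ) : Continuous fun z : f.Stratum r => z.wt i :=
  continuous_sigma fun _ => (continuous_wtN i).comp continuous_snd

/-- An edge of a representative. -/
def ed (z : f.Stratum r) (i : ℕ) : Y.Mor := f.edge z.simplex i

theorem continuous_ed {i : ℕ} (hi : i < r) : Continuous fun z : f.Stratum r => z.ed i := by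
  refine continuous_sigma fun m => ?_
  have h : i < m + r := by omega
  simp_rw [ed, edge_of_lt _ h]
  exact (continuous_shMor _ _ _).comp (continuous_simplex m)

/-- A vertex of a representative. -/
def ob (z : f.Stratum r) (i : ℕ) : Y.Obj := f.vtx z.simplex i

theorem continuous_ob {i : ℕ} (hi : i ≤ r) : Continuous fun z : f.Stratum r => z.ob i := by
  refine continuous_sigma fun m => ?_
  have h : i < m + r + 1 := by omega
  simp_rw [ob, vtx_of_lt _ h]
  exact (continuous_shObj _).comp (continuous_simplex m)

theorem isString (z : f.Stratum r) : Y.IsString r z.ed z.ob :=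
  isString_edge z.simplex (Nat.le_add_left r z.1)

theorem pt_mem (z : f.Stratum r) : z.pt ∈ f.collageFil (r + 1) :=
  ⟨_, z.simplex, z.weights, fun _ hi => topType_eq_true.2 hi, rfl⟩

/-- A representative is reduced if its weights at the vertices in `Y` are positive, and
consecutive such vertices are not connected by identities. -/
def Reduced (z : f.Stratum r) : Prop :=
  (∀ i ≤ r, 0 < z.wt i) ∧ ∀ i < r, z.ed i ∉ Set.range Y.ident

theorem reduced_iff (z : f.Stratum r) : z.Reduced ↔ f.IsReduced z.simplex z.weights := by
  refine and_congr ⟨fun h i hi => ?_, fun h i hi => ?_⟩ ⟨fun h i hi => ?_, fun h i hi => ?_⟩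
  · have := h i (topType_eq_false.1 hi)
    rwa [wt, wtN_of_lt _ i.2] at this
  · have hi' : i < z.1 + r + 1 := by omega
    rw [wt, wtN_of_lt _ hi']
    exact h ⟨i, hi'⟩ (topType_eq_false.2 hi)
  · have := h i (topType_eq_false.1 hi)
    rw [ed, edge_of_lt _ i.2] at this
    exact this
  · have hi' : i < z.1 + r := by omega
    rw [ed, edge_of_lt _ hi']
    exact h ⟨i, hi'⟩ (topType_eq_false.2 hi)

theorem reduced_iff_pt (z : f.Stratum r) : z.Reduced ↔ z.pt ∉ f.collageFil r := by
  rw [reduced_iff]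
  constructor
  · intro h hr
    have h1 := h.bounded f hr ⟨r, by omega⟩ le_rfl
    exact absurd (topType_eq_true.1 h1) (lt_irrefl r)
  · intro h
    by_contra hred
    exact h (f.cpt_mem_of_not_isReduced _ _ (fun i hi => topType_eq_true.2 hi) hred)

/-- Whether a representative is reduced depends only on the point of the realization. -/
theorem Reduced.of_pt_eq {z z' : f.Stratum r} (h : z.Reduced) (hz : z.pt = z'.pt) :
    z'.Reduced := by
  rw [reduced_iff_pt] at h ⊢
  rwa [← hz]

/-- Otherwise, the index of `z` stays at the vertex `i` when that of `z'` moves on to the vertex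
`i + 1`, so that the edge between these vertices of `z'` is an identity. -/
theorem wt_le_of_sum_eq {z z' : f.Stratum r} (h : z.Reduced) (hz : z.pt = z'.pt) {i : ℕ}
    (hi : i ≤ r) (hsum : ∑ j ∈ Finset.range i, z.wt j = ∑ j ∈ Finset.range i, z'.wt j) :
    z.wt i ≤ z'.wt i := by
  have h' := h.of_pt_eq hz
  by_contra! hlt
  have hpos := h.1 i hi
  have hpos' := h'.1 i hi
  have hnn : 0 ≤ ∑ j ∈ Finset.range i, z.wt j :=
    Finset.sum_nonneg fun j _ => wtN_nonneg _ _
  have hle : ∑ j ∈ Finset.range (i + 1), z.wt j ≤ 1 := sum_wtN_le _ _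
  rw [Finset.sum_range_succ] at hle
  let τ : Set.Ico (0 : ℝ) 1 := ⟨∑ j ∈ Finset.range i, z.wt j, hnn, by linarith⟩
  let τ' : Set.Ico (0 : ℝ) 1 := ⟨∑ j ∈ Finset.range i, z.wt j + z'.wt i, by linarith,
    by linarith⟩
  have hτ : τ ≤ τ' := by
    change ∑ j ∈ Finset.range i, z.wt j ≤ ∑ j ∈ Finset.range i, z.wt j + z'.wt i
    linarith
  have e1 : timeIndex z.weights τ = ⟨i, by omega⟩ := by
    rw [timeIndex_eq_iff]
    refine ⟨le_rfl, ?_⟩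
    rw [Finset.sum_range_succ]
    change ∑ j ∈ Finset.range i, z.wt j < ∑ j ∈ Finset.range i, z.wt j + z.wt i
    linarith
  have e2 : timeIndex z.weights τ' = ⟨i, by omega⟩ := by
    rw [timeIndex_eq_iff, Finset.sum_range_succ]
    change ∑ j ∈ Finset.range i, z.wt j ≤ ∑ j ∈ Finset.range i, z.wt j + z'.wt i ∧
      ∑ j ∈ Finset.range i, z.wt j + z'.wt i < ∑ j ∈ Finset.range i, z.wt j + z.wt i
    constructor <;> linarith
  have e3 : timeIndex z'.weights τ = ⟨i, by omega⟩ := by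
    rw [timeIndex_eq_iff, Finset.sum_range_succ]
    change ∑ j ∈ Finset.range i, z'.wt j ≤ ∑ j ∈ Finset.range i, z.wt j ∧
      ∑ j ∈ Finset.range i, z.wt j < ∑ j ∈ Finset.range i, z'.wt j + z'.wt i
    constructor <;> linarith
  obtain ⟨h1, h2, h3⟩ := f.eval_two hz hτ
  have hk := timeIndex.mono (t := z'.weights) hτ
  have hne : (timeIndex z'.weights τ' : ℕ) ≠ i := by
    intro heq
    have h4 := ((timeIndex_eq_iff z'.weights (τ := τ') (i := ⟨i, by omega⟩)).1 (Fin.ext heq)).2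
    rw [Finset.sum_range_succ] at h4
    change ∑ j ∈ Finset.range i, z.wt j + z'.wt i < ∑ j ∈ Finset.range i, z'.wt j + z'.wt i at h4
    linarith
  have hlt' : i + 1 ≤ (timeIndex z'.weights τ' : ℕ) := by
    rw [e3, Fin.le_def] at hk
    change i ≤ _ at hk
    omega
  have hler : (timeIndex z'.weights τ' : ℕ) ≤ r := by
    rw [e2] at h2
    exact topType_eq_false.1 (h2.symm.trans (topType_eq_false.2 hi))
  have e4 : timeIndex z'.weights τ' = ⟨i + 1, by omega⟩ := by
    have hpos'' := h'.1 (i + 1) (by omega)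
    rw [timeIndex_eq_iff]
    change ∑ j ∈ Finset.range (i + 1), z'.wt j ≤ ∑ j ∈ Finset.range i, z.wt j + z'.wt i ∧
      ∑ j ∈ Finset.range i, z.wt j + z'.wt i < ∑ j ∈ Finset.range (i + 1 + 1), z'.wt j
    rw [Finset.sum_range_succ _ (i + 1), Finset.sum_range_succ]
    change ∑ j ∈ Finset.range i, z'.wt j + z'.wt i ≤ ∑ j ∈ Finset.range i, z.wt j + z'.wt i ∧
      ∑ j ∈ Finset.range i, z.wt j + z'.wt i <
        ∑ j ∈ Finset.range i, z'.wt j + z'.wt i + z'.wt (i + 1)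
    constructor <;> linarith
  refine h'.2 i (by omega) ?_
  rw [ed, edge_of_lt _ (by omega)]
  rw [shMor_congr z.simplex _ le_rfl e1 e2,
    shMor_congr z'.simplex _ (Fin.mk_le_mk.2 i.le_succ) e3 e4] at h3
  rw [← h3, shMor_self]
  exact ⟨_, rfl⟩

theorem wt_eq {z z' : f.Stratum r} (h : z.Reduced) (hz : z.pt = z'.pt) {i : ℕ} (hi : i ≤ r) :
    z.wt i = z'.wt i := by
  induction i using Nat.strong_induction_on with
  | _ i ih =>
    have hsum : ∑ j ∈ Finset.range i, z.wt j = ∑ j ∈ Finset.range i, z'.wt j :=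
      Finset.sum_congr rfl fun j hj => ih j (Finset.mem_range.1 hj)
        ((Finset.mem_range.1 hj).le.trans hi)
    exact le_antisymm (wt_le_of_sum_eq h hz hi hsum)
      (wt_le_of_sum_eq (h.of_pt_eq hz) hz.symm hi hsum.symm)

theorem sum_wt_eq {z z' : f.Stratum r} (h : z.Reduced) (hz : z.pt = z'.pt) {i : ℕ}
    (hi : i ≤ r + 1) : ∑ j ∈ Finset.range i, z.wt j = ∑ j ∈ Finset.range i, z'.wt j :=
  Finset.sum_congr rfl fun _ hj => wt_eq h hz (by have := Finset.mem_range.1 hj; omega)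

/-- The time at which the interval of the vertex `i` begins. -/
def start (z : f.Stratum r) (h : z.Reduced) (i : ℕ) (hi : i ≤ r) : Set.Ico (0 : ℝ) 1 :=
  ⟨∑ j ∈ Finset.range i, z.wt j, Finset.sum_nonneg fun j _ => wtN_nonneg _ _, by
    have hle : ∑ j ∈ Finset.range (i + 1), z.wt j ≤ 1 := sum_wtN_le _ _
    have := h.1 i hi
    rw [Finset.sum_range_succ] at hle
    linarith⟩

theorem timeIndex_start {z : f.Stratum r} (h : z.Reduced) {i : ℕ} (hi : i ≤ r) :
    timeIndex z.weights (z.start h i hi) = ⟨i, by omega⟩ := by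
  rw [timeIndex_eq_iff]
  refine ⟨le_rfl, ?_⟩
  have := h.1 i hi
  rw [Finset.sum_range_succ]
  change ∑ j ∈ Finset.range i, z.wt j < ∑ j ∈ Finset.range i, z.wt j + z.wt i
  linarith

theorem shMor_eq {z z' : f.Stratum r} (h : z.Reduced) (hz : z.pt = z'.pt) {i j : ℕ} (hij : i ≤ j)
    (hj : j ≤ r) : f.shMor z.simplex ⟨i, by omega⟩ ⟨j, by omega⟩ (Fin.mk_le_mk.2 hij) =
      f.shMor z'.simplex ⟨i, by omega⟩ ⟨j, by omega⟩ (Fin.mk_le_mk.2 hij) := by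
  have h' := h.of_pt_eq hz
  have hst : z.start h i (hij.trans hj) ≤ z.start h j hj :=
    Finset.sum_le_sum_of_subset_of_nonneg (Finset.range_subset_range.2 hij)
      fun _ _ _ => wtN_nonneg _ _
  have hs {i : ℕ} (hi : i ≤ r) : z.start h i hi = z'.start h' i hi :=
    Subtype.ext (sum_wt_eq h hz (by omega))
  have h3 := (f.eval_two hz hst).2.2
  have gen {n : ℕ} (c : f.CollageSpace n) {i j i' j' : Fin (n + 1)} (hij : i ≤ j)
      (hij' : i' ≤ j') (h : i = i') (h' : j = j') : f.shMor c i j hij = f.shMor c i' j' hij' := by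
    subst h h'
    rfl
  rwa [gen z.simplex _ (Fin.mk_le_mk.2 hij) (timeIndex_start h _) (timeIndex_start h _),
    gen z'.simplex _ (Fin.mk_le_mk.2 hij) ((congrArg _ (hs _)).trans (timeIndex_start h' _))
      ((congrArg _ (hs _)).trans (timeIndex_start h' _))] at h3

theorem ed_eq {z z' : f.Stratum r} (h : z.Reduced) (hz : z.pt = z'.pt) {i : ℕ} (hi : i < r) :
    z.ed i = z'.ed i := by
  rw [ed, ed, edge_of_lt _ (by omega), edge_of_lt _ (by omega)]
  exact shMor_eq h hz i.le_succ hi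

theorem ob_eq {z z' : f.Stratum r} (h : z.Reduced) (hz : z.pt = z'.pt) {i : ℕ} (hi : i ≤ r) :
    z.ob i = z'.ob i := by
  rw [ob, ob, vtx_of_lt _ (by omega), vtx_of_lt _ (by omega), ← src_shMor _ _ _ le_rfl,
    ← src_shMor _ _ _ le_rfl, shMor_eq h hz le_rfl hi]

end Stratum

/-- The stage `r + 1` of the filtration is obtained from the stage `r` and a stratum. -/
def stageMap (r : ℕ) : C(f.collageFil r ⊕ f.Stratum r, f.collageFil (r + 1)) where
  toFun := Sum.elim (fun b => ⟨b.1, f.collageFil_mono r.le_succ b.2⟩) fun z => ⟨z.pt, z.pt_mem⟩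
  continuous_toFun := by
    refine continuous_sum_dom.2 ⟨?_, ?_⟩
    · exact continuous_subtype_val.subtype_mk _
    · exact Stratum.continuous_pt.subtype_mk _

theorem exists_stratum {r n : ℕ} (c : f.CollageSpace n) (t : stdSimplex ℝ (Fin (n + 1)))
    (hc : ∀ i : Fin (n + 1), r + 1 ≤ i → c.1 i = true) :
    f.cpt c t ∈ f.collageFil r ∨ ∃ z : f.Stratum r, z.pt = f.cpt c t := by
  by_cases h : ∀ i : Fin (n + 1), r ≤ i → c.1 i = true
  · exact Or.inl ⟨n, c, t, h, rfl⟩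
  · push Not at h
    obtain ⟨i, hi, hci⟩ := h
    obtain ⟨m, rfl⟩ := Nat.exists_eq_add_of_le' (show r ≤ n by omega)
    obtain ⟨κ, p⟩ := c
    obtain rfl : κ = topType (m + r) r := by
      refine OrderHom.ext _ _ (funext fun j => ?_)
      by_cases hj : r < j
      · exact (hc j hj).trans (topType_eq_true.2 hj).symm
      · rw [topType_eq_false.2 (not_lt.1 hj)]
        refine f.eq_false_of_le ⟨κ, p⟩ (j := i) (Fin.le_def.2 (by omega)) ?_
        simpa using hci
    exact Or.inr ⟨⟨m, p, t⟩, rfl⟩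

/-- The topology of the stage `r + 1` is determined by the stage `r` and the stratum. -/
theorem isQuotientMap_stageMap (r : ℕ) : IsQuotientMap (f.stageMap r) := by
  refine isQuotientMap_iff_isClosed.2 ⟨?_, fun s =>
    ⟨fun h => h.preimage (f.stageMap r).continuous, fun h => ?_⟩⟩
  · rintro ⟨_, n, c, t, hc, rfl⟩
    obtain h | ⟨z, hz⟩ := f.exists_stratum c t hc
    · exact ⟨Sum.inl ⟨_, h⟩, rfl⟩
    · exact ⟨Sum.inr z, Subtype.ext hz⟩
  · obtain ⟨h1, h2⟩ := isClosed_sum_iff.1 h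
    have h3 : IsClosed (Subtype.val '' s : Set f.CollageRealization) := by
      refine f.isClosed_of_subset_collageFil (r := r + 1) ?_ fun n κ hκ => ?_
      · rintro _ ⟨b, -, rfl⟩
        exact b.2
      by_cases h : ∀ i : Fin (n + 1), r ≤ i → κ i = true
      · have h4 := (f.isClosed_collageFil r).isClosedEmbedding_subtypeVal.isClosedMap _ h1
        convert h4.preimage ((f.continuous_cpt n).comp
          ((continuous_sigmaMk.comp continuous_fst).prodMk continuous_snd)) using 1
        ext z
        constructor
        · rintro ⟨b, hb, hbz⟩
          let b' : f.collageFil r := ⟨f.cpt ⟨κ, z.1⟩ z.2, n, ⟨κ, z.1⟩, z.2, h, rfl⟩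
          have : f.stageMap r (Sum.inl b') = b := Subtype.ext hbz.symm
          refine ⟨b', ?_, rfl⟩
          change f.stageMap r (Sum.inl b') ∈ s
          rwa [this]
        · rintro ⟨b, hb, hbz⟩
          exact ⟨_, hb, hbz⟩
      · push Not at h
        obtain ⟨i, hi, hci⟩ := h
        obtain ⟨m, rfl⟩ := Nat.exists_eq_add_of_le' (show r ≤ n by omega)
        obtain rfl : κ = topType (m + r) r := by
          refine OrderHom.ext _ _ (funext fun j => ?_)
          by_cases hj : r < j
          · exact (hκ j hj).trans (topType_eq_true.2 hj).symm
          · rw [topType_eq_false.2 (not_lt.1 hj)]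
            have hji : j ≤ i := Fin.le_def.2 (by omega)
            by_contra h5
            exact hci (OrderHom.bool_mono hji (by simpa using h5))
        convert isClosed_sigma_iff.1 h2 m using 1
        ext z
        constructor
        · rintro ⟨b, hb, hbz⟩
          have : f.stageMap r (Sum.inr ⟨m, z⟩) = b := Subtype.ext hbz.symm
          change f.stageMap r (Sum.inr ⟨m, z⟩) ∈ s
          rwa [this]
        · intro hz
          exact ⟨_, hz, rfl⟩
    convert h3.preimage continuous_subtype_val
    rw [Set.preimage_image_eq _ Subtype.val_injective]

end TopologicalFunctor

/-! ### Simplices of the slice category as cones -/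

namespace TopologicalFunctor

open TopologicalCategory

variable {X Y : TopologicalCategory.{u}} (f : TopologicalFunctor X Y)

/-- The functor `Y₀ ↓ f → X` that sends `(g : a → f b, b)` to `b`. -/
def sliceProj : TopologicalFunctor f.slice X where
  obj := ⟨fun o => ((CompactCoherentification.mk f.SliceObj).symm o).1.2,
    continuous_snd.comp (continuous_subtype_val.comp CompactCoherentification.continuous_mk_symm)⟩
  mor := ⟨fun m => ((CompactCoherentification.mk f.SliceMor).symm m).1.2.2,
    continuous_snd.comp (continuous_snd.comp (continuous_subtype_val.comp
      CompactCoherentification.continuous_mk_symm))⟩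
  src_mor _ := rfl
  tgt_mor _ := rfl
  mor_ident _ := rfl
  mor_comp _ _ _ := rfl

/-- The simplex of `X` that underlies a simplex of `Y₀ ↓ f`. -/
def sliceX {n : ℕ} (d : f.slice.NerveSpace n) : X.NerveSpace n :=
  CompactCoherentification.map (f.sliceProj.simplexMap n) d

theorem continuous_sliceX (n : ℕ) : Continuous (f.sliceX (n := n)) :=
  CompactCoherentification.continuous_map_of_continuous (f.sliceProj.continuous_simplexMap n)

/-- The morphism of `Y` that belongs to a vertex of a simplex of `Y₀ ↓ f`. -/
def sliceEdge {n : ℕ} (d : f.slice.NerveSpace n) (i : Fin (n + 1)) : Y.Mor :=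
  ((CompactCoherentification.mk f.SliceObj).symm
    (((CompactCoherentification.mk _).symm d).1.1 i)).1.1

theorem continuous_sliceEdge {n : ℕ} (i : Fin (n + 1)) :
    Continuous fun d : f.slice.NerveSpace n => f.sliceEdge d i :=
  continuous_fst.comp (continuous_subtype_val.comp
    (CompactCoherentification.continuous_mk_symm.comp ((continuous_apply i).comp
      (continuous_fst.comp (continuous_subtype_val.comp
        CompactCoherentification.continuous_mk_symm)))))

theorem tgt_sliceEdge {n : ℕ} (d : f.slice.NerveSpace n) (i : Fin (n + 1)) :
    Y.tgt (f.sliceEdge d i) = f.shObj (f.mixed ⊤ (f.sliceX d)) i :=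
  ((CompactCoherentification.mk f.SliceObj).symm
    (((CompactCoherentification.mk _).symm d).1.1 i)).2

/-- A simplex of `Y₀ ↓ f` consists of objects with the same source `a` in `Y`, and thus gives a
simplex of the collage with first vertex `a`. -/
def sliceCone {n : ℕ} (d : f.slice.NerveSpace n) : f.CollageSpace (n + 1) :=
  f.cons (f.sliceEdge d 0) (f.mixed ⊤ (f.sliceX d))

theorem continuous_sliceCone (n : ℕ) : Continuous (f.sliceCone (n := n)) :=
  continuous_cons (f.continuous_sliceEdge 0) ((f.continuous_mixed ⊤).comp (f.continuous_sliceX n))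
    fun d => f.tgt_sliceEdge d 0

theorem shObj_sliceCone {n : ℕ} (d : f.slice.NerveSpace n) :
    f.shObj (f.sliceCone d) 0 = Y.src (f.sliceEdge d 0) :=
  shObj_cons_zero (f.tgt_sliceEdge d 0)

theorem comp_sliceEdge {n : ℕ} (d : f.slice.NerveSpace n) (i : Fin (n + 1)) :
    Y.comp (f.sliceEdge d 0) (f.shMor (f.mixed ⊤ (f.sliceX d)) 0 i (Fin.zero_le _))
      ((f.tgt_sliceEdge d 0).trans (src_shMor _ _ _ _).symm) = f.sliceEdge d i := by
  obtain ⟨p, rfl⟩ := (CompactCoherentification.mk _).surjective d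
  let q : OrdMor n := ⟨(0, i), Fin.zero_le _⟩
  have h1 := ((CompactCoherentification.mk f.SliceMor).symm (p.1.2 q)).2.comm
  have h2 := congrArg (fun o => ((CompactCoherentification.mk f.SliceObj).symm o).1.1) (p.2.src q)
  have h3 := congrArg (fun o => ((CompactCoherentification.mk f.SliceObj).symm o).1.1) (p.2.tgt q)
  refine Eq.trans ?_ (h1.trans h3)
  exact Y.comp_congr _ h2.symm rfl

theorem collageMap_liftHom_sliceCone {m n : ℕ} (θ : Fin (m + 1) →o Fin (n + 1))
    (d : f.slice.NerveSpace n) :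
    f.collageMap (liftHom θ) (f.sliceCone d) = f.sliceCone (f.slice.nerveRestrict θ d) := by
  rw [sliceCone, collageMap_lift_cons (f.tgt_sliceEdge d 0), comp_sliceEdge]
  rfl

theorem classifyingRho_npt {n : ℕ} (d : f.slice.NerveSpace n) (v : stdSimplex ℝ (Fin (n + 1))) :
    f.classifyingRho (f.slice.npt d v) = Y.src (f.sliceEdge d 0) := rfl

/-- A simplex of the collage, all of whose vertices except the first one are in `X`, gives a
simplex of `Y₀ ↓ f`. -/
def sliceOf {n : ℕ} (c : f.CollageSpace (n + 1)) (h : ∀ i : Fin (n + 1), c.1 i.succ = true) :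
    f.slice.NerveSpace n :=
  CompactCoherentification.mk _
    ⟨(fun i => CompactCoherentification.mk f.SliceObj
          ⟨(f.shMor c 0 i.succ (Fin.zero_le _), f.xObj c i.succ (h i)),
            (tgt_shMor c _ _ _).trans ((isCollageSimplex c).obj ⟨_, h i⟩).symm⟩,
        fun q => CompactCoherentification.mk f.SliceMor
          ⟨(f.shMor c 0 q.1.1.succ (Fin.zero_le _), f.shMor c 0 q.1.2.succ (Fin.zero_le _),
              f.xMor c q.1.1.succ q.1.2.succ (Fin.succ_le_succ_iff.2 q.2) (h _)),
            { tgt := (tgt_shMor c _ _ _).trans (((isCollageSimplex c).obj ⟨_, h q.1.1⟩).symm.trans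
                (congrArg f.obj ((isCollageSimplex c).src
                  ⟨⟨(q.1.1.succ, q.1.2.succ), Fin.succ_le_succ_iff.2 q.2⟩, h q.1.1⟩).symm))
              comm := by
                refine Eq.trans ?_ (shMor_comp c 0 q.1.1.succ q.1.2.succ (Fin.zero_le _)
                  (Fin.succ_le_succ_iff.2 q.2)).symm
                exact Y.comp_congr _ rfl ((isCollageSimplex c).mor
                  ⟨⟨(q.1.1.succ, q.1.2.succ), Fin.succ_le_succ_iff.2 q.2⟩, h q.1.1⟩) }⟩),
      { src := fun q => congrArg (CompactCoherentification.mk f.SliceObj) (Subtype.ext (Prod.ext rfl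
          ((isCollageSimplex c).src
            ⟨⟨(q.1.1.succ, q.1.2.succ), Fin.succ_le_succ_iff.2 q.2⟩, h q.1.1⟩)))
        tgt := fun q => congrArg (CompactCoherentification.mk f.SliceObj) (Subtype.ext (Prod.ext rfl
          ((isCollageSimplex c).tgt
            ⟨⟨(q.1.1.succ, q.1.2.succ), Fin.succ_le_succ_iff.2 q.2⟩, h q.1.1⟩)))
        ident := fun i => congrArg (CompactCoherentification.mk f.SliceMor)
          (Subtype.ext (Prod.ext rfl (Prod.ext rfl ((isCollageSimplex c).ident ⟨i.succ, h i⟩))))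
        comp := fun i j k hij hjk => congrArg (CompactCoherentification.mk f.SliceMor)
          (Subtype.ext (Prod.ext rfl (Prod.ext rfl ((isCollageSimplex c).comp i.succ j.succ k.succ
            (Fin.succ_le_succ_iff.2 hij) (Fin.succ_le_succ_iff.2 hjk) (h i))))) }⟩

theorem continuous_sliceOf {n : ℕ} {κ : Fin (n + 2) →o Bool}
    (h : ∀ i : Fin (n + 1), κ i.succ = true) :
    Continuous fun p : 𝐤 {p : CollageData (X := X) (Y := Y) (n + 1) κ //
      f.IsCollageSimplex (n + 1) κ p} => f.sliceOf ⟨κ, p⟩ h := by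
  have hsh (i j : Fin (n + 2)) (hij : i ≤ j) : Continuous fun p : 𝐤 {p : CollageData (X := X)
      (Y := Y) (n + 1) κ // f.IsCollageSimplex (n + 1) κ p} => f.shMor ⟨κ, p⟩ i j hij :=
    (continuous_shMor i j hij).comp continuous_sigmaMk
  refine continuous_mk_comp_of_coherent (Continuous.subtype_mk (Continuous.prodMk ?_ ?_) _)
  · refine continuous_pi fun i => ?_
    refine continuous_mk_comp_of_coherent (Continuous.subtype_mk (Continuous.prodMk ?_ ?_) _)
    · exact hsh _ _ _
    · exact continuous_xObj (f := f) (κ := κ) _ (h i)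
  · refine continuous_pi fun q => ?_
    refine continuous_mk_comp_of_coherent (Continuous.subtype_mk (Continuous.prodMk ?_
      (Continuous.prodMk ?_ ?_)) _)
    · exact hsh _ _ _
    · exact hsh _ _ _
    · exact continuous_xMor (f := f) (κ := κ) _ _ _ (h _)

theorem sliceCone_sliceOf {n : ℕ} (c : f.CollageSpace (n + 1))
    (h : ∀ i : Fin (n + 1), c.1 i.succ = true) (h0 : c.1 0 = false) :
    f.sliceCone (f.sliceOf c h) = c := by
  refine (eq_cons (tgt_sliceEdge _ _ _) h0 ?_ rfl).symm
  refine collage_ext h (fun i j hij => ?_) fun i j hij _ _ => rfl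
  exact ((isCollageSimplex c).mor
    ⟨⟨(i.succ, j.succ), Fin.succ_le_succ_iff.2 hij⟩, h i⟩).symm

theorem npt_lift_eq {X : TopologicalCategory.{u}} {α : Type*}
    (F : ∀ n, X.NerveSpace n → stdSimplex ℝ (Fin (n + 1)) → α)
    (hF : ∀ (m n : ℕ) (θ : Fin (m + 1) →o Fin (n + 1)) (c : X.NerveSpace n)
      (t : stdSimplex ℝ (Fin (m + 1))), F m (X.nerveRestrict θ c) t = F n c (stdSimplex.map θ t))
    {m n : ℕ} {c : X.NerveSpace m} {t : stdSimplex ℝ (Fin (m + 1))} {c' : X.NerveSpace n}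
    {t' : stdSimplex ℝ (Fin (n + 1))} (h : X.npt c t = X.npt c' t') : F m c t = F n c' t' := by
  let G : X.ClassifyingSpace → α := Quot.lift (fun p => F p.1.len p.2.1 p.2.2) (by
    rintro _ _ ⟨θ, x, t⟩
    exact hF _ _ θ.toOrderHom x t)
  exact congrArg G h

/-! ### Joins with points of the slice category -/

/-- The weights of a point of a cone with weight `s` at the apex, where `w` gets the factor `k`. -/
def coneW {n : ℕ} (s k : ℝ) (w : Fin n → ℝ) : Fin (n + 1) → ℝ := Fin.cons s (k • w)

theorem sum_coneW {n : ℕ} (s k : ℝ) (w : Fin n → ℝ) :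
    ∑ i, coneW s k w i = s + k * ∑ i, w i := by
  rw [Fin.sum_univ_succ, Finset.mul_sum]
  rfl

theorem consW_coneW_mem {n : ℕ} {k : ℝ} {w : Fin n → ℝ} {r : ℕ} {s : ℕ → ℝ}
    (hs : ∀ i ≤ r, 0 ≤ s i) (hk : 0 ≤ k) (hw : ∀ i, 0 ≤ w i)
    (h : ∑ i ∈ Finset.range (r + 1), s i + k * ∑ i, w i = 1) :
    consW (coneW (s r) k w) r s ∈ stdSimplex ℝ (Fin (n + r + 1)) := by
  refine consW_mem (fun i hi => hs i hi.le) (fun i => ?_) ?_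
  · induction i using Fin.cases with
    | zero => exact hs r le_rfl
    | succ i => exact mul_nonneg hk (hw i)
  · rw [sum_coneW, ← add_assoc, ← Finset.sum_range_succ, h]

theorem linearMap_coneW {m n : ℕ} (θ : Fin (m + 1) →o Fin (n + 1)) (s k : ℝ)
    (w : Fin (m + 1) → ℝ) : FunOnFinite.linearMap ℝ ℝ (liftHom θ) (coneW s k w) =
      coneW s k (FunOnFinite.linearMap ℝ ℝ θ w) := by
  rw [coneW, linearMap_liftHom, map_smul]
  rfl

theorem linearMap_const_coneW {n : ℕ} (s k : ℝ) (w : Fin n → ℝ) (hk : k • w = 0) :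
    FunOnFinite.linearMap ℝ ℝ (OrderHom.const (Fin 1) (0 : Fin (n + 1))) (fun _ => s) =
      coneW s k w := by
  refine funext fun j => ?_
  rw [FunOnFinite.linearMap_apply_apply, coneW, hk]
  induction j using Fin.cases with
  | zero => simp
  | succ j => simp [(Fin.succ_pos j).ne]

/-- The conditions for `s 0, …, s r` to be part of the weights of a point of a simplex. -/
def IsPartialWeight (r : ℕ) (s : ℕ → ℝ) : Prop :=
  (∀ i ≤ r, 0 ≤ s i) ∧ ∑ i ∈ Finset.range (r + 1), s i ≤ 1

variable {f} in
/-- The point of the classifying space of the collage that is given by a string of edges in `Y`,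
followed by a cone on a point of the classifying space of `Y₀ ↓ f`, in terms of a representative of
the latter. -/
def joinRep {n : ℕ} (r : ℕ) (a : ℕ → Y.Mor) (s : ℕ → ℝ) (d : f.slice.NerveSpace n)
    (v : stdSimplex ℝ (Fin (n + 1))) : f.CollageRealization :=
  joinPt (f.sliceCone d) (coneW (s r) (1 - ∑ i ∈ Finset.range (r + 1), s i) v) r a s

variable {f} {r : ℕ} {a : ℕ → Y.Mor} {o : ℕ → Y.Obj} {s : ℕ → ℝ}

theorem IsPartialWeight.mem (hs : IsPartialWeight r s) {n : ℕ} (v : stdSimplex ℝ (Fin (n + 1))) :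
    consW (coneW (s r) (1 - ∑ i ∈ Finset.range (r + 1), s i) v) r s ∈
      stdSimplex ℝ (Fin (n + 1 + r + 1)) :=
  consW_coneW_mem hs.1 (sub_nonneg.2 hs.2) (stdSimplex.zero_le v) (by
    have := stdSimplex.sum_eq_one v
    rw [this]
    ring)

theorem joinRep_eq (h : Y.IsString r a o) (hs : IsPartialWeight r s) {m n : ℕ}
    {d : f.slice.NerveSpace m} {v : stdSimplex ℝ (Fin (m + 1))} {d' : f.slice.NerveSpace n}
    {v' : stdSimplex ℝ (Fin (n + 1))} (hd : f.slice.npt d v = f.slice.npt d' v')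
    (ho : Y.src (f.sliceEdge d 0) = o r) : joinRep r a s d v = joinRep r a s d' v' := by
  classical
  have ho' : Y.src (f.sliceEdge d' 0) = o r := by
    rw [← ho, ← f.classifyingRho_npt d v, ← f.classifyingRho_npt d' v', hd]
  have key := npt_lift_eq (X := f.slice) (α := Option f.CollageRealization)
    (fun n d v => if Y.src (f.sliceEdge d 0) = o r then some (joinRep r a s d v) else none)
    (fun m n θ d v => ?_) hd
  · simpa only [ho, ho', if_true, Option.some.injEq] using key
  · have h1 : Y.src (f.sliceEdge (f.slice.nerveRestrict θ d) 0) = Y.src (f.sliceEdge d 0) := by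
      rw [← f.classifyingRho_npt _ v, npt_map, classifyingRho_npt]
    rw [h1]
    split_ifs with h2
    · refine congrArg some ?_
      rw [joinRep, ← collageMap_liftHom_sliceCone, joinPt_map h ((f.shObj_sliceCone d).trans h2)
        (liftHom θ) rfl (hs.mem v), linearMap_coneW]
      rfl
    · rfl

variable (f) in
/-- The point of the classifying space of the collage that is given by a string of edges in `Y`,
followed by a cone on a point of the classifying space of `Y₀ ↓ f`, for a chosen representative of
the latter; any other one gives the same point, by `joinRep_eq`. -/
def join (r : ℕ) (a : ℕ → Y.Mor) (s : ℕ → ℝ) (ζ : f.slice.ClassifyingSpace) :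
    f.CollageRealization :=
  joinRep r a s (f.slice.exists_npt ζ).choose_spec.choose
    (f.slice.exists_npt ζ).choose_spec.choose_spec.choose

theorem join_npt (h : Y.IsString r a o) (hs : IsPartialWeight r s) {n : ℕ}
    {d : f.slice.NerveSpace n} {v : stdSimplex ℝ (Fin (n + 1))}
    (ho : Y.src (f.sliceEdge d 0) = o r) : f.join r a s (f.slice.npt d v) = joinRep r a s d v :=
  (joinRep_eq h hs (f.slice.exists_npt (f.slice.npt d v)).choose_spec.choose_spec.choose_spec
    ho).symm

/-- If only the apex of a cone has a positive weight, then the join only depends on the apex. -/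
theorem joinPt_coneW_eq (h : Y.IsString r a o) (hs : ∀ i ≤ r, 0 ≤ s i)
    (hsum : ∑ i ∈ Finset.range (r + 1), s i = 1) {m n : ℕ} {c : f.CollageSpace m}
    {c' : f.CollageSpace n} (hc : f.shObj c 0 = o r) (hc' : f.shObj c' 0 = o r)
    (h0 : c.1 0 = false) (h0' : c'.1 0 = false) {k k' : ℝ} {w : Fin m → ℝ} {w' : Fin n → ℝ}
    (hw : k • w = 0) (hw' : k' • w' = 0) :
    joinPt c (coneW (s r) k w) r a s = joinPt c' (coneW (s r) k' w') r a s := by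
  have hmem : consW (fun _ : Fin 1 => s r) r s ∈ stdSimplex ℝ (Fin (0 + r + 1)) := by
    refine consW_mem (fun i hi => hs i hi.le) (fun _ => hs r le_rfl) ?_
    simpa [Finset.sum_range_succ] using hsum
  have key {m : ℕ} {c : f.CollageSpace m} (hc : f.shObj c 0 = o r) {k : ℝ} {w : Fin m → ℝ}
      (hw : k • w = 0) : joinPt c (coneW (s r) k w) r a s =
        joinPt (f.collageMap (OrderHom.const (Fin 1) (0 : Fin (m + 1))) c) (fun _ => s r) r a
          s := by
    rw [joinPt_map h hc _ rfl hmem, linearMap_const_coneW _ k w hw]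
  rw [key hc hw, key hc' hw']
  congr 1
  refine collage_ext (fun i => ?_) (fun i j hij => ?_) fun i j hij hi _ => ?_
  · exact h0.trans h0'.symm
  · change f.shMor c 0 0 le_rfl = f.shMor c' 0 0 le_rfl
    rw [shMor_self, shMor_self, hc, hc']
  · exact absurd (h0.symm.trans hi) Bool.false_ne_true

theorem sliceCone_zero {n : ℕ} (d : f.slice.NerveSpace n) : (f.sliceCone d).1 0 = false :=
  cons_zero (f.tgt_sliceEdge d 0)

theorem sliceCone_of_ne_zero {n : ℕ} (d : f.slice.NerveSpace n) (i : Fin (n + 2)) (hi : i ≠ 0) :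
    (f.sliceCone d).1 i = true := by
  obtain ⟨i, rfl⟩ := Fin.exists_succ_eq.2 hi
  exact cons_succ (f.tgt_sliceEdge d 0) i

/-- The join is continuous although the string varies together with the point of `B(Y₀ ↓ f)`. The
closed sets are tested on the product of the parameter space with the spaces of representatives; the
former is compact Hausdorff, so that taking the product preserves quotient maps and compactly
coherent spaces. -/
theorem continuous_join {Z : Type*} [TopologicalSpace Z] [CompactSpace Z] [T2Space Z]
    {a : Z → ℕ → Y.Mor} {o : Z → ℕ → Y.Obj} {s : Z → ℕ → ℝ} {ζ : Z → f.slice.ClassifyingSpace}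
    (ha : ∀ i < r, Continuous fun z => a z i) (ho : Continuous fun z => o z r)
    (h : ∀ z, Y.IsString r (a z) (o z)) (hs : ∀ i ≤ r, Continuous fun z => s z i)
    (hsp : ∀ z, IsPartialWeight r (s z)) (hζ : Continuous ζ)
    (hζo : ∀ z, f.classifyingRho (ζ z) = o z r) :
    Continuous fun z => f.join r (a z) (s z) (ζ z) := by
  refine continuous_iff_isClosed.2 fun A hA => ?_
  let B : Set (Z × f.slice.ClassifyingSpace) :=
    {q | f.classifyingRho q.2 = o q.1 r ∧ f.join r (a q.1) (s q.1) q.2 ∈ A}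
  suffices hB : IsClosed B by
    convert hB.preimage (continuous_id.prodMk hζ) using 1
    ext z
    exact ⟨fun hz => ⟨hζo z, hz⟩, fun hz => hz.2⟩
  suffices hB : Continuous fun q => q ∈ Bᶜ from isOpen_compl_iff.1 (continuous_Prop.1 hB)
  refine (GeometricRealization.isQuotientMap_mk (S := f.slice.nerve)).continuous_lift_prod_right ?_
  rw [continuous_Prop]
  suffices hB' : IsClosed {q : Z × PreRealization f.slice.nerve |
      (q.1, (Quot.mk _ q.2 : f.slice.ClassifyingSpace)) ∈ B} from hB'.isOpen_compl
  suffices hB' : IsClosed {q : PreRealization f.slice.nerve × Z |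
      (q.2, (Quot.mk _ q.1 : f.slice.ClassifyingSpace)) ∈ B} from hB'.preimage continuous_swap
  refine isClosed_sigma_prod fun n => ?_
  suffices hB' : IsClosed {q : (f.slice.NerveSpace n.len × stdSimplex ℝ (Fin (n.len + 1))) × Z |
      (q.2, f.slice.npt q.1.1 q.1.2) ∈ B} from hB'
  let E : Set ((f.slice.NerveSpace n.len × stdSimplex ℝ (Fin (n.len + 1))) × Z) :=
    {q | Y.src (f.sliceEdge q.1.1 0) = o q.2 r}
  have hE : IsClosed E := isClosed_eq
    (Y.src.continuous.comp ((f.continuous_sliceEdge 0).comp (continuous_fst.comp continuous_fst)))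
    (ho.comp continuous_snd)
  have : CompactlyCoherentSpace
      ((f.slice.NerveSpace n.len × stdSimplex ℝ (Fin (n.len + 1))) × Z) :=
    CompactlyCoherentSpace.prod
  have hcc : CompactlyCoherentSpace E := CompactlyCoherentSpace.of_isClosed_subset hE
  have hcont : Continuous fun q : E =>
      joinRep r (a q.1.2) (s q.1.2) q.1.1.1 q.1.1.2 := by
    refine continuous_joinPt
      (fun i hi => (ha i hi).comp (continuous_snd.comp continuous_subtype_val))
      ((f.continuous_sliceCone _).comp (continuous_fst.comp (continuous_fst.comp
        continuous_subtype_val))) (fun q => h q.1.2)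
      (fun q => (f.shObj_sliceCone _).trans q.2) ?_ (fun i hi =>
        (hs i hi.le).comp (continuous_snd.comp continuous_subtype_val))
      fun q => (hsp q.1.2).mem _
    have hs' (i : ℕ) (hi : i ≤ r) : Continuous fun q : E => s q.1.2 i :=
      (hs i hi).comp (continuous_snd.comp continuous_subtype_val)
    refine continuous_pi fun i => ?_
    induction i using Fin.cases with
    | zero => exact hs' r le_rfl
    | succ i =>
      refine Continuous.mul (continuous_const.sub (continuous_finsetSum _ fun i hi =>
        hs' i (by simpa [Nat.lt_succ_iff] using hi))) ?_
      exact (continuous_apply i).comp (continuous_subtype_val.comp (continuous_snd.comp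
        (continuous_fst.comp continuous_subtype_val)))
  convert hE.isClosedEmbedding_subtypeVal.isClosedMap _ (hA.preimage hcont) using 1
  ext q
  constructor
  · rintro ⟨h1, h2⟩
    have h1' : q ∈ E := h1
    refine ⟨⟨q, h1'⟩, ?_, rfl⟩
    rw [join_npt (h _) (hsp _) h1'] at h2
    exact h2
  · rintro ⟨q, h2, rfl⟩
    refine ⟨q.2, ?_⟩
    rw [join_npt (h _) (hsp _) q.2]
    exact h2

end TopologicalFunctor

/-! ### Modifications of the representatives in a stratum -/

namespace TopologicalFunctor

open TopologicalCategory

variable {X Y : TopologicalCategory.{u}} {f : TopologicalFunctor X Y}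

/-- A join of a string in `Y` and a cone on a simplex of `X` is represented by a point of the
stratum. -/
theorem exists_stratum_joinPt {m r : ℕ} {c : f.CollageSpace m} {a : ℕ → Y.Mor} {o : ℕ → Y.Obj}
    {w : Fin (m + 1) → ℝ} {s : ℕ → ℝ} (h0 : c.1 0 = false) (hc : ∀ i, i ≠ 0 → c.1 i = true)
    (h : Y.IsString r a o) (hco : f.shObj c 0 = o r)
    (hw : consW w r s ∈ stdSimplex ℝ (Fin (m + r + 1))) : ∃ z : f.Stratum r,
      z.pt = joinPt c w r a s ∧ (∀ i < r, z.wt i = s i) ∧ z.wt r = w 0 ∧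
        ∀ i < r, z.ed i = a i := by
  have hs (i : Fin (m + 1)) : (f.consN c r a).1 ⟨i + r, by omega⟩ = c.1 i :=
    congrArg (fun c : f.CollageSpace m => c.1 i) (collageMap_shift_consN h hco)
  have hκ : (f.consN c r a).1 = topType (m + r) r := by
    refine OrderHom.ext _ _ (funext fun i => ?_)
    obtain hi | hi := lt_trichotomy r i
    · rw [topType_eq_true.2 hi, ← hc ⟨i - r, by omega⟩ fun h => ?_, ← hs]
      · congr 1
        exact Fin.ext (by simp; omega)
      · have := congrArg Fin.val h
        simp at this
        omega
    · rw [topType_eq_false.2 (by omega)]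
      obtain hi | hi := hi
      · rw [← h0, ← hs]
        congr 1
        exact Fin.ext (by simp; omega)
      · exact consN_type_of_lt h hco i hi
  obtain ⟨p, hp⟩ : ∃ p, f.consN c r a = ⟨topType (m + r) r, p⟩ := by
    generalize f.consN c r a = d at hκ
    obtain ⟨κ, p⟩ := d
    obtain rfl : κ = _ := hκ
    exact ⟨p, rfl⟩
  have hwt (i : ℕ) (hi : i < m + r + 1) (z : f.Stratum r) (hz : z = ⟨m, p, consW w r s, hw⟩) :
      z.wt i = consW w r s ⟨i, hi⟩ := by
    subst hz
    exact wtN_of_lt _ hi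
  refine ⟨⟨m, p, consW w r s, hw⟩, ?_, fun i hi => ?_, ?_, fun i hi => ?_⟩
  · rw [joinPt, wpt_of_mem _ hw, hp]
    rfl
  · rw [hwt i (by omega) _ rfl, consW_apply, dif_neg (by simpa using hi)]
  · rw [hwt r (by omega) _ rfl, consW_apply, dif_pos le_rfl]
    congr 1
    exact Fin.ext (by simp)
  · rw [← edge_consN h hco hi, hp]
    rfl

namespace Stratum

variable {r : ℕ}

theorem continuous_mk (m : ℕ) : Continuous
    fun p : 𝐤 {p : CollageData (X := X) (Y := Y) (m + r) (topType (m + r) r) //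
        f.IsCollageSimplex (m + r) (topType (m + r) r) p} × stdSimplex ℝ (Fin (m + r + 1)) =>
      (⟨m, p⟩ : f.Stratum r) :=
  @continuous_sigmaMk _ (fun m : ℕ =>
    𝐤 {p : CollageData (X := X) (Y := Y) (m + r) (topType (m + r) r) //
      f.IsCollageSimplex (m + r) (topType (m + r) r) p} × stdSimplex ℝ (Fin (m + r + 1))) _ m

/-- The total weight of the vertices in `X`. -/
def xsum (z : f.Stratum r) : ℝ := 1 - ∑ i ∈ Finset.range (r + 1), z.wt i

theorem continuous_xsum : Continuous fun z : f.Stratum r => z.xsum :=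
  continuous_const.sub (continuous_finsetSum _ fun i _ => continuous_wt i)

theorem wt_nonneg (z : f.Stratum r) (i : ℕ) : 0 ≤ z.wt i := wtN_nonneg _ _

theorem xsum_nonneg (z : f.Stratum r) : 0 ≤ z.xsum := sub_nonneg.2 (sum_wtN_le _ _)

theorem xsum_eq {z z' : f.Stratum r} (h : z.Reduced) (hz : z.pt = z'.pt) : z.xsum = z'.xsum :=
  congrArg (1 - ·) (sum_wt_eq h hz le_rfl)

/-- The simplex that is spanned by the last vertex in `Y` and the vertices in `X`. -/
def tail (z : f.Stratum r) : f.CollageSpace z.1 := f.collageMap (shiftHom z.1 r) z.simplex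

theorem tail_zero (z : f.Stratum r) : z.tail.1 0 = false :=
  topType_eq_false.2 (Nat.zero_add r).le

theorem tail_of_ne_zero (z : f.Stratum r) (i : Fin (z.1 + 1)) (hi : i ≠ 0) : z.tail.1 i = true :=
  topType_eq_true.2 (Nat.lt_add_of_pos_left (Fin.lt_def.1 (Fin.pos_of_ne_zero hi)))

theorem shObj_tail (z : f.Stratum r) : f.shObj z.tail 0 = z.ob r := by
  rw [ob, vtx_of_lt _ (by omega)]
  change f.shObj z.simplex _ = _
  congr 1
  exact Fin.ext (Nat.zero_add _)

/-- The weights of the vertices in `X`. -/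
def xwt (z : f.Stratum r) (i : Fin z.1) : ℝ := z.wt (r + 1 + i)

theorem sum_xwt (z : f.Stratum r) : ∑ i, z.xwt i = z.xsum := by
  have h1 := Fin.sum_univ_eq_sum_range (fun i => z.wt (r + 1 + i)) z.1
  refine h1.trans ?_
  have h2 : ∑ i ∈ Finset.range (r + 1 + z.1), z.wt i = 1 := sum_wtN _ (by omega)
  rw [Finset.sum_range_add] at h2
  rw [xsum, ← h2]
  ring

theorem xsum_eq_zero {p : 𝐤 {p : CollageData (X := X) (Y := Y) (0 + r)
      (topType (0 + r) r) // f.IsCollageSimplex (0 + r) (topType (0 + r) r) p} ×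
      stdSimplex ℝ (Fin (0 + r + 1))} : xsum ⟨0, p⟩ = 0 := by
  rw [← sum_xwt]
  exact Fin.sum_univ_zero _

/-- The point that is obtained by replacing the edges of the string in `Y` by `a`, and the weights
of its vertices by `s`, and by multiplying the weights of the vertices in `X` by `k`. -/
def modify (z : f.Stratum r) (a : ℕ → Y.Mor) (s : ℕ → ℝ) (k : ℝ) : f.CollageRealization :=
  joinPt z.tail (coneW (s r) k z.xwt) r a s

theorem consW_mem {z : f.Stratum r} {s : ℕ → ℝ} {k : ℝ} (hs : ∀ i ≤ r, 0 ≤ s i) (hk : 0 ≤ k)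
    (h : ∑ i ∈ Finset.range (r + 1), s i + k * z.xsum = 1) :
    consW (coneW (s r) k z.xwt) r s ∈ stdSimplex ℝ (Fin (z.1 + r + 1)) :=
  consW_coneW_mem hs hk (fun _ => z.wt_nonneg _) (by rwa [sum_xwt])

theorem modify_eq_pt {z : f.Stratum r} {a : ℕ → Y.Mor} {s : ℕ → ℝ} (ha : ∀ i < r, a i = z.ed i)
    (hs : ∀ i ≤ r, s i = z.wt i) : z.modify a s 1 = z.pt := by
  have h1 : z.simplex = f.consN z.tail r a :=
    (eq_consN z.simplex fun i hi => topType_eq_false.2 hi.le).trans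
      (consN_congr fun i hi => (ha i hi).symm)
  have h2 : consW (coneW (s r) 1 z.xwt) r s = z.weights := by
    refine funext fun i => ?_
    have hi : z.weights i = z.wt i := (wtN_of_lt _ i.2).symm
    rw [consW_apply, hi]
    split_ifs with hri
    · obtain ⟨i, hi'⟩ := i
      obtain ⟨j, rfl⟩ := Nat.exists_eq_add_of_le hri
      have h3 : (⟨r + j - r, by omega⟩ : Fin (z.1 + 1)) = ⟨j, by omega⟩ :=
        Fin.ext (Nat.add_sub_cancel_left _ _)
      rw [h3]
      cases j with
      | zero => exact hs r le_rfl
      | succ j =>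
        change 1 * z.wt (r + 1 + j) = z.wt (r + (j + 1))
        rw [one_mul]
        congr 1
        omega
    · exact hs i (by omega)
  have h3 : consW (coneW (s r) 1 z.xwt) r s ∈ stdSimplex ℝ (Fin (z.1 + r + 1)) := by
    rw [h2]
    exact z.weights.2
  rw [modify, joinPt, wpt_of_mem _ h3, ← h1, pt]
  congr 1
  exact Subtype.ext h2

/-- A modified representative is again represented by a point of the stratum. -/
theorem exists_modify {z : f.Stratum r} {a : ℕ → Y.Mor} {o : ℕ → Y.Obj} {s : ℕ → ℝ} {k : ℝ}
    (h : Y.IsString r a o) (ho : z.ob r = o r) (hs : ∀ i ≤ r, 0 ≤ s i) (hk : 0 ≤ k)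
    (hsum : ∑ i ∈ Finset.range (r + 1), s i + k * z.xsum = 1) : ∃ z' : f.Stratum r,
      z'.pt = z.modify a s k ∧ (∀ i ≤ r, z'.wt i = s i) ∧ ∀ i < r, z'.ed i = a i := by
  obtain ⟨z', h1, h2, h3, h4⟩ := exists_stratum_joinPt z.tail_zero z.tail_of_ne_zero h
    (z.shObj_tail.trans ho) (consW_mem hs hk hsum)
  refine ⟨z', h1, fun i hi => ?_, h4⟩
  obtain hi | rfl := hi.lt_or_eq
  · exact h2 i hi
  · exact h3

theorem continuous_modify {a : f.Stratum r × I → ℕ → Y.Mor} {o : f.Stratum r × I → ℕ → Y.Obj}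
    {s : f.Stratum r × I → ℕ → ℝ} {k : f.Stratum r × I → ℝ}
    (ha : ∀ i < r, Continuous fun q => a q i) (hs : ∀ i ≤ r, Continuous fun q => s q i)
    (hk : Continuous k) (h : ∀ q, Y.IsString r (a q) (o q)) (ho : ∀ q, q.1.ob r = o q r)
    (hs0 : ∀ q, ∀ i ≤ r, 0 ≤ s q i) (hk0 : ∀ q, 0 ≤ k q)
    (hsum : ∀ q, ∑ i ∈ Finset.range (r + 1), s q i + k q * q.1.xsum = 1) :
    Continuous fun q : f.Stratum r × I => q.1.modify (a q) (s q) (k q) := by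
  refine continuous_sigma_prod fun m => ?_
  let e : (𝐤 {p : CollageData (X := X) (Y := Y) (m + r) (topType (m + r) r) //
      f.IsCollageSimplex (m + r) (topType (m + r) r) p} × stdSimplex ℝ (Fin (m + r + 1))) × I →
      f.Stratum r × I := fun q => (⟨m, q.1⟩, q.2)
  have he : Continuous e := ((continuous_mk m).comp continuous_fst).prodMk continuous_snd
  refine continuous_joinPt (a := fun q => a (e q)) (o := fun q => o (e q)) (s := fun q => s (e q))
    (c := fun q => (e q).1.tail) (w := fun q => coneW (s (e q) r) (k (e q)) (e q).1.xwt)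
    (fun i hi => (ha i hi).comp he) ?_ (fun q => h (e q))
    (fun q => (shObj_tail _).trans (ho (e q))) ?_ (fun i hi => (hs i hi.le).comp he)
    fun q => consW_mem (hs0 (e q)) (hk0 (e q)) (hsum (e q))
  · exact (f.continuous_collageMap (shiftHom m r)).comp
      ((continuous_simplex m).comp continuous_fst)
  · refine continuous_pi fun i => ?_
    induction i using Fin.cases with
    | zero => exact (hs r le_rfl).comp he
    | succ i =>
      exact (hk.comp he).mul ((continuous_wt (r + 1 + i)).comp (continuous_fst.comp he))

/-! ### The slice coordinate of a point of a stratum -/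

theorem normalized_mem {z : f.Stratum r} (hz : 0 < z.xsum) :
    (fun i => z.xsum⁻¹ * z.xwt i) ∈ stdSimplex ℝ (Fin z.1) := by
  refine ⟨fun i => mul_nonneg (inv_nonneg.2 hz.le) (z.wt_nonneg _), ?_⟩
  rw [← Finset.mul_sum, sum_xwt, inv_mul_cancel₀ hz.ne']

/-- The part of a simplex after the vertices in `Y` other than the last one is given by the values
at times after those of these vertices. -/
theorem collageMap_tail {n N : ℕ} {p : 𝐤 {p : CollageData (X := X) (Y := Y) (n + 1 + r)
      (topType (n + 1 + r) r) // f.IsCollageSimplex (n + 1 + r) (topType (n + 1 + r) r) p} ×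
      stdSimplex ℝ (Fin (n + 1 + r + 1))} (hz : 0 < xsum ⟨n + 1, p⟩)
    (hred : Reduced ⟨n + 1, p⟩) (τ : Fin (N + 1) →o Set.Ico (0 : ℝ) 1)
    (τ' : Fin (N + 2) →o Set.Ico (0 : ℝ) 1)
    (h0 : (τ' 0 : ℝ) = ∑ i ∈ Finset.range r, wt ⟨n + 1, p⟩ i)
    (hsucc : ∀ k : Fin (N + 1), (τ' k.succ : ℝ) = 1 - xsum ⟨n + 1, p⟩ + xsum ⟨n + 1, p⟩ * τ k) :
    f.collageMap (liftHom (timeIndex.hom ⟨_, normalized_mem hz⟩ τ)) (tail ⟨n + 1, p⟩) =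
      f.collageMap (timeIndex.hom (weights ⟨n + 1, p⟩) τ') (simplex ⟨n + 1, p⟩) := by
  let z : f.Stratum r := ⟨n + 1, p⟩
  suffices h : (shiftHom (n + 1) r).comp (liftHom (timeIndex.hom ⟨_, normalized_mem hz⟩ τ)) =
      timeIndex.hom z.weights τ' from congrArg (fun θ => f.collageMap θ z.simplex) h
  refine OrderHom.ext _ _ (funext fun k => ?_)
  induction k using Fin.cases with
  | zero =>
    have h1 : τ' 0 = z.start hred r le_rfl := Subtype.ext h0
    refine Eq.trans (Fin.ext ?_) ((timeIndex_start hred le_rfl).symm.trans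
      (congrArg (timeIndex z.weights) h1.symm))
    exact Nat.zero_add r
  | succ k =>
    refine Eq.symm ((timeIndex_eq_iff z.weights).2 ?_)
    set v : stdSimplex ℝ (Fin (n + 1)) := ⟨_, normalized_mem hz⟩
    set j : Fin (n + 1) := timeIndex v (τ k) with hj
    have hv (i : ℕ) (hi : i < n + 1) : z.xsum * wtN v i = z.wt (r + 1 + i) := by
      rw [wtN_of_lt _ hi]
      change z.xsum * (z.xsum⁻¹ * z.wt (r + 1 + i)) = _
      rw [mul_inv_cancel_left₀ hz.ne']
    have hsum (l : ℕ) (hl : l ≤ n + 1) : ∑ i ∈ Finset.range (r + 1 + l), z.wt i =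
        1 - z.xsum + z.xsum * ∑ i ∈ Finset.range l, wtN v i := by
      rw [Finset.sum_range_add, Finset.mul_sum, xsum, sub_sub_cancel]
      refine congrArg _ (Finset.sum_congr rfl fun i hi => ?_)
      rw [← hv i ((Finset.mem_range.1 hi).trans_le hl)]
      rfl
    obtain ⟨h1, h2⟩ := (timeIndex_eq_iff v).1 hj.symm
    have e1 := hsum j j.2.le
    have e2 := hsum (j + 1) j.2
    have hval : (((shiftHom (n + 1) r).comp (liftHom (timeIndex.hom v τ)) k.succ : Fin _) : ℕ) =
        r + 1 + j := by
      change (j : ℕ) + 1 + r = _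
      omega
    rw [hval]
    change ∑ i ∈ Finset.range (r + 1 + j), z.wt i ≤ _ ∧
      _ < ∑ i ∈ Finset.range (r + 1 + (j + 1)), z.wt i
    rw [e1, e2, hsucc]
    have hz' : 0 < z.xsum := hz
    exact ⟨add_le_add_right (mul_le_mul_of_nonneg_left h1 hz'.le) _,
      add_lt_add_right (mul_lt_mul_of_pos_left h2 hz') _⟩

section Slice

variable [Nonempty f.slice.ClassifyingSpace]

open Classical in
/-- The point of the classifying space of `Y₀ ↓ f` that is defined by the last vertex in `Y` and
the vertices in `X`, with the weights of the latter divided by their sum (or junk, if all of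
these are zero). -/
def sliceCoord : f.Stratum r → f.slice.ClassifyingSpace
  | ⟨0, _⟩ => Classical.arbitrary _
  | ⟨n + 1, p⟩ =>
    if h : (fun i => (xsum ⟨n + 1, p⟩)⁻¹ * xwt ⟨n + 1, p⟩ i) ∈ stdSimplex ℝ (Fin (n + 1)) then
      f.slice.npt (f.sliceOf (tail ⟨n + 1, p⟩) fun _ => tail_of_ne_zero _ _ (Fin.succ_ne_zero _))
        ⟨_, h⟩
    else Classical.arbitrary _

theorem sliceCoord_of_pos {n : ℕ} {p : 𝐤 {p : CollageData (X := X) (Y := Y) (n + 1 + r)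
      (topType (n + 1 + r) r) // f.IsCollageSimplex (n + 1 + r) (topType (n + 1 + r) r) p} ×
      stdSimplex ℝ (Fin (n + 1 + r + 1))} (hz : 0 < xsum ⟨n + 1, p⟩) :
    sliceCoord ⟨n + 1, p⟩ =
      f.slice.npt (f.sliceOf (tail ⟨n + 1, p⟩) fun _ => tail_of_ne_zero _ _ (Fin.succ_ne_zero _))
        ⟨_, normalized_mem hz⟩ :=
  dif_pos (normalized_mem hz)

theorem continuousOn_sliceCoord :
    ContinuousOn (sliceCoord (f := f) (r := r)) {z | 0 < z.xsum} := by
  have hopen : IsOpen {z : f.Stratum r | 0 < z.xsum} :=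
    isOpen_lt continuous_const continuous_xsum
  rw [hopen.continuousOn_iff]
  rintro ⟨m, p⟩ hz
  suffices h : ContinuousAt (fun p => sliceCoord (⟨m, p⟩ : f.Stratum r)) p from
    (@IsOpenEmbedding.sigmaMk _ (fun m : ℕ =>
      𝐤 {p : CollageData (X := X) (Y := Y) (m + r) (topType (m + r) r) //
        f.IsCollageSimplex (m + r) (topType (m + r) r) p} ×
          stdSimplex ℝ (Fin (m + r + 1))) _ m).continuousAt_iff.1 h
  cases m with
  | zero =>
    change 0 < xsum ⟨0, p⟩ at hz
    rw [xsum_eq_zero] at hz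
    exact absurd hz (lt_irrefl _)
  | succ n =>
    have hopen' := hopen.preimage (continuous_mk (f := f) (r := r) (n + 1))
    refine ContinuousOn.continuousAt ?_ (hopen'.mem_nhds hz)
    rw [continuousOn_iff_continuous_domRestrict]
    refine Continuous.congr ?_ fun p => (sliceCoord_of_pos p.2).symm
    refine (f.slice.continuous_npt n).comp (Continuous.prodMk ?_ (Continuous.subtype_mk ?_ _))
    · have h1 : Continuous fun p : 𝐤 {p : CollageData (X := X) (Y := Y) (n + 1 + r)
          (topType (n + 1 + r) r) // f.IsCollageSimplex (n + 1 + r) (topType (n + 1 + r) r) p} =>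
          CompactCoherentification.map (f.collageRestrict (shiftHom (n + 1) r) _) p :=
        CompactCoherentification.continuous_map_of_continuous (f.continuous_collageRestrict _ _)
      exact (f.continuous_sliceOf (κ := (topType (n + 1 + r) r).comp (shiftHom (n + 1) r))
        fun i => tail_of_ne_zero (f := f) ⟨n + 1, p⟩ _ (Fin.succ_ne_zero i)).comp
          (h1.comp (continuous_fst.comp continuous_subtype_val))
    · have hmk := (continuous_mk (f := f) (r := r) (n + 1)).comp
        (continuous_subtype_val (p := fun p => p ∈ (fun p => (⟨n + 1, p⟩ : f.Stratum r)) ⁻¹'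
          {z : f.Stratum r | 0 < z.xsum}))
      exact continuous_pi fun i : Fin (n + 1) =>
        ((continuous_xsum.comp hmk).inv₀ fun p => p.2.ne').mul
          ((continuous_wt (r + 1 + i)).comp hmk)

theorem classifyingRho_sliceCoord {z : f.Stratum r} (hz : 0 < z.xsum) :
    f.classifyingRho z.sliceCoord = z.ob r := by
  obtain ⟨_ | n, p⟩ := z
  · rw [xsum_eq_zero] at hz
    exact absurd hz (lt_irrefl _)
  · rw [sliceCoord_of_pos hz, classifyingRho_npt, ← shObj_tail]
    exact src_shMor _ _ _ _

/-- If there are vertices in `X` with positive weights, then a modification is a join with the slice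
coordinate. -/
theorem modify_eq_join {z : f.Stratum r} (hz : 0 < z.xsum) {a : ℕ → Y.Mor} {o : ℕ → Y.Obj}
    {s : ℕ → ℝ} {k : ℝ} (h : Y.IsString r a o) (ho : z.ob r = o r) (hs : IsPartialWeight r s)
    (hk : ∑ i ∈ Finset.range (r + 1), s i + k * z.xsum = 1) :
    z.modify a s k = f.join r a s z.sliceCoord := by
  have hρ := classifyingRho_sliceCoord hz
  obtain ⟨_ | n, p⟩ := z
  · rw [xsum_eq_zero] at hz
    exact absurd hz (lt_irrefl _)
  · rw [sliceCoord_of_pos hz, classifyingRho_npt] at hρ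
    rw [sliceCoord_of_pos hz, join_npt h hs (hρ.trans ho), joinRep,
      sliceCone_sliceOf _ (tail ⟨n + 1, p⟩) _ (tail_zero _), modify]
    congr 1
    refine congrArg (Fin.cons (α := fun _ => ℝ) (s r)) (funext fun i => ?_)
    change k * _ = (1 - ∑ i ∈ Finset.range (r + 1), s i) * (_ * _)
    rw [← hk]
    field_simp
    ring

/-- The slice coordinate does not depend on the reduced representative: restrictions of the
corresponding simplices of `Y₀ ↓ f` are restrictions of the given simplices, at the time at which
the interval of the last vertex in `Y` begins and at times in the intervals of the vertices in
`X`. -/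
theorem sliceCoord_eq {z z' : f.Stratum r} (h : z.Reduced) (hz : z.pt = z'.pt)
    (hx : 0 < z.xsum) : z.sliceCoord = z'.sliceCoord := by
  have hxx := xsum_eq h hz
  have hww := sum_wt_eq h hz r.le_succ
  have h' := h.of_pt_eq hz
  have hx' : 0 < z'.xsum := hxx ▸ hx
  have hstart : ∑ i ∈ Finset.range r, z.wt i ≤ 1 - z.xsum := by
    rw [xsum, sub_sub_cancel, Finset.sum_range_succ]
    exact le_add_of_nonneg_right (z.wt_nonneg r)
  have hstart' : 0 ≤ ∑ i ∈ Finset.range r, z.wt i := Finset.sum_nonneg fun i _ => z.wt_nonneg i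
  have hcpt := cpt_eq_iff.1 hz
  obtain ⟨_ | n, p⟩ := z
  · rw [xsum_eq_zero] at hx
    exact absurd hx (lt_irrefl _)
  obtain ⟨_ | n', p'⟩ := z'
  · rw [xsum_eq_zero] at hx'
    exact absurd hx' (lt_irrefl _)
  rw [sliceCoord_of_pos hx, sliceCoord_of_pos hx']
  refine npt_eq_iff.2 fun N τ => ?_
  set x : ℝ := xsum ⟨n + 1, p⟩
  set y : ℝ := ∑ i ∈ Finset.range r, wt ⟨n + 1, p⟩ i
  have hmem (k : Fin (N + 1)) : 1 - x + x * (τ k : ℝ) ∈ Set.Ico (0 : ℝ) 1 := by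
    have h1 := mul_nonneg hx.le (τ k).2.1
    have h2 := mul_lt_mul_of_pos_left (τ k).2.2 hx
    constructor <;> linarith
  let τ' : Fin (N + 2) →o Set.Ico (0 : ℝ) 1 :=
    ⟨Fin.cons ⟨y, hstart', by linarith⟩ fun k => ⟨1 - x + x * τ k, hmem k⟩, fun i j hij => by
      induction i using Fin.cases with
      | zero =>
        induction j using Fin.cases with
        | zero => exact le_rfl
        | succ j =>
          have h1 := mul_nonneg hx.le (τ j).2.1
          change y ≤ 1 - x + x * (τ j : ℝ)
          linarith
      | succ i =>
        induction j using Fin.cases with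
        | zero => exact absurd hij (not_le.2 (Fin.succ_pos i))
        | succ j =>
          have h1 : (τ i : ℝ) ≤ τ j := τ.monotone (Fin.succ_le_succ_iff.1 hij)
          change 1 - x + x * (τ i : ℝ) ≤ 1 - x + x * (τ j : ℝ)
          have := mul_le_mul_of_nonneg_left h1 hx.le
          linarith⟩
  have key := (collageMap_tail hx h τ τ' rfl fun _ => rfl).trans ((hcpt _ τ').trans
    (collageMap_tail hx' h' τ τ' hww fun k => by rw [← hxx]; rfl).symm)
  have gen {c c' : f.CollageSpace (N + 1)} (hc : c = c') (h1 h2) :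
      f.sliceOf c h1 = f.sliceOf c' h2 := by
    subst hc
    rfl
  exact gen key
    (fun i => tail_of_ne_zero ⟨n + 1, p⟩ (timeIndex.hom _ τ i).succ (Fin.succ_ne_zero _))
    fun i => tail_of_ne_zero ⟨n' + 1, p'⟩ (timeIndex.hom _ τ i).succ (Fin.succ_ne_zero _)

end Slice

/-- Modification does not depend on the reduced representative. -/
theorem modify_eq {z z' : f.Stratum r} (h : z.Reduced) (hz : z.pt = z'.pt) {a : ℕ → Y.Mor}
    {o : ℕ → Y.Obj} {s : ℕ → ℝ} {k : ℝ} (ha : Y.IsString r a o) (ho : z.ob r = o r)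
    (hs : IsPartialWeight r s)
    (hk : ∑ i ∈ Finset.range (r + 1), s i + k * z.xsum = 1) : z.modify a s k = z'.modify a s k := by
  have hx := xsum_eq h hz
  have ho' : z'.ob r = o r := (ob_eq h hz le_rfl).symm.trans ho
  obtain h0 | h0 := z.xsum_nonneg.lt_or_eq
  · obtain ⟨_ | n, p⟩ := z
    · rw [xsum_eq_zero] at h0
      exact absurd h0 (lt_irrefl _)
    have : Nonempty f.slice.ClassifyingSpace :=
      ⟨f.slice.npt (f.sliceOf (tail ⟨n + 1, p⟩) fun _ => tail_of_ne_zero _ _ (Fin.succ_ne_zero _))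
        (stdSimplex.vertex 0)⟩
    have h0' : 0 < z'.xsum := hx ▸ h0
    rw [modify_eq_join (f := f) h0 ha ho hs hk, modify_eq_join (f := f) h0' ha ho' hs (hx ▸ hk),
      sliceCoord_eq h hz h0]
  · have hw (z : f.Stratum r) (h0 : z.xsum = 0) : k • z.xwt = 0 := by
      have := (Finset.sum_eq_zero_iff_of_nonneg (f := z.xwt) fun i _ => z.wt_nonneg _).1
        (z.sum_xwt.trans h0)
      rw [show z.xwt = 0 from funext fun i => this i (Finset.mem_univ i), smul_zero]
    rw [← h0, mul_zero, add_zero] at hk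
    exact joinPt_coneW_eq ha hs.1 hk (z.shObj_tail.trans ho) (z'.shObj_tail.trans ho')
      z.tail_zero z'.tail_zero (hw z h0.symm) (hw z' (hx ▸ h0.symm))

end Stratum

end TopologicalFunctor

/-! ### Maps on a stage of the filtration -/

namespace TopologicalFunctor

open TopologicalCategory

variable {X Y : TopologicalCategory.{u}} {f : TopologicalFunctor X Y} {r : ℕ}

/-- Homotopies on the stage `r + 1` of the filtration can be defined on the stage `r` and on the
stratum. -/
theorem exists_extension {W : Type*} [TopologicalSpace W] {g₀ : f.collageFil r × I → W}
    {g : f.Stratum r × I → W} (hg₀ : Continuous g₀) (hg : Continuous g)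
    (h₀ : ∀ (z : f.Stratum r) (τ : I) (hz : z.pt ∈ f.collageFil r),
      g (z, τ) = g₀ (⟨z.pt, hz⟩, τ))
    (h : ∀ (z z' : f.Stratum r) (τ : I), z.Reduced → z.pt = z'.pt → g (z, τ) = g (z', τ)) :
    ∃ G : C(f.collageFil (r + 1) × I, W),
      (∀ (b : f.collageFil r) τ, G (⟨b.1, f.collageFil_mono r.le_succ b.2⟩, τ) = g₀ (b, τ)) ∧
        ∀ (z : f.Stratum r) τ, G (⟨z.pt, z.pt_mem⟩, τ) = g (z, τ) := by
  have hq := f.isQuotientMap_stageMap r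
  let g' : (f.collageFil r ⊕ f.Stratum r) × I → W :=
    fun q => Sum.elim (fun b => g₀ (b, q.2)) (fun z => g (z, q.2)) q.1
  let G : f.collageFil (r + 1) × I → W := fun q => g' (Function.surjInv hq.surjective q.1, q.2)
  have hmixed (b : f.collageFil r) (z : f.Stratum r) (τ : I)
      (hbz : f.stageMap r (Sum.inl b) = f.stageMap r (Sum.inr z)) : g₀ (b, τ) = g (z, τ) := by
    have h1 : b.1 = z.pt := congrArg Subtype.val hbz
    have hz : z.pt ∈ f.collageFil r := h1 ▸ b.2
    obtain rfl : b = ⟨z.pt, hz⟩ := Subtype.ext h1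
    exact (h₀ z τ hz).symm
  have hG (p : f.collageFil r ⊕ f.Stratum r) (τ : I) : G (f.stageMap r p, τ) = g' (p, τ) := by
    change g' (Function.surjInv hq.surjective (f.stageMap r p), τ) = g' (p, τ)
    have h1 := Function.surjInv_eq hq.surjective (f.stageMap r p)
    generalize Function.surjInv hq.surjective (f.stageMap r p) = p' at h1
    rcases p with b | z <;> rcases p' with b' | z'
    · have h2 : b' = b := Subtype.ext (congrArg (Subtype.val : f.collageFil (r + 1) → _) h1)
      rw [h2]
    · exact (hmixed b z' τ h1.symm).symm
    · exact hmixed b' z τ h1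
    · have h2 : z'.pt = z.pt := congrArg Subtype.val h1
      change g (z', τ) = g (z, τ)
      by_cases h3 : z'.Reduced
      · exact h z' z τ h3 h2
      · rw [Stratum.reduced_iff_pt, not_not] at h3
        have h4 : z.pt ∈ f.collageFil r := h2 ▸ h3
        rw [h₀ z' τ h3, h₀ z τ h4]
        simp only [h2]
  have hg' : Continuous g' := by
    have h1 : Continuous (Sum.elim g₀ g) := continuous_sum_dom.2 ⟨hg₀, hg⟩
    refine (h1.comp Homeomorph.sumProdDistrib.continuous).congr ?_
    rintro ⟨b | z, τ⟩ <;> rfl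
  exact ⟨⟨G, hq.continuous_lift_prod_left (hg'.congr fun q => (hG q.1 q.2).symm)⟩,
    fun b τ => hG (Sum.inl b) τ, fun z τ => hG (Sum.inr z) τ⟩

section Rep

variable [Nonempty (f.Stratum r)]

open Classical in
/-- A representative in the stratum of a point of the stage `r + 1` of the filtration (or junk, if
there is none). -/
def rep (b : f.collageFil (r + 1)) : f.Stratum r :=
  if h : ∃ z : f.Stratum r, z.pt = b then h.choose else Classical.arbitrary _

theorem pt_rep {b : f.collageFil (r + 1)} (hb : b.1 ∉ f.collageFil r) : (rep b).pt = b := by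
  have h : ∃ z : f.Stratum r, z.pt = b := by
    obtain ⟨_, n, c, t, hc, rfl⟩ := b
    exact (f.exists_stratum c t hc).resolve_left hb
  rw [rep, dif_pos h]
  exact h.choose_spec

theorem reduced_rep {b : f.collageFil (r + 1)} (hb : b.1 ∉ f.collageFil r) : (rep b).Reduced := by
  rw [Stratum.reduced_iff_pt, pt_rep hb]
  exact hb

theorem continuousOn_rep {W : Type*} [TopologicalSpace W] {V : Set (f.collageFil (r + 1))}
    (hV : IsOpen V) (hVr : ∀ b ∈ V, b.1 ∉ f.collageFil r) {g : f.Stratum r → W}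
    (hg : ContinuousOn g {z | (⟨z.pt, z.pt_mem⟩ : f.collageFil (r + 1)) ∈ V})
    (h : ∀ z z' : f.Stratum r, (⟨z.pt, z.pt_mem⟩ : f.collageFil (r + 1)) ∈ V → z.Reduced →
      z.pt = z'.pt → g z = g z') : ContinuousOn (fun b => g (rep b)) V := by
  rw [(f.isQuotientMap_stageMap r).continuousOn_isOpen_iff hV, IsOpen.continuousOn_iff
    (hV.preimage (f.stageMap r).continuous)]
  rintro (b | z) hb
  · exact absurd b.2 (hVr _ hb)
  · refine IsOpenEmbedding.inr.continuousAt_iff.1 ?_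
    have hopen : IsOpen {z : f.Stratum r | (⟨z.pt, z.pt_mem⟩ : f.collageFil (r + 1)) ∈ V} :=
      hV.preimage (Stratum.continuous_pt.subtype_mk _)
    refine ContinuousOn.continuousAt (hg.congr fun z' hz' => ?_) (hopen.mem_nhds hb)
    have h1 := hVr _ hz'
    exact (h z' _ hz' ((Stratum.reduced_iff_pt z').2 h1) (pt_rep h1).symm).symm

end Rep

end TopologicalFunctor

/-- A homotopy `h` may be traversed with a speed that is not continuous at the points that it does
not move. -/
theorem continuous_homotopy_speed {A Z : Type*} [TopologicalSpace A] [TopologicalSpace Z]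
    {h : A × I → A} (hh : Continuous h) {a : Z → A} (ha : Continuous a)
    {v : Z → I} (hv : ∀ z, (∀ t, h (a z, t) = a z) ∨ ContinuousAt v z) :
    Continuous fun z => h (a z, v z) := by
  rw [continuous_iff_continuousAt]
  intro z
  obtain hz | hz := hv z
  · -- By compactness of the unit interval, `h (b, t)` is close to `a z` for all `t` at once if `b`
    -- is close to `a z`.
    intro N hN
    rw [Filter.mem_map]
    simp only [hz] at hN
    have key : ∀ᶠ b in 𝓝 (a z), ∀ t ∈ (Set.univ : Set I), h (b, t) ∈ N := by
      refine isCompact_univ.eventually_forall_of_forall_eventually fun t _ => ?_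
      exact hh.continuousAt.preimage_mem_nhds (x := (a z, t)) (by rwa [hz])
    exact (ha.continuousAt.eventually key).mono fun z' hz' => hz' _ (Set.mem_univ _)
  · exact ContinuousAt.comp (f := fun z => (a z, v z)) hh.continuousAt
      (ha.continuousAt.prodMk hz)

/-! ### Retraction of a neighbourhood of a stage of the filtration -/

/-- The minimum of the first `r + 1` elements of two sequences. -/
def low (r : ℕ) (t v : ℕ → ℝ) : ℝ :=
  (Finset.range (r + 1)).inf' Finset.nonempty_range_add_one fun i => min (t i) (v i)

section Low

variable {r : ℕ} {t v : ℕ → ℝ}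

theorem low_le_left {i : ℕ} (hi : i ≤ r) : low r t v ≤ t i :=
  (Finset.inf'_le _ (Finset.mem_range_succ_iff.2 hi)).trans (min_le_left _ _)

theorem low_le_right {i : ℕ} (hi : i ≤ r) : low r t v ≤ v i :=
  (Finset.inf'_le _ (Finset.mem_range_succ_iff.2 hi)).trans (min_le_right _ _)

theorem le_low {x : ℝ} (ht : ∀ i ≤ r, x ≤ t i) (hv : ∀ i ≤ r, x ≤ v i) : x ≤ low r t v :=
  Finset.le_inf' _ _ fun i hi => le_min (ht i (Finset.mem_range_succ_iff.1 hi))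
    (hv i (Finset.mem_range_succ_iff.1 hi))

theorem exists_low_eq (r : ℕ) (t v : ℕ → ℝ) : ∃ i ≤ r, low r t v = t i ∨ low r t v = v i := by
  obtain ⟨i, hi, h⟩ := Finset.exists_mem_eq_inf' Finset.nonempty_range_add_one
    (s := Finset.range (r + 1)) fun i => min (t i) (v i)
  refine ⟨i, Finset.mem_range_succ_iff.1 hi, ?_⟩
  obtain h1 | h1 := min_choice (t i) (v i)
  · exact Or.inl (h.trans h1)
  · exact Or.inr (h.trans h1)

theorem low_congr {t' v' : ℕ → ℝ} (ht : ∀ i ≤ r, t i = t' i) (hv : ∀ i ≤ r, v i = v' i) :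
    low r t v = low r t' v' :=
  Finset.inf'_congr _ rfl fun i hi => by
    rw [ht i (Finset.mem_range_succ_iff.1 hi), hv i (Finset.mem_range_succ_iff.1 hi)]

theorem continuous_low {Z : Type*} [TopologicalSpace Z] {t v : Z → ℕ → ℝ}
    (ht : ∀ i ≤ r, Continuous fun z => t z i) (hv : ∀ i ≤ r, Continuous fun z => v z i) :
    Continuous fun z => low r (t z) (v z) :=
  Continuous.finset_inf'_apply _ fun i hi => (ht i (Finset.mem_range_succ_iff.1 hi)).min
    (hv i (Finset.mem_range_succ_iff.1 hi))

end Low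

namespace TopologicalFunctor

open TopologicalCategory

variable {X Y : TopologicalCategory.{u}} {f : TopologicalFunctor X Y} {r : ℕ}

namespace Stratum

variable (u : C(Y.Mor, I))

/-- The values of a function on the edges between vertices in `Y`, followed by `1`. -/
def edgeVal (z : f.Stratum r) (i : ℕ) : ℝ := if i < r then u (z.ed i) else 1

theorem edgeVal_nonneg (z : f.Stratum r) (i : ℕ) : 0 ≤ z.edgeVal u i := by
  rw [edgeVal]
  split_ifs
  · exact (u _).2.1
  · exact zero_le_one

theorem edgeVal_le_one (z : f.Stratum r) (i : ℕ) : z.edgeVal u i ≤ 1 := by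
  rw [edgeVal]
  split_ifs
  · exact (u _).2.2
  · exact le_rfl

theorem continuous_edgeVal (i : ℕ) : Continuous fun z : f.Stratum r => z.edgeVal u i := by
  by_cases hi : i < r
  · simp only [edgeVal, if_pos hi]
    exact continuous_subtype_val.comp (u.continuous.comp (continuous_ed hi))
  · simp only [edgeVal, if_neg hi]
    exact continuous_const

/-- A measure for how far a representative is from being not reduced: the minimum of the weights of
the vertices in `Y` and of the values of `u` on the edges between them. -/
def gap (z : f.Stratum r) : ℝ := low r z.wt (z.edgeVal u)

theorem continuous_gap : Continuous fun z : f.Stratum r => z.gap u :=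
  continuous_low (fun i _ => continuous_wt i) fun i _ => continuous_edgeVal u i

theorem gap_nonneg (z : f.Stratum r) : 0 ≤ z.gap u :=
  le_low (fun i _ => z.wt_nonneg i) fun i _ => z.edgeVal_nonneg u i

/-- The variant of `Stratum.gap` that does not take the edge `i` into account. -/
def gapExcept (z : f.Stratum r) (i : ℕ) : ℝ := low r z.wt (Function.update (z.edgeVal u) i 1)

theorem continuous_gapExcept (i : ℕ) : Continuous fun z : f.Stratum r => z.gapExcept u i := by
  refine continuous_low (fun i _ => continuous_wt i) fun j _ => ?_
  obtain rfl | hij := eq_or_ne j i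
  · simpa only [Function.update_self] using continuous_const
  · simpa only [Function.update_of_ne hij] using continuous_edgeVal u j

theorem gap_le_gapExcept (z : f.Stratum r) (i : ℕ) : z.gap u ≤ z.gapExcept u i := by
  refine le_low (fun j hj => low_le_left hj) fun j hj => (low_le_right hj).trans ?_
  obtain rfl | hij := eq_or_ne j i
  · rw [Function.update_self]
    exact z.edgeVal_le_one u j
  · rw [Function.update_of_ne hij]

variable {u}

theorem gap_pos_iff (hu : Set.range Y.ident = u ⁻¹' {0}) (z : f.Stratum r) :
    0 < z.gap u ↔ z.Reduced := by
  have hmem (a : Y.Mor) : a ∈ Set.range Y.ident ↔ (u a : ℝ) = 0 := by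
    rw [hu, Set.mem_preimage, Set.mem_singleton_iff, Subtype.ext_iff]
    rfl
  constructor
  · refine fun h => ⟨fun i hi => h.trans_le (low_le_left hi), fun i hi => ?_⟩
    rw [hmem]
    have h1 := h.trans_le (low_le_right hi.le)
    rw [edgeVal, if_pos hi] at h1
    exact h1.ne'
  · intro h
    obtain ⟨i, hi, h1 | h1⟩ := exists_low_eq r z.wt (z.edgeVal u)
    · rw [gap, h1]
      exact h.1 i hi
    · rw [gap, h1, edgeVal]
      split_ifs with hir
      · have := h.2 i hir
        rw [hmem] at this
        exact lt_of_le_of_ne (u _).2.1 (Ne.symm this)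
      · exact zero_lt_one

theorem gap_eq_zero_iff (hu : Set.range Y.ident = u ⁻¹' {0}) (z : f.Stratum r) :
    z.gap u = 0 ↔ z.pt ∈ f.collageFil r := by
  rw [← not_iff_not, ← reduced_iff_pt, ← gap_pos_iff hu]
  exact ⟨fun h => lt_of_le_of_ne (z.gap_nonneg u) (Ne.symm h), fun h => h.ne'⟩

theorem edgeVal_eq {z z' : f.Stratum r} (h : z.Reduced) (hz : z.pt = z'.pt) (i : ℕ) :
    z.edgeVal u i = z'.edgeVal u i := by
  rw [edgeVal, edgeVal]
  split_ifs with hi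
  · rw [ed_eq h hz hi]
  · rfl

theorem gap_eq {z z' : f.Stratum r} (h : z.Reduced) (hz : z.pt = z'.pt) : z.gap u = z'.gap u :=
  low_congr (fun _ hi => wt_eq h hz hi) fun i _ => edgeVal_eq h hz i

theorem gapExcept_eq {z z' : f.Stratum r} (h : z.Reduced) (hz : z.pt = z'.pt) (i : ℕ) :
    z.gapExcept u i = z'.gapExcept u i := by
  rw [gapExcept, gapExcept, funext (edgeVal_eq h hz)]
  exact low_congr (fun _ hi => wt_eq h hz hi) fun _ _ => rfl

end Stratum

/-- The gap descends to a function on the stage `r + 1` that vanishes exactly on the stage `r`. -/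
theorem exists_gap {u : C(Y.Mor, I)} (hu : Set.range Y.ident = u ⁻¹' {0}) :
    ∃ w : C(f.collageFil (r + 1), ℝ), (∀ z : f.Stratum r, w ⟨z.pt, z.pt_mem⟩ = z.gap u) ∧
      (∀ b, 0 ≤ w b) ∧ ∀ b, w b = 0 ↔ b.1 ∈ f.collageFil r := by
  obtain ⟨G, h0, hG⟩ := exists_extension (f := f) (r := r) (g₀ := fun _ => (0 : ℝ))
    (g := fun q => q.1.gap u) continuous_const ((Stratum.continuous_gap u).comp continuous_fst)
    (fun z _ hz => (Stratum.gap_eq_zero_iff hu z).2 hz) fun z z' _ h hz => Stratum.gap_eq h hz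
  have key (b : f.collageFil (r + 1)) :
      0 ≤ G (b, 0) ∧ (G (b, 0) = 0 ↔ b.1 ∈ f.collageFil r) := by
    by_cases hb : b.1 ∈ f.collageFil r
    · have : G (b, 0) = 0 := h0 ⟨b.1, hb⟩ 0
      exact ⟨this.ge, fun _ => hb, fun _ => this⟩
    · obtain ⟨_, n, c, t, hc, rfl⟩ := b
      obtain ⟨z, hz⟩ := (f.exists_stratum c t hc).resolve_left hb
      simp only [← hz]
      have : G (⟨z.pt, z.pt_mem⟩, 0) = z.gap u := hG z 0
      rw [this]
      exact ⟨z.gap_nonneg u, Stratum.gap_eq_zero_iff hu z⟩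
  exact ⟨⟨fun b => G (b, 0), by fun_prop⟩, fun z => hG z 0, fun b => (key b).1, fun b => (key b).2⟩

/-- Homotopies of the stage `r + 1` of the filtration that fix the stage `r` can be defined by
modifying the edges of the strings in `Y` and the weights, if the modification at time `0` is
trivial, as well as that of representatives that are not reduced. -/
theorem exists_modification {a : f.Stratum r × I → ℕ → Y.Mor} {s : f.Stratum r × I → ℕ → ℝ}
    {k : f.Stratum r × I → ℝ}
    (ha : ∀ i < r, Continuous fun q => a q i) (hs : ∀ i ≤ r, Continuous fun q => s q i)
    (hk : Continuous k) (hsrc : ∀ q, ∀ i < r, Y.src (a q i) = Y.src (q.1.ed i))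
    (htgt : ∀ q, ∀ i < r, Y.tgt (a q i) = Y.tgt (q.1.ed i)) (hs0 : ∀ q, ∀ i ≤ r, 0 ≤ s q i)
    (hk0 : ∀ q, 0 ≤ k q)
    (hsum : ∀ q, ∑ i ∈ Finset.range (r + 1), s q i + k q * q.1.xsum = 1)
    (htriv : ∀ q, q.2 = 0 ∨ ¬ q.1.Reduced →
      (∀ i < r, a q i = q.1.ed i) ∧ (∀ i ≤ r, s q i = q.1.wt i) ∧ k q = 1)
    (hinv : ∀ (z z' : f.Stratum r) (τ : I), z.Reduced → z.pt = z'.pt →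
      (∀ i < r, a (z, τ) i = a (z', τ) i) ∧ (∀ i ≤ r, s (z, τ) i = s (z', τ) i) ∧
        k (z, τ) = k (z', τ)) :
    ∃ G : C(f.collageFil (r + 1) × I, f.CollageRealization), (∀ b, G (b, 0) = b) ∧
      (∀ b τ, b.1 ∈ f.collageFil r → G (b, τ) = b) ∧
        ∀ (z : f.Stratum r) τ,
          G (⟨z.pt, z.pt_mem⟩, τ) = z.modify (a (z, τ)) (s (z, τ)) (k (z, τ)) := by
  have hstr (q : f.Stratum r × I) : Y.IsString r (a q) q.1.ob := fun i hi =>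
    ⟨(hsrc q i hi).trans (q.1.isString i hi).1, (htgt q i hi).trans (q.1.isString i hi).2⟩
  have hpt (q : f.Stratum r × I) (hq : q.2 = 0 ∨ ¬ q.1.Reduced) :
      q.1.modify (a q) (s q) (k q) = q.1.pt := by
    obtain ⟨h1, h2, h3⟩ := htriv q hq
    rw [h3]
    exact Stratum.modify_eq_pt h1 h2
  have hmod (z z' : f.Stratum r) (τ : I) (h : z.Reduced) (hz : z.pt = z'.pt) :
      z.modify (a (z, τ)) (s (z, τ)) (k (z, τ)) =
        z'.modify (a (z', τ)) (s (z', τ)) (k (z', τ)) := by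
    obtain ⟨h1, h2, h3⟩ := hinv z z' τ h hz
    have hle : ∑ i ∈ Finset.range (r + 1), s (z, τ) i ≤ 1 := by
      rw [← hsum (z, τ)]
      exact le_add_of_nonneg_right (mul_nonneg (hk0 _) z.xsum_nonneg)
    refine (Stratum.modify_eq h hz (hstr (z, τ)) rfl ⟨hs0 _, hle⟩ (hsum _)).trans ?_
    rw [Stratum.modify, Stratum.modify, h3, h2 r le_rfl]
    unfold joinPt
    rw [consN_congr h1]
    congr 1
    refine funext fun i => ?_
    rw [consW_apply, consW_apply]
    split_ifs with hi
    · rfl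
    · exact h2 i (by omega)
  obtain ⟨G, h0, hG⟩ := exists_extension (f := f) (r := r) (g₀ := fun q => q.1.1)
    (g := fun q : f.Stratum r × I => q.1.modify (a q) (s q) (k q))
    (continuous_subtype_val.comp continuous_fst)
    (Stratum.continuous_modify ha hs hk hstr (fun _ => rfl) hs0 hk0 hsum)
    (fun z τ hz => hpt (z, τ) (Or.inr ((Stratum.reduced_iff_pt z).not_left.2 hz)))
    hmod
  refine ⟨G, fun b => ?_, fun b τ hb => h0 ⟨b.1, hb⟩ τ, hG⟩
  by_cases hb : b.1 ∈ f.collageFil r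
  · exact h0 ⟨b.1, hb⟩ 0
  · obtain ⟨_, n, c, t, hc, rfl⟩ := b
    obtain ⟨z, hz⟩ := (f.exists_stratum c t hc).resolve_left hb
    simp only [← hz]
    exact (hG z 0).trans (hpt (z, 0) (Or.inl rfl))

/-- The stage `r` of the filtration is a deformation retract of a neighbourhood: the weights that
are close to `0` are moved to `0`, and the edges that are close to identities are moved to
identities. -/
theorem exists_retraction {u : C(Y.Mor, I)} {h : C(Y.Mor × I, Y.Mor)}
    (hp : ∀ a t, (Y.src (h (a, t)), Y.tgt (h (a, t))) = (Y.src a, Y.tgt a))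
    (hu : Set.range Y.ident = u ⁻¹' {0}) (h0 : ∀ a, h (a, 0) = a)
    (hid : ∀ a ∈ Set.range Y.ident, ∀ t, h (a, t) = a)
    (h1 : ∀ a, u a < 1 → h (a, 1) ∈ Set.range Y.ident) {ε : ℝ} (hε : 0 < ε)
    (hεr : (r + 1) * ε ≤ 1 / 2) :
    ∃ G : C(f.collageFil (r + 1) × I, f.CollageRealization), (∀ b, G (b, 0) = b) ∧
      (∀ b τ, b.1 ∈ f.collageFil r → G (b, τ) = b) ∧
        ∀ z : f.Stratum r, z.gap u ≤ ε → G (⟨z.pt, z.pt_mem⟩, 1) ∈ f.collageFil r := by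
  have hu0 (a : Y.Mor) (ha : (u a : ℝ) = 0) (t : I) : h (a, t) = a :=
    hid a (hu ▸ Subtype.ext ha) t
  -- The edge `i` is moved along the homotopy `h` until the time `v`, which is `1` at the end if the
  -- edge realizes the gap, and `0` if the representative is not reduced for another reason.
  let v : f.Stratum r × I → ℕ → I := fun q i => Set.projIcc 0 1 zero_le_one
    (q.2 * (q.1.gapExcept u i / max (u (q.1.ed i) : ℝ) (q.1.gapExcept u i)))
  -- The amount by which the weights of the vertices in `Y` are diminished, before all weights are
  -- rescaled. A weight that realizes the gap becomes zero.
  let μ : f.Stratum r × I → ℝ := fun q => q.2 * min ε (q.1.gap u)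
  have hμ (q : f.Stratum r × I) : 0 ≤ μ q ∧ μ q ≤ ε ∧ ∀ i ≤ r, μ q ≤ q.1.wt i := by
    have h2 : 0 ≤ min ε (q.1.gap u) := le_min hε.le (q.1.gap_nonneg u)
    have h3 : μ q ≤ min ε (q.1.gap u) := mul_le_of_le_one_left h2 q.2.2.2
    exact ⟨mul_nonneg q.2.2.1 h2, h3.trans (min_le_left _ _), fun i hi =>
      h3.trans ((min_le_right _ _).trans (low_le_left hi))⟩
  have hden (q : f.Stratum r × I) : 0 < 1 - (r + 1) * μ q := by
    have h2 := mul_le_mul_of_nonneg_left (hμ q).2.1 (by positivity : (0 : ℝ) ≤ r + 1)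
    linarith
  have hvi (q : f.Stratum r × I) (i : ℕ) (hq : q.1.gapExcept u i = 0 ∨ q.2 = 0) : v q i = 0 := by
    have : (q.2 : ℝ) * (q.1.gapExcept u i / max (u (q.1.ed i) : ℝ) (q.1.gapExcept u i)) = 0 := by
      obtain hq | hq := hq <;> simp [hq]
    change Set.projIcc 0 1 zero_le_one _ = _
    rw [this]
    exact Set.projIcc_left zero_le_one
  have hμc : Continuous μ := (continuous_subtype_val.comp continuous_snd).mul
    (continuous_const.min ((Stratum.continuous_gap u).comp continuous_fst))
  have hdc : Continuous fun q => 1 - (r + 1) * μ q := by fun_prop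
  have hε1 : ε ≤ 1 / 2 := le_trans (le_mul_of_one_le_left hε.le (by simp)) hεr
  have hs0 (q : f.Stratum r × I) : ∀ i ≤ r, 0 ≤ (q.1.wt i - μ q) / (1 - (r + 1) * μ q) :=
    fun i hi => div_nonneg (sub_nonneg.2 ((hμ q).2.2 i hi)) (hden q).le
  have hk0 (q : f.Stratum r × I) : 0 ≤ 1 / (1 - (r + 1) * μ q) :=
    div_nonneg zero_le_one (hden q).le
  have hsum (q : f.Stratum r × I) : ∑ i ∈ Finset.range (r + 1),
      (q.1.wt i - μ q) / (1 - (r + 1) * μ q) + 1 / (1 - (r + 1) * μ q) * q.1.xsum = 1 := by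
    have h2 := (hden q).ne'
    rw [← Finset.sum_div, Finset.sum_sub_distrib, Stratum.xsum]
    simp only [Finset.sum_const, Finset.card_range, nsmul_eq_mul, Nat.cast_add, Nat.cast_one]
    field_simp
    ring
  have hstr (q : f.Stratum r × I) : Y.IsString r (fun i => h (q.1.ed i, v q i)) q.1.ob :=
    fun i hi => ⟨(congrArg Prod.fst (hp _ _)).trans (q.1.isString i hi).1,
      (congrArg Prod.snd (hp _ _)).trans (q.1.isString i hi).2⟩
  refine Exists.elim (exists_modification (f := f) (r := r)
    (a := fun q i => h (q.1.ed i, v q i))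
    (s := fun q i => (q.1.wt i - μ q) / (1 - (r + 1) * μ q))
    (k := fun q => 1 / (1 - (r + 1) * μ q)) ?_ ?_ ?_ ?_ ?_ hs0 hk0 hsum ?_ ?_) ?_
  · intro i hi
    have hec : Continuous fun q : f.Stratum r × I => q.1.ed i :=
      (Stratum.continuous_ed hi).comp continuous_fst
    -- `v` need not be continuous where `u` vanishes on the edge, but `h` does not move it there.
    refine continuous_homotopy_speed h.continuous hec fun q => ?_
    by_cases hq : (u (q.1.ed i) : ℝ) = 0
    · exact Or.inl (hu0 _ hq)
    · refine Or.inr (continuous_projIcc.continuousAt.comp ?_)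
      have hg : Continuous fun q : f.Stratum r × I => q.1.gapExcept u i :=
        (Stratum.continuous_gapExcept u i).comp continuous_fst
      have hue : Continuous fun q : f.Stratum r × I => (u (q.1.ed i) : ℝ) :=
        continuous_subtype_val.comp (u.continuous.comp hec)
      refine (continuous_subtype_val.comp continuous_snd).continuousAt.mul
        (hg.continuousAt.div (hue.max hg).continuousAt ?_)
      exact ((lt_of_le_of_ne (u _).2.1 (Ne.symm hq)).trans_le (le_max_left _ _)).ne'
  · exact fun i _ => (((Stratum.continuous_wt i).comp continuous_fst).sub hμc).div hdc
      fun q => (hden q).ne'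
  · exact continuous_const.div hdc fun q => (hden q).ne'
  · exact fun q i _ => congrArg Prod.fst (hp _ _)
  · exact fun q i _ => congrArg Prod.snd (hp _ _)
  · intro q hq
    have hμ0 : μ q = 0 := by
      obtain hq | hq := hq
      · simp [μ, hq]
      · have h2 : q.1.gap u = 0 := le_antisymm
          (not_lt.1 fun h2 => hq ((Stratum.gap_pos_iff hu q.1).1 h2)) (q.1.gap_nonneg u)
        simp [μ, h2, hε.le]
    refine ⟨fun i hi => ?_, fun i _ => by simp [hμ0], by simp [hμ0]⟩
    by_cases hui : (u (q.1.ed i) : ℝ) = 0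
    · exact hu0 _ hui _
    · rw [hvi q i, h0]
      refine hq.symm.imp_left fun hq => le_antisymm ?_
        ((q.1.gap_nonneg u).trans (q.1.gap_le_gapExcept u i))
      have h2 : q.1.gap u ≤ 0 := not_lt.1 fun h2 => hq ((Stratum.gap_pos_iff hu q.1).1 h2)
      obtain ⟨j, hj, h3⟩ := exists_low_eq r q.1.wt (q.1.edgeVal u)
      rw [← Stratum.gap] at h3
      obtain h3 | h3 := h3
      · exact (low_le_left hj).trans (h3 ▸ h2)
      · refine (low_le_right hj).trans ?_
        rw [Function.update_of_ne, ← h3]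
        · exact h2
        · rintro rfl
          rw [Stratum.edgeVal, if_pos hi] at h3
          exact hui (le_antisymm (h3 ▸ h2) (u _).2.1)
  · intro z z' τ hz hzz
    have hg := Stratum.gap_eq (u := u) hz hzz
    have hμ' : μ (z, τ) = μ (z', τ) := by
      change τ * min ε (z.gap u) = τ * min ε (z'.gap u)
      rw [hg]
    refine ⟨fun i hi => ?_, fun i hi => ?_, ?_⟩
    · have he : z.gapExcept u i = z'.gapExcept u i := Stratum.gapExcept_eq hz hzz i
      have hed := Stratum.ed_eq hz hzz hi
      have hv : v (z, τ) i = v (z', τ) i := by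
        change Set.projIcc 0 1 zero_le_one _ = Set.projIcc 0 1 zero_le_one _
        rw [he, hed]
      change h (z.ed i, v (z, τ) i) = h (z'.ed i, v (z', τ) i)
      rw [hv, hed]
    · change (z.wt i - μ (z, τ)) / _ = (z'.wt i - μ (z', τ)) / _
      rw [hμ', Stratum.wt_eq hz hzz hi]
    · rw [hμ']
  · rintro G ⟨hG0, hGr, hG⟩
    refine ⟨G, hG0, hGr, fun z hz => ?_⟩
    by_cases hred : z.pt ∈ f.collageFil r
    · rw [hGr _ _ hred]
      exact hred
    rw [← Stratum.reduced_iff_pt] at hred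
    have hpos := (Stratum.gap_pos_iff hu z).2 hred
    rw [hG]
    obtain ⟨z', hz', hwt, hed⟩ := Stratum.exists_modify (hstr (z, 1)) rfl (hs0 (z, 1)) (hk0 (z, 1))
      (hsum (z, 1))
    rw [← hz']
    refine not_not.1 fun hr => ?_
    rw [← Stratum.reduced_iff_pt] at hr
    obtain ⟨j, hj, h3 | h3⟩ := exists_low_eq r z.wt (z.edgeVal u)
    · have h4 := hr.1 j hj
      rw [hwt j hj] at h4
      have h5 : μ (z, 1) = z.wt j := by
        change (1 : ℝ) * min ε (z.gap u) = _
        rw [min_eq_right hz, one_mul]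
        exact h3
      simp [h5] at h4
    · have hgap : z.gap u = z.edgeVal u j := h3
      obtain hjr | rfl := hj.lt_or_eq
      · refine hr.2 j hjr ?_
        rw [hed j hjr]
        rw [Stratum.edgeVal, if_pos hjr] at hgap
        have h4 := z.gap_le_gapExcept u j
        have h5 : v (z, 1) j = 1 := by
          change Set.projIcc 0 1 zero_le_one (1 * (_ / max (u (z.ed j) : ℝ) (z.gapExcept u j))) = 1
          rw [max_eq_right (hgap ▸ h4), div_self (hpos.trans_le h4).ne', one_mul]
          exact Set.projIcc_right zero_le_one
        change h (z.ed j, v (z, 1) j) ∈ _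
        rw [h5]
        refine h1 _ (Subtype.coe_lt_coe.1 ?_)
        rw [← hgap]
        exact (hz.trans hε1).trans_lt (by norm_num)
      · rw [Stratum.edgeVal, if_neg (lt_irrefl _)] at hgap
        linarith

end TopologicalFunctor

/-! ### Compression into the previous stage of the filtration -/

/-- The projection of the real numbers to the unit interval. -/
def ramp (x : ℝ) : ℝ := max 0 (min 1 x)

theorem ramp_nonneg (x : ℝ) : 0 ≤ ramp x := le_max_left _ _

theorem ramp_le_one (x : ℝ) : ramp x ≤ 1 := max_le zero_le_one (min_le_left _ _)

theorem ramp_of_nonpos {x : ℝ} (hx : x ≤ 0) : ramp x = 0 :=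
  max_eq_left ((min_le_right _ _).trans hx)

theorem ramp_of_one_le {x : ℝ} (hx : 1 ≤ x) : ramp x = 1 := by
  rw [ramp, min_eq_left hx, max_eq_right zero_le_one]

theorem continuous_ramp : Continuous ramp :=
  continuous_const.max (continuous_const.min continuous_id)

namespace TopologicalFunctor

open TopologicalCategory

variable {X Y : TopologicalCategory.{u}} {f : TopologicalFunctor X Y} {r : ℕ}

namespace Stratum

/-- The weights of the vertices in `Y` after those of the vertices in `X` have been diminished,
and set to zero where they amount to at most a quarter of the total weight. -/
def shrunkWt (z : f.Stratum r) (i : ℕ) : ℝ := z.wt i / (1 - ramp (2 - 4 * z.xsum) * z.xsum)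

theorem half_le_of_ramp (z : f.Stratum r) {μ : ℝ} (hμ : μ ≤ ramp (2 - 4 * z.xsum)) :
    1 / 2 ≤ 1 - μ * z.xsum := by
  have h0 := z.xsum_nonneg
  have h1 := mul_le_mul_of_nonneg_right hμ h0
  obtain h | h := le_total (1 / 2) z.xsum
  · rw [ramp_of_nonpos (by linarith), zero_mul] at h1
    linarith
  · have h2 := mul_le_mul (ramp_le_one (2 - 4 * z.xsum)) h h0 zero_le_one
    linarith

theorem continuous_shrunkWt (i : ℕ) : Continuous fun z : f.Stratum r => z.shrunkWt i := by
  have h : Continuous fun z : f.Stratum r => ramp (2 - 4 * z.xsum) :=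
    continuous_ramp.comp (continuous_const.sub (continuous_const.mul continuous_xsum))
  refine (continuous_wt i).div (continuous_const.sub (h.mul continuous_xsum)) fun z => ?_
  linarith [z.half_le_of_ramp le_rfl]

theorem shrunkWt_nonneg (z : f.Stratum r) (i : ℕ) : 0 ≤ z.shrunkWt i :=
  div_nonneg (z.wt_nonneg i) (by linarith [z.half_le_of_ramp le_rfl])

theorem div_le_two_mul {x d : ℝ} (hx : 0 ≤ x) (hd : 1 / 2 ≤ d) : x / d ≤ 2 * x := by
  rw [div_le_iff₀ (by linarith)]
  nlinarith

theorem shrunkWt_le (z : f.Stratum r) (i : ℕ) : z.shrunkWt i ≤ 2 * z.wt i :=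
  div_le_two_mul (z.wt_nonneg i) (z.half_le_of_ramp le_rfl)

theorem shrunk_sum (z : f.Stratum r) {μ : ℝ} (hμ : μ ≤ ramp (2 - 4 * z.xsum)) :
    ∑ i ∈ Finset.range (r + 1), z.wt i / (1 - μ * z.xsum) +
      (1 - μ) / (1 - μ * z.xsum) * z.xsum = 1 := by
  have h : 1 - μ * z.xsum ≠ 0 := by linarith [z.half_le_of_ramp hμ]
  rw [← Finset.sum_div, show ∑ i ∈ Finset.range (r + 1), z.wt i = 1 - z.xsum by rw [xsum]; ring,
    div_mul_eq_mul_div, ← add_div, div_eq_one_iff_eq h]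
  ring

theorem isPartialWeight_shrunkWt (z : f.Stratum r) : IsPartialWeight r z.shrunkWt := by
  refine ⟨fun i _ => z.shrunkWt_nonneg i, ?_⟩
  have h1 := z.shrunk_sum (μ := ramp (2 - 4 * z.xsum)) le_rfl
  have h2 : 0 ≤ (1 - ramp (2 - 4 * z.xsum)) / (1 - ramp (2 - 4 * z.xsum) * z.xsum) * z.xsum :=
    mul_nonneg (div_nonneg (by linarith [ramp_le_one (2 - 4 * z.xsum)])
      (by linarith [z.half_le_of_ramp le_rfl])) z.xsum_nonneg
  unfold shrunkWt
  linarith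

end Stratum

/-- The vertices in `X` are given smaller weights, outside a neighbourhood of the stage `r`, so that
there the result is a join with any point `ζ` of the right fibre that agrees with the slice
coordinate where the weight of the vertices in `X` is at least a quarter. -/
theorem exists_shrinking {u : C(Y.Mor, I)} (hu : Set.range Y.ident = u ⁻¹' {0}) {e : ℝ}
    (he : 0 < e) : ∃ G : C(f.collageFil (r + 1) × I, f.CollageRealization), (∀ b, G (b, 0) = b) ∧
      (∀ b τ, b.1 ∈ f.collageFil r → G (b, τ) = b) ∧
      (∀ z : f.Stratum r, ∃ z' : f.Stratum r, z'.pt = G (⟨z.pt, z.pt_mem⟩, 1) ∧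
        z'.gap u ≤ 2 * z.gap u) ∧
      ∀ z : f.Stratum r, e ≤ z.gap u → ∀ ζ : f.slice.ClassifyingSpace,
        f.classifyingRho ζ = z.ob r →
        (∀ [Nonempty f.slice.ClassifyingSpace], 1 / 4 ≤ z.xsum → ζ = z.sliceCoord) →
        G (⟨z.pt, z.pt_mem⟩, 1) = f.join r z.ed z.shrunkWt ζ := by
  -- The weights of the vertices in `X` are multiplied by `1 - μ`, and all weights are rescaled.
  let μ : f.Stratum r × I → ℝ := fun q =>
    q.2 * ramp (2 * q.1.gap u / e - 1) * ramp (2 - 4 * q.1.xsum)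
  have hμ0 (q : f.Stratum r × I) : 0 ≤ μ q :=
    mul_nonneg (mul_nonneg q.2.2.1 (ramp_nonneg _)) (ramp_nonneg _)
  have hμ (q : f.Stratum r × I) : μ q ≤ ramp (2 - 4 * q.1.xsum) :=
    mul_le_of_le_one_left (ramp_nonneg _) (mul_le_one₀ q.2.2.2 (ramp_nonneg _) (ramp_le_one _))
  have hden (q : f.Stratum r × I) : 1 / 2 ≤ 1 - μ q * q.1.xsum := q.1.half_le_of_ramp (hμ q)
  have hxc : Continuous fun q : f.Stratum r × I => q.1.xsum :=
    Stratum.continuous_xsum.comp continuous_fst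
  have hgc : Continuous fun q : f.Stratum r × I => q.1.gap u :=
    (Stratum.continuous_gap u).comp continuous_fst
  have hμc : Continuous μ :=
    ((continuous_subtype_val.comp continuous_snd).mul (continuous_ramp.comp
      (((continuous_const.mul hgc).div_const e).sub continuous_const))).mul
        (continuous_ramp.comp (continuous_const.sub (continuous_const.mul hxc)))
  have hdc : Continuous fun q : f.Stratum r × I => 1 - μ q * q.1.xsum :=
    continuous_const.sub (hμc.mul hxc)
  have hd0 (q : f.Stratum r × I) : 1 - μ q * q.1.xsum ≠ 0 := by linarith [hden q]
  have hs0 (q : f.Stratum r × I) : ∀ i ≤ r, 0 ≤ q.1.wt i / (1 - μ q * q.1.xsum) :=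
    fun i _ => div_nonneg (q.1.wt_nonneg i) (by linarith [hden q])
  have hk0 (q : f.Stratum r × I) : 0 ≤ (1 - μ q) / (1 - μ q * q.1.xsum) :=
    div_nonneg (by linarith [hμ q, ramp_le_one (2 - 4 * q.1.xsum)]) (by linarith [hden q])
  have hsum (q : f.Stratum r × I) := q.1.shrunk_sum (hμ q)
  refine Exists.elim (exists_modification (f := f) (r := r) (a := fun q => q.1.ed)
    (s := fun q i => q.1.wt i / (1 - μ q * q.1.xsum))
    (k := fun q => (1 - μ q) / (1 - μ q * q.1.xsum)) ?_ ?_ ?_ (fun _ _ _ => rfl) (fun _ _ _ => rfl)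
    hs0 hk0 hsum ?_ ?_) ?_
  · exact fun i hi => (Stratum.continuous_ed hi).comp continuous_fst
  · exact fun i _ => ((Stratum.continuous_wt i).comp continuous_fst).div hdc hd0
  · exact (continuous_const.sub hμc).div hdc hd0
  · intro q hq
    have hμq : μ q = 0 := by
      obtain hq | hq := hq
      · simp [μ, hq]
      · have h2 : q.1.gap u = 0 := le_antisymm
          (not_lt.1 fun h2 => hq ((Stratum.gap_pos_iff hu q.1).1 h2)) (q.1.gap_nonneg u)
        simp [μ, h2, ramp_of_nonpos]
    exact ⟨fun _ _ => rfl, fun i _ => by simp [hμq], by simp [hμq]⟩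
  · intro z z' τ hz hzz
    have hx := Stratum.xsum_eq hz hzz
    have hμ' : μ (z, τ) = μ (z', τ) := by
      change τ * ramp (2 * z.gap u / e - 1) * ramp (2 - 4 * z.xsum) = _
      rw [Stratum.gap_eq hz hzz, hx]
    refine ⟨fun i hi => Stratum.ed_eq hz hzz hi, fun i hi => ?_, ?_⟩
    · change z.wt i / (1 - μ (z, τ) * z.xsum) = z'.wt i / (1 - μ (z', τ) * z'.xsum)
      rw [hμ', hx, Stratum.wt_eq hz hzz hi]
    · change (1 - μ (z, τ)) / (1 - μ (z, τ) * z.xsum) = (1 - μ (z', τ)) / (1 - μ (z', τ) * z'.xsum)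
      rw [hμ', hx]
  · rintro G ⟨hG0, hGr, hG⟩
    refine ⟨G, hG0, hGr, fun z => ?_, fun z hz ζ hζ hζz => ?_⟩
    · obtain ⟨z', hz', hwt, hed⟩ := Stratum.exists_modify (z := z) z.isString rfl
        (hs0 (z, 1)) (hk0 (z, 1)) (hsum (z, 1))
      refine ⟨z', hz'.trans (hG z 1).symm, ?_⟩
      obtain ⟨j, hj, h3 | h3⟩ := exists_low_eq r z.wt (z.edgeVal u)
      · refine (low_le_left hj).trans ?_
        rw [hwt j hj, Stratum.gap, h3]
        exact Stratum.div_le_two_mul (z.wt_nonneg j) (hden (z, 1))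
      · refine (low_le_right hj).trans ?_
        have h4 := z.edgeVal_nonneg u j
        have h5 : z'.edgeVal u j = z.edgeVal u j := by
          rw [Stratum.edgeVal, Stratum.edgeVal]
          split_ifs with hjr
          · rw [hed j hjr]
          · rfl
        rw [h5, Stratum.gap, h3]
        linarith
    · have hμ1 : μ (z, 1) = ramp (2 - 4 * z.xsum) := by
        change (1 : ℝ) * ramp (2 * z.gap u / e - 1) * _ = _
        rw [ramp_of_one_le, one_mul, one_mul]
        rw [le_sub_iff_add_le, le_div_iff₀ he]
        linarith
      rw [hG]
      dsimp only
      rw [hμ1]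
      have hsum' := z.shrunk_sum (μ := ramp (2 - 4 * z.xsum)) le_rfl
      have : Nonempty f.slice.ClassifyingSpace := ⟨ζ⟩
      obtain hx | hx := le_or_gt (1 / 4) z.xsum
      · rw [hζz hx]
        exact Stratum.modify_eq_join (by linarith) z.isString rfl z.isPartialWeight_shrunkWt hsum'
      · have hr : ramp (2 - 4 * z.xsum) = 1 := ramp_of_one_le (by linarith)
        have hk : (1 - ramp (2 - 4 * z.xsum)) / (1 - ramp (2 - 4 * z.xsum) * z.xsum) = 0 := by
          rw [hr, sub_self, zero_div]
        rw [hk, zero_mul, add_zero] at hsum'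
        change ∑ i ∈ Finset.range (r + 1), z.shrunkWt i = 1 at hsum'
        rw [hk]
        obtain ⟨n, d, v, rfl⟩ := f.slice.exists_npt ζ
        rw [classifyingRho_npt] at hζ
        rw [join_npt z.isString z.isPartialWeight_shrunkWt hζ, joinRep, hsum', sub_self]
        exact joinPt_coneW_eq z.isString (fun i _ => z.shrunkWt_nonneg i) hsum' z.shObj_tail
          ((f.shObj_sliceCone d).trans hζ) z.tail_zero (sliceCone_zero d) (zero_smul _ _)
          (zero_smul _ _)

end TopologicalFunctor

theorem ContinuousMap.HomotopicRel.of_continuous {K M : Type*} [TopologicalSpace K]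
    [TopologicalSpace M] {g₀ g₁ : C(K, M)} {S : Set K} {H : K × I → M} (hH : Continuous H)
    (h0 : ∀ y, H (y, 0) = g₀ y) (h1 : ∀ y, H (y, 1) = g₁ y) (hS : ∀ y ∈ S, ∀ τ, H (y, τ) = g₀ y) :
    g₀.HomotopicRel g₁ S :=
  ⟨{ toFun := fun q => H (q.2, q.1)
     continuous_toFun := hH.comp continuous_swap
     map_zero_left := h0
     map_one_left := h1
     prop' := fun τ y hy => hS y hy τ }⟩

theorem ContinuousMap.HomotopicRel.mono {K M : Type*} [TopologicalSpace K]
    [TopologicalSpace M] {g₀ g₁ : C(K, M)} {S T : Set K} (h : g₀.HomotopicRel g₁ S) (hT : T ⊆ S) :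
    g₀.HomotopicRel g₁ T := by
  obtain ⟨H⟩ := h
  exact ⟨{ H with prop' := fun τ y hy => H.prop' τ y (hT hy) }⟩

namespace TopologicalFunctor

open TopologicalCategory

variable {X Y : TopologicalCategory.{u}} {f : TopologicalFunctor X Y} {r : ℕ}

/-- A map of a cube to the stage `r + 1` can be deformed into a neighbourhood of the stage `r`:
outside that neighbourhood, the vertices in `X` are replaced by a lift of the last vertex in `Y` to
the classifying space of `Y₀ ↓ f`, and then the weights of the vertices in `Y` are moved to zero. -/
theorem exists_push {u : C(Y.Mor, I)} (hu : Set.range Y.ident = u ⁻¹' {0})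
    (hρ : IsAcyclicSerreFibration f.classifyingRho) {n : ℕ}
    (φ : C(Fin n → I, f.collageFil (r + 1))) {ε : ℝ} (hε : 0 < ε) :
    ∃ φ' : C(Fin n → I, f.CollageRealization),
      ContinuousMap.HomotopicRel ⟨fun y => (φ y).1, by fun_prop⟩ φ' {y | (φ y).1 ∈ f.collageFil r} ∧
        ∀ y, φ' y ∈ f.collageFil r ∨ ∃ z : f.Stratum r, z.pt = φ' y ∧ z.gap u ≤ ε := by
  classical
  by_cases hne : Nonempty (f.Stratum r)
  swap
  · refine ⟨⟨fun y => (φ y).1, by fun_prop⟩, ContinuousMap.HomotopicRel.refl _, fun y => Or.inl ?_⟩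
    obtain ⟨m, c, t, hc, hct⟩ := (φ y).2
    obtain h | ⟨z, -⟩ := f.exists_stratum c t hc
    · rw [hct] at h
      exact h
    · exact absurd ⟨z⟩ hne
  have hneF : Nonempty f.slice.ClassifyingSpace := by
    obtain ⟨z⟩ := hne
    obtain ⟨ζ, -⟩ := hρ.surjective (z.ob r)
    exact ⟨ζ⟩
  set e : ℝ := ε / 4 with he_def
  have he : 0 < e := by positivity
  obtain ⟨w, hwz, hw0, hwr⟩ := exists_gap (f := f) (r := r) hu
  obtain ⟨G, hG0, hGr, hG, hGjoin⟩ := exists_shrinking (f := f) (r := r) hu he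
  have hnot {b : f.collageFil (r + 1)} (hb : 0 < w b) : b.1 ∉ f.collageFil r :=
    fun h => hb.ne' ((hwr b).2 h)
  have hrep {b : f.collageFil (r + 1)} (hb : 0 < w b) :
      (rep b).pt = b ∧ (rep b).Reduced ∧ (rep b).gap u = w b := by
    have h1 := pt_rep (hnot hb)
    refine ⟨h1, reduced_rep (hnot hb), (hwz _).symm.trans ?_⟩
    congr 1
    exact Subtype.ext h1
  -- On the complement `V` of the stage `r`, the data of a representative are continuous functions.
  let V : Set (f.collageFil (r + 1)) := {b | 0 < w b}
  have hV : IsOpen V := isOpen_lt continuous_const w.continuous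
  have hxV : ContinuousOn (fun b => (rep b).xsum) V := continuousOn_rep hV (fun b hb => hnot hb)
    Stratum.continuous_xsum.continuousOn fun z z' _ h hz => Stratum.xsum_eq h hz
  have hoV : ContinuousOn (fun b => (rep b).ob r) V := continuousOn_rep hV (fun b hb => hnot hb)
    (Stratum.continuous_ob le_rfl).continuousOn fun z z' _ h hz => Stratum.ob_eq h hz le_rfl
  have hsV (i : ℕ) (hi : i ≤ r) : ContinuousOn (fun b => (rep b).shrunkWt i) V :=
    continuousOn_rep hV (fun b hb => hnot hb) (Stratum.continuous_shrunkWt i).continuousOn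
      fun z z' _ h hz => by
        rw [Stratum.shrunkWt, Stratum.shrunkWt, Stratum.wt_eq h hz hi, Stratum.xsum_eq h hz]
  have haV (i : ℕ) (hi : i < r) : ContinuousOn (fun b => (rep b).ed i) V :=
    continuousOn_rep hV (fun b hb => hnot hb) (Stratum.continuous_ed hi).continuousOn
      fun z z' _ h hz => Stratum.ed_eq h hz hi
  let V' : Set (f.collageFil (r + 1)) := V ∩ {b | 0 < (rep b).xsum}
  have hV' : IsOpen V' := hxV.isOpen_inter_preimage hV isOpen_Ioi
  have hlV : ContinuousOn (fun b => (rep b).sliceCoord) V' := by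
    refine continuousOn_rep hV' (fun b hb => hnot hb.1)
      (Stratum.continuousOn_sliceCoord.mono fun z hz => ?_) fun z z' hz h hzz =>
        Stratum.sliceCoord_eq h hzz ?_
    all_goals
      have h1 := hrep hz.1
      have h2 := Stratum.xsum_eq h1.2.1 h1.1
      have h3 : 0 < (rep (⟨z.pt, z.pt_mem⟩ : f.collageFil (r + 1))).xsum := hz.2
      rw [h2] at h3
      exact h3
  have hwφ : Continuous fun y => w (φ y) := by fun_prop
  -- On the closed set `C`, the last vertex in `Y` is lifted to the classifying space of `Y₀ ↓ f`.
  -- The lift is the slice coordinate where the weight of the vertices in `X` is at least `1 / 4`.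
  let C : Set (Fin n → I) := {y | e ≤ w (φ y)}
  have hC : IsClosed C := isClosed_le continuous_const hwφ
  have hCV (y : Fin n → I) (hy : y ∈ C) : φ y ∈ V := he.trans_le hy
  obtain ⟨L, hLc, hLo, hLl⟩ := hρ.liftsCubes.exists_lift (C := C) (O := φ ⁻¹' V)
    (D := C ∩ {y | 1 / 4 ≤ (rep (φ y)).xsum}) (O' := φ ⁻¹' V') hC (hV.preimage φ.continuous) hCV
    ((hxV.comp φ.continuous.continuousOn hCV).preimage_isClosed_of_isClosed hC isClosed_Ici)
    (hV'.preimage φ.continuous)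
    (fun y hy => ⟨hCV y hy.1, lt_of_lt_of_le (by norm_num : (0 : ℝ) < 1 / 4) hy.2⟩)
    (b := fun y => (rep (φ y)).ob r) (hoV.comp φ.continuous.continuousOn fun y hy => hy)
    (l := fun y => (rep (φ y)).sliceCoord)
    (hlV.comp φ.continuous.continuousOn fun y hy => hy.2)
    (fun y hy => Stratum.classifyingRho_sliceCoord hy.2.2)
  have hGL (y : Fin n → I) (hy : y ∈ C) :
      G (φ y, 1) = f.join r (rep (φ y)).ed (rep (φ y)).shrunkWt (L y) := by
    obtain ⟨h1, h2, h3⟩ := hrep (hCV y hy)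
    have h4 := hGjoin (rep (φ y)) (h3 ▸ hy) (L y) (hLo y hy) fun {_} hx => hLl y ⟨hy, hy, hx⟩
    rw [← h4]
    congr 2
    exact Subtype.ext h1.symm
  -- The weights of the vertices in `Y` are multiplied by `1 - χ`. At the end, they are zero where
  -- the gap was at least `2 * e`.
  let χ : (Fin n → I) × I → ℝ := fun q => q.2 * ramp (w (φ q.1) / e - 1)
  have hχc : Continuous χ := (continuous_subtype_val.comp continuous_snd).mul
    (continuous_ramp.comp (((hwφ.comp continuous_fst).div_const e).sub continuous_const))
  have hχ0 (q) : 0 ≤ 1 - χ q :=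
    sub_nonneg.2 (mul_le_one₀ q.2.2.2 (ramp_nonneg _) (ramp_le_one _))
  have hχ1 (q) : 1 - χ q ≤ 1 := sub_le_self _ (mul_nonneg q.2.2.1 (ramp_nonneg _))
  have hpw (q : (Fin n → I) × I) :
      IsPartialWeight r fun i => (1 - χ q) * (rep (φ q.1)).shrunkWt i := by
    obtain ⟨h1, h2⟩ := (rep (φ q.1)).isPartialWeight_shrunkWt
    refine ⟨fun i hi => mul_nonneg (hχ0 q) (h1 i hi), ?_⟩
    rw [← Finset.mul_sum]
    exact mul_le_one₀ (hχ1 q) (Finset.sum_nonneg fun i hi =>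
      h1 i (Finset.mem_range_succ_iff.1 hi)) h2
  let P : (Fin n → I) × I → f.CollageRealization := fun q =>
    f.join r (rep (φ q.1)).ed (fun i => (1 - χ q) * (rep (φ q.1)).shrunkWt i) (L q.1)
  let H : (Fin n → I) × I → f.CollageRealization := fun q =>
    if e ≤ w (φ q.1) then P q else G (φ q.1, 1)
  have hPG (q : (Fin n → I) × I) (hq : q.1 ∈ C) (h : χ q = 0) : P q = G (φ q.1, 1) := by
    rw [hGL q.1 hq]
    simp only [P, h, sub_zero, one_mul]
  have hHc : Continuous H := by
    refine continuous_if_le continuous_const (hwφ.comp continuous_fst) ?_ (by fun_prop)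
      fun q hq => hPG q hq.le ?_
    · rw [continuousOn_iff_continuous_domRestrict]
      have hcl : IsClosed {q : (Fin n → I) × I | e ≤ w (φ q.1)} := hC.preimage continuous_fst
      have : CompactSpace {q : (Fin n → I) × I | e ≤ w (φ q.1)} :=
        isCompact_iff_compactSpace.1 hcl.isCompact
      have hφc : Continuous fun q : {q : (Fin n → I) × I | e ≤ w (φ q.1)} => φ q.1.1 := by
        fun_prop
      have hφV (q : {q : (Fin n → I) × I | e ≤ w (φ q.1)}) : φ q.1.1 ∈ V := hCV _ q.2
      exact continuous_join (a := fun q : {q : (Fin n → I) × I | e ≤ w (φ q.1)} =>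
          (rep (φ q.1.1)).ed) (o := fun q => (rep (φ q.1.1)).ob)
        (fun i hi => (haV i hi).comp_continuous hφc hφV) (hoV.comp_continuous hφc hφV)
        (fun q => Stratum.isString _)
        (fun i hi => (continuous_const.sub (hχc.comp continuous_subtype_val)).mul
          ((hsV i hi).comp_continuous hφc hφV))
        (fun q => hpw q.1) (hLc.comp_continuous (continuous_fst.comp continuous_subtype_val)
          fun q => q.2) fun q => hLo _ q.2
    · change q.2 * ramp (w (φ q.1) / e - 1) = 0
      rw [← hq, div_self he.ne', sub_self, ramp_of_nonpos le_rfl, mul_zero]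
  refine ⟨⟨fun y => H (y, 1), by fun_prop⟩,
    (ContinuousMap.HomotopicRel.of_continuous (g₁ := ⟨fun y => G (φ y, 1), by fun_prop⟩)
      (H := fun q => G (φ q.1, q.2)) (by fun_prop) (fun y => hG0 _) (fun y => rfl)
      fun y hy τ => hGr _ _ hy).trans
    (ContinuousMap.HomotopicRel.of_continuous hHc (fun y => ?_) (fun y => rfl)
      fun y hy τ => ?_), fun y => ?_⟩
  · change (if e ≤ w (φ y) then P (y, 0) else G (φ y, 1)) = G (φ y, 1)
    split_ifs with h
    · exact hPG _ h (by simp [χ])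
    · rfl
  · refine if_neg ?_
    rw [(hwr (φ y)).2 hy]
    exact not_le.2 he
  · change (if e ≤ w (φ y) then P (y, 1) else G (φ y, 1)) ∈ _ ∨ ∃ z : f.Stratum r,
      z.pt = (if e ≤ w (φ y) then P (y, 1) else G (φ y, 1)) ∧ _
    by_cases hr : (φ y).1 ∈ f.collageFil r
    · rw [if_neg (by rw [(hwr (φ y)).2 hr]; exact not_le.2 he), hGr _ _ hr]
      exact Or.inl hr
    have hwpos : 0 < w (φ y) := lt_of_le_of_ne (hw0 _) fun h => hr ((hwr _).1 h.symm)
    obtain ⟨h1, h2, h3⟩ := hrep hwpos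
    right
    split_ifs with hye
    · obtain ⟨m, d, v, hdv⟩ := f.slice.exists_npt (L y)
      have hd := hLo y hye
      rw [hdv, classifyingRho_npt] at hd
      obtain ⟨z, hz, hzw, hzr, hze⟩ := exists_stratum_joinPt (sliceCone_zero d)
        (sliceCone_of_ne_zero d) (rep (φ y)).isString ((f.shObj_sliceCone d).trans hd)
        ((hpw (y, 1)).mem v)
      have hzw' (i : ℕ) (hi : i ≤ r) : z.wt i = (1 - χ (y, 1)) * (rep (φ y)).shrunkWt i := by
        obtain hi | rfl := hi.lt_or_eq
        · exact hzw i hi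
        · exact hzr
      refine ⟨z, hz.trans ?_, ?_⟩
      · change _ = f.join r _ _ (L y)
        rw [hdv, join_npt (Stratum.isString _) (hpw (y, 1)) hd]
        rfl
      · obtain hlt | hge := lt_or_ge (w (φ y)) (2 * e)
        · have hle : z.gap u ≤ 2 * (rep (φ y)).gap u := by
            obtain ⟨j, hj, h4 | h4⟩ := exists_low_eq r (rep (φ y)).wt ((rep (φ y)).edgeVal u)
            · refine (low_le_left hj).trans ?_
              rw [hzw' j hj, Stratum.gap, h4]
              exact (mul_le_of_le_one_left (Stratum.shrunkWt_nonneg _ _) (hχ1 _)).trans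
                (Stratum.shrunkWt_le _ _)
            · refine (low_le_right hj).trans ?_
              have h5 := (rep (φ y)).edgeVal_nonneg u j
              have h6 : z.edgeVal u j = (rep (φ y)).edgeVal u j := by
                rw [Stratum.edgeVal, Stratum.edgeVal]
                split_ifs with hjr
                · rw [hze j hjr]
                · rfl
              rw [h6, Stratum.gap, h4]
              linarith
          rw [h3] at hle
          linarith
        · refine (low_le_left (Nat.zero_le r)).trans ?_
          have h4 : χ (y, 1) = 1 := by
            change (1 : ℝ) * ramp (w (φ y) / e - 1) = 1
            rw [one_mul, ramp_of_one_le]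
            rw [le_sub_iff_add_le, le_div_iff₀ he]
            linarith
          rw [hzw' 0 (Nat.zero_le r), h4, sub_self, zero_mul]
          exact hε.le
    · obtain ⟨z, hz, hzg⟩ := hG (rep (φ y))
      refine ⟨z, hz.trans ?_, hzg.trans ?_⟩
      · congr 2
        exact Subtype.ext h1
      · rw [h3]
        linarith [not_le.1 hye]

/-- Maps of cubes can be deformed from a stage of the filtration to the previous one. -/
theorem exists_compression (hY : Y.IsWellPointed)
    (hρ : IsAcyclicSerreFibration f.classifyingRho) {n : ℕ} (φ : C(Fin n → I, f.CollageRealization))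
    (hφ : ∀ y, φ y ∈ f.collageFil (r + 1)) :
    ∃ φ' : C(Fin n → I, f.CollageRealization),
      φ.HomotopicRel φ' {y | φ y ∈ f.collageFil r} ∧ ∀ y, φ' y ∈ f.collageFil r := by
  obtain ⟨u, h, hp, hu, h0, hid, h1⟩ := hY
  obtain ⟨ε, hε, hεr⟩ : ∃ ε : ℝ, 0 < ε ∧ (r + 1) * ε ≤ 1 / 2 :=
    ⟨1 / (2 * (r + 1)), by positivity, by
      apply le_of_eq
      field_simp⟩
  obtain ⟨φ₁, hhom, hφ₁⟩ := exists_push hu hρ ⟨fun y => ⟨φ y, hφ y⟩, by fun_prop⟩ hε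
  obtain ⟨G, hG0, hGr, hG⟩ := exists_retraction (f := f) (r := r) hp hu h0 hid h1 hε hεr
  have hmem (y) : φ₁ y ∈ f.collageFil (r + 1) := by
    obtain h | ⟨z, hz, -⟩ := hφ₁ y
    · exact f.collageFil_mono r.le_succ h
    · exact hz ▸ z.pt_mem
  have hH : Continuous fun q : (Fin n → I) × I => G (⟨φ₁ q.1, hmem q.1⟩, q.2) := by fun_prop
  refine ⟨⟨fun y => G (⟨φ₁ y, hmem y⟩, 1), by fun_prop⟩, hhom.trans
    (ContinuousMap.HomotopicRel.of_continuous hH (fun y => hG0 _) (fun y => rfl)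
      fun y hy τ => hGr _ _ ?_), fun y => ?_⟩
  · have h2 : φ y = φ₁ y := hhom.fst_eq_snd hy
    change φ₁ y ∈ _
    rw [← h2]
    exact hy
  · obtain h | ⟨z, hz, hzg⟩ := hφ₁ y
    · have h2 := hGr ⟨φ₁ y, hmem y⟩ 1 h
      exact h2 ▸ h
    · have h2 := hG z hzg
      simp only [hz] at h2
      exact h2

end TopologicalFunctor

/-! ### Compression into `BX` -/

namespace TopologicalFunctor

open TopologicalCategory

variable {X Y : TopologicalCategory.{u}} {f : TopologicalFunctor X Y}

/-- The image of a compact space is contained in a stage of the filtration. Otherwise, there would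
be a decreasing sequence of closed sets that all meet it, but whose intersection is empty: the union
of the subsets of the differences of consecutive stages `d ≥ k` where the function that vanishes on
the stage `d` is not too small. -/
theorem exists_forall_mem_collageFil (hY : Y.IsWellPointed) {K : Type*} [TopologicalSpace K]
    [CompactSpace K] (φ : C(K, f.CollageRealization)) : ∃ r, ∀ y, φ y ∈ f.collageFil r := by
  obtain ⟨u, -, -, hu, -⟩ := hY
  choose w hw using fun d : ℕ => exists_gap (f := f) (r := d) hu
  have hc (d : ℕ) : ∃ c : ℝ, 0 < c ∧ ((∃ y, φ y ∈ f.collageFil (d + 1) ∧ φ y ∉ f.collageFil d) →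
      ∃ (y : K) (h : φ y ∈ f.collageFil (d + 1)), c ≤ w d ⟨φ y, h⟩) := by
    by_cases h : ∃ y, φ y ∈ f.collageFil (d + 1) ∧ φ y ∉ f.collageFil d
    · obtain ⟨y, h1, h2⟩ := h
      refine ⟨w d ⟨φ y, h1⟩, lt_of_le_of_ne ((hw d).2.1 _) fun h => h2 ?_, fun _ => ⟨y, h1, le_rfl⟩⟩
      exact ((hw d).2.2 ⟨φ y, h1⟩).1 h.symm
    · exact ⟨1, one_pos, fun h' => absurd h' h⟩
  choose c hc0 hc using hc
  -- By the choice of the bound `c d`, the set `C d` meets the image of `φ` if the latter meets the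
  -- difference of the stages `d` and `d + 1`.
  let C (d : ℕ) : Set f.CollageRealization := Subtype.val '' {b | c d ≤ w d b}
  have hC (d : ℕ) : IsClosed (C d) :=
    (f.isClosed_collageFil (d + 1)).isClosedEmbedding_subtypeVal.isClosedMap _
      (isClosed_le continuous_const (w d).continuous)
  have hCd {d : ℕ} {b : f.CollageRealization} (hb : b ∈ C d) : b ∉ f.collageFil d := by
    obtain ⟨b, hb, rfl⟩ := hb
    intro h
    have h1 : c d ≤ w d b := hb
    rw [((hw d).2.2 b).2 h] at h1
    exact absurd (hc0 d) (not_lt.2 h1)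
  let A (k : ℕ) : Set f.CollageRealization := ⋃ d ∈ Set.Ici k, C d
  have hA (k : ℕ) : IsClosed (A k) := by
    refine f.isClosed_of_forall_inter_collageFil fun r => ?_
    have : A k ∩ f.collageFil r = (⋃ d ∈ Set.Ico k r, C d) ∩ f.collageFil r := by
      ext b
      simp only [A, Set.mem_inter_iff, Set.mem_iUnion, Set.mem_Ici, Set.mem_Ico, exists_prop]
      refine and_congr_left fun hb => exists_congr fun d =>
        ⟨fun h => ⟨⟨h.1, ?_⟩, h.2⟩, fun h => ⟨h.1.1, h.2⟩⟩
      by_contra! hd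
      exact hCd h.2 (f.collageFil_mono hd hb)
    rw [this]
    exact ((Set.finite_Ico k r).isClosed_biUnion fun d _ => hC d).inter (f.isClosed_collageFil r)
  by_contra! hφ
  have hne (k : ℕ) : (φ ⁻¹' A k).Nonempty := by
    obtain ⟨y, hy⟩ := hφ k
    have hex : ∃ d, φ y ∈ f.collageFil d := by
      obtain ⟨n, b, t, hb⟩ := f.exists_cpt (φ y)
      exact ⟨n + 1, hb ▸ f.cpt_mem_collageFil b t⟩
    classical
    have hkd : k < Nat.find hex := by
      by_contra! h
      exact hy (f.collageFil_mono h (Nat.find_spec hex))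
    obtain ⟨d, hd⟩ := Nat.exists_eq_add_of_lt hkd
    obtain ⟨y', h1, h2⟩ := hc (k + d) ⟨y, hd ▸ Nat.find_spec hex, Nat.find_min hex (by omega)⟩
    exact ⟨y', Set.mem_biUnion (Nat.le_add_right k d) ⟨⟨φ y', h1⟩, h2, rfl⟩⟩
  obtain ⟨y, hy⟩ := IsCompact.nonempty_iInter_of_sequence_nonempty_isCompact_isClosed
    (fun k => φ ⁻¹' A k) (fun k => Set.preimage_mono
      (Set.biUnion_subset_biUnion_left (Set.Ici_subset_Ici.2 k.le_succ))) hne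
    ((hA 0).preimage φ.continuous).isCompact fun k => (hA k).preimage φ.continuous
  obtain ⟨n, b, t, hb⟩ := f.exists_cpt (φ y)
  have h1 := Set.mem_iInter.1 hy (n + 1)
  simp only [A, Set.mem_preimage, Set.mem_iUnion, Set.mem_Ici, exists_prop] at h1
  obtain ⟨d, hd, h1⟩ := h1
  refine hCd h1 (f.collageFil_mono hd ?_)
  rw [hb]
  exact f.cpt_mem_collageFil b t

/-- Maps of cubes to the classifying space of the collage can be deformed into `BX`. -/
theorem exists_compression_zero (hY : Y.IsWellPointed)
    (hρ : IsAcyclicSerreFibration f.classifyingRho) {n : ℕ}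
    (φ : C(Fin n → I, f.CollageRealization)) :
    ∃ φ' : C(Fin n → I, f.CollageRealization),
      φ.HomotopicRel φ' {y | φ y ∈ f.collageFil 0} ∧ ∀ y, φ' y ∈ f.collageFil 0 := by
  obtain ⟨r, hr⟩ := exists_forall_mem_collageFil hY φ
  induction r generalizing φ with
  | zero => exact ⟨φ, ContinuousMap.HomotopicRel.refl φ, hr⟩
  | succ r ih =>
    obtain ⟨φ₁, h1, hφ₁⟩ := exists_compression hY hρ φ hr
    obtain ⟨φ₂, h2, hφ₂⟩ := ih φ₁ hφ₁
    have h1' : φ.HomotopicRel φ₁ {y | φ y ∈ f.collageFil 0} :=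
      h1.mono fun y hy => f.collageFil_mono (Nat.zero_le r) hy
    refine ⟨φ₂, h1'.trans (h2.mono fun y hy => ?_), hφ₂⟩
    change φ₁ y ∈ f.collageFil 0
    rw [← h1'.fst_eq_snd hy]
    exact hy

/-- The homotopy of `exists_cylinder` turns a map of a cube to `BY`, with a lift of the boundary to
`BX`, into a map to the classifying space of the collage that sends the boundary to `BX`. -/
theorem compressesCubes_classifyingMap (hY : Y.IsWellPointed)
    (hρ : IsAcyclicSerreFibration f.classifyingRho) : CompressesCubes f.classifyingMap := by
  classical
  intro n φ g hg
  obtain ⟨D, hD0, hD1, hD⟩ := f.exists_cylinder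
  -- The map to the cylinder on the open box that is `φ` at time `0`, and that moves from the image
  -- of `g` in `Y` to `g` on the boundary.
  let ψ : (Fin n → I) × I → f.CollageRealization := fun q =>
    if h : q.1 ∈ Cube.boundary (Fin n) then D (g ⟨q.1, h⟩, unitInterval.symm q.2)
    else GeometricRealization.map f.inclY (φ q.1)
  have hψb (q : (Fin n → I) × I) (h : q.1 ∈ Cube.boundary (Fin n)) :
      ψ q = D (g ⟨q.1, h⟩, unitInterval.symm q.2) := dif_pos h
  have hψ0 (q : (Fin n → I) × I) (h : q.2 = 0) :
      ψ q = GeometricRealization.map f.inclY (φ q.1) := by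
    by_cases hq : q.1 ∈ Cube.boundary (Fin n)
    · rw [hψb q hq, h, unitInterval.symm_zero, hD1, hg]
    · exact dif_neg hq
  have hψc : ContinuousOn ψ (openBox (Cube.boundary (Fin n))) := by
    refine ContinuousOn.union_of_isClosed (s := {q : (Fin n → I) × I | q.2 = 0})
      (t := {q : (Fin n → I) × I | q.1 ∈ Cube.boundary (Fin n)}) ?_ ?_
      (isClosed_eq continuous_snd continuous_const)
      ((isClosed_cubeBoundary n).preimage continuous_fst)
    · exact ContinuousOn.congr
        (f := fun q : (Fin n → I) × I => GeometricRealization.map f.inclY (φ q.1)) (by fun_prop)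
        fun q hq => hψ0 q hq
    · rw [continuousOn_iff_continuous_domRestrict]
      have : Continuous fun q : {q : (Fin n → I) × I | q.1 ∈ Cube.boundary (Fin n)} =>
          D (g ⟨q.1.1, q.2⟩, unitInterval.symm q.1.2) := by fun_prop
      exact this.congr fun q => (hψb q.1 q.2).symm
  have hψs (q : (Fin n → I) × I) : GeometricRealization.map f.shadowMap (ψ q) = φ q.1 := by
    by_cases hq : q.1 ∈ Cube.boundary (Fin n)
    · rw [hψb q hq, hD, hg]
    · exact (congrArg _ (dif_neg hq)).trans (f.map_shadowMap_inclY _)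
  let Ψ : C((Fin n → I) × I, f.CollageRealization) :=
    ⟨fun q => ψ (boxFlow q 0), hψc.comp_continuous
      (continuous_boxFlow.comp (continuous_id.prodMk continuous_const)) boxFlow_zero_mem⟩
  have hΨ (q : (Fin n → I) × I) (hq : q ∈ openBox (Cube.boundary (Fin n))) : Ψ q = ψ q :=
    congrArg ψ (boxFlow_zero_eq_self hq)
  let φ₁ : C(Fin n → I, f.CollageRealization) := ⟨fun y => Ψ (y, 1), by fun_prop⟩
  have hφ₁ (y : Fin n → I) (hy : y ∈ Cube.boundary (Fin n)) :
      φ₁ y = GeometricRealization.map f.inclX (g ⟨y, hy⟩) := by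
    refine (hΨ (y, 1) (Or.inr hy)).trans ?_
    rw [hψb (y, 1) hy, unitInterval.symm_one, hD0]
  obtain ⟨φ₂, hhom, hφ₂⟩ := exists_compression_zero hY hρ φ₁
  have hbd : Cube.boundary (Fin n) ⊆ {y | φ₁ y ∈ f.collageFil 0} := by
    intro y hy
    change φ₁ y ∈ f.collageFil 0
    rw [hφ₁ y hy, ← range_inclX]
    exact Set.mem_range_self _
  have hhom' := hhom.mono hbd
  choose G hG using fun y => (f.range_inclX ▸ hφ₂ y :
    φ₂ y ∈ Set.range (GeometricRealization.map f.inclX))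
  have hGc : Continuous G := f.isClosedEmbedding_inclX.isEmbedding.continuous_iff.2
    (φ₂.continuous.congr fun y => (hG y).symm)
  refine ⟨⟨G, hGc⟩, fun y => f.isClosedEmbedding_inclX.injective ?_, ?_⟩
  · rw [← hφ₁ y y.2, hhom'.fst_eq_snd y.2]
    exact hG y
  · have h1 : f.classifyingMap.comp ⟨G, hGc⟩ = (GeometricRealization.map f.shadowMap).comp φ₂ := by
      ext y
      change f.classifyingMap (G y) = GeometricRealization.map f.shadowMap (φ₂ y)
      rw [← hG y, map_shadowMap_inclX]
    rw [h1]
    refine ((ContinuousMap.HomotopicRel.of_continuous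
      (H := fun q => GeometricRealization.map f.shadowMap (Ψ q)) (by fun_prop) (fun y => ?_)
        (fun y => rfl) fun y hy τ => ?_).trans
      (hhom'.comp_continuousMap (GeometricRealization.map f.shadowMap))).symm
    · rw [hΨ _ (Or.inl rfl), hψs]
    · rw [hΨ _ (Or.inr hy), hψs]

end TopologicalFunctor

theorem theoremA {X Y : TopologicalCategory.{u}} (f : TopologicalFunctor X Y)
    (hX : X.IsWellPointed) (hY : Y.IsWellPointed)
    (hρ : IsAcyclicSerreFibration f.classifyingRho) :
    IsWeakHomotopyEquiv f.classifyingMap :=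
  (TopologicalFunctor.compressesCubes_classifyingMap hY hρ).isWeakHomotopyEquiv
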